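/- **Conventions.** Let $\mathcal A$ be a unital C*-algebra generated (as a unital C*-algebra) by finitely many self-adjoint elements $x_1,\dots,x_n$. $\mathcal M_k(\mathbb C)$ carries the operator norm, $\mathcal M_k(\mathbb C)^n$ the norm $\|(A_1,\dots,A_n)\|=\max_i\|A_i\|$, and $\tau_k=\frac1k\mathrm{Tr}$. Let $\{Q_r\}_{r\ge 1}$ be any enumeration of the noncommutative polynomials in $X_1,\dots,X_n$ with coefficients in $\mathbb Q+i\mathbb Q$. *Topological free entropy dimension.* For $R,\varepsilon>0$ let $\Gamma_R^{(\mathrm{top})}(x_1,\dots,x_n;k,\varepsilon,Q_1,\dots,Q_r)$ be the set of $n$-tuples $(A_1,\dots,A_n)$ of self-adjoint $k\times k$ complex matrices with $\|A_i\|\le R$ for all $i$ and $\bigl|\,\|Q_j(A_1,\dots,A_n)\|-\|Q_j(x_1,\dots,x_n)\|\,\bigr|\le\varepsilon$ for $1\le j\le r$. For $\Sigma\subseteq\mathcal M_k(\mathbb C)^n$ let $\nu_\infty(\Sigma,\omega)$ be the minimal number of open norm balls of radius $\omega$ with centers in $\Sigma$ that cover $\Sigma$. Put, with $\log 0=-\infty$,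 $$\delta_{\mathrm{top}}(x_1,\dots,x_n;\omega)=\sup_{R>0}\ \inf_{\varepsilon>0,\,r\in\mathbb N}\ \limsup_{k\to\infty}\frac{\log \nu_\infty\bigl(\Gamma_R^{(\mathrm{top})}(x_1,\dots,x_n;k,\varepsilon,Q_1,\dots,Q_r),\omega\bigr)}{-k^2\log\omega},$$ $$\delta_{\mathrm{top}}(x_1,\dots,x_n)=\limsup_{\omega\to0^+}\delta_{\mathrm{top}}(x_1,\dots,x_n;\omega).$$ *MF-nuclearity.* $\mathcal A$ is an *MF algebra* if it embeds in $\prod_k\mathcal M_{m_k}(\mathbb C)/\sum_k\mathcal M_{m_k}(\mathbb C)$ (bounded sequences modulo sequences converging to $0$ in norm) for some increasing sequence $(m_k)$ of positive integers. A tracial state $\tau$ on $\mathcal A$ is an *MF-trace* if there are positive integers $m_k$ and tuples $(A_{1k},\dots,A_{nk})\in\mathcal M_{m_k}(\mathbb C)^n$ such that, for every $*$-polynomial $Q$, $\|Q(A_{1k},\dots,A_{nk})\|\to\|Q(x_1,\dots,x_n)\|$ and $\tau_{m_k}(Q(A_{1k},\dots,A_{nk}))\to\tau(Q(x_1,\dots,x_n))$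 as $k\to\infty$. $\mathcal A$ is *MF-nuclear* if it is an MF algebra and, for every MF-trace $\tau$ with GNS representation $\pi_\tau$, the von Neumann algebra $\pi_\tau(\mathcal A)''$ is hyperfinite, i.e. contains an increasing sequence of finite-dimensional $*$-subalgebras whose union is dense in it for the strong operator topology. **Theorem 3.3.** If $\mathcal A$ is MF-nuclear, then $$\delta_{\mathrm{top}}(x_1,\dots,x_n)\le 1.$$ -/

import Mathlib

open Filter Topology
open scoped ENNReal ComplexOrder Matrix.Norms.L2Operator

/-! Throughout, `Matrix (Fin k) (Fin k) ℂ` carries the operator norm of its action on `ℂᵏ` with the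
Euclidean norm, and a tuple `Fin n → Matrix (Fin k) (Fin k) ℂ` carries the maximum of the norms of
its entries. Noncommutative polynomials are elements of `FreeAlgebra ℂ _`, and
`FreeAlgebra.lift ℂ x p` is the value of `p` at the tuple `x`. -/

namespace TopFreeEntropy

noncomputable section

/-! ### Topological free entropy dimension -/

/-- The noncommutative polynomials in `X₁, …, Xₙ` with coefficients in `ℚ + iℚ`, as the
`ℚ`-subalgebra of `ℂ⟨X₁, …, Xₙ⟩` generated by the scalar `i` and by the indeterminates. -/
def complexRationalPolynomials (n : ℕ) : Set (FreeAlgebra ℂ (Fin n)) :=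
  (Algebra.adjoin ℚ
    (insert (algebraMap ℂ (FreeAlgebra ℂ (Fin n)) Complex.I)
      (Set.range (FreeAlgebra.ι ℂ : Fin n → FreeAlgebra ℂ (Fin n)))) :
    Subalgebra ℚ (FreeAlgebra ℂ (Fin n)))

/-- The norm-microstate space of `x₁, …, xₙ` with parameters `R`, `k`, `ε` and the first `r`
members of the sequence `Q` of noncommutative polynomials: the tuples of self-adjoint `k × k`
matrices of norm at most `R` for which `| ‖Q_j(A)‖ - ‖Q_j(x)‖ | ≤ ε` for all these members. -/
def microstates {A : Type*} [CStarAlgebra A] {n : ℕ} (x : Fin n → A)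
    (Q : ℕ → FreeAlgebra ℂ (Fin n)) (R : ℝ) (k : ℕ) (ε : ℝ) (r : ℕ) :
    Set (Fin n → Matrix (Fin k) (Fin k) ℂ) :=
  {a | (∀ i, IsSelfAdjoint (a i)) ∧ (∀ i, ‖a i‖ ≤ R) ∧
    ∀ j < r, |‖FreeAlgebra.lift ℂ a (Q j)‖ - ‖FreeAlgebra.lift ℂ x (Q j)‖| ≤ ε}

/-- The minimal number of open operator-norm balls of radius `ω`, with centres in `K`, that
cover `K`. -/
def coveringNumber {n k : ℕ} (K : Set (Fin n → Matrix (Fin k) (Fin k) ℂ)) (ω : ℝ) : ℕ∞ :=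
  ⨅ (C : Set (Fin n → Matrix (Fin k) (Fin k) ℂ)) (_ : C ⊆ K)
    (_ : K ⊆ ⋃ b ∈ C, Metric.ball b ω), C.encard

/-- `δ_top(x₁, …, xₙ; ω)`, an extended real number (with `log 0 = -∞`). -/
def deltaTopAt {A : Type*} [CStarAlgebra A] {n : ℕ} (x : Fin n → A)
    (Q : ℕ → FreeAlgebra ℂ (Fin n)) (ω : ℝ) : EReal :=
  ⨆ (R : ℝ) (_ : 0 < R), ⨅ (ε : ℝ) (_ : 0 < ε) (r : ℕ),
    limsup (fun k : ℕ ↦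
      ENNReal.log (coveringNumber (microstates x Q R k ε r) ω : ℝ≥0∞) /
        ((-((k : ℝ) ^ 2 * Real.log ω) : ℝ) : EReal)) atTop

/-- The topological free entropy dimension `δ_top(x₁, …, xₙ)`, computed with the enumeration `Q` of
the complex-rational noncommutative polynomials. -/
def deltaTop {A : Type*} [CStarAlgebra A] {n : ℕ} (x : Fin n → A)
    (Q : ℕ → FreeAlgebra ℂ (Fin n)) : EReal :=
  limsup (fun ω : ℝ ↦ deltaTopAt x Q ω) (𝓝[>] 0)

/-! ### MF algebras -/

/-- The C⋆-algebra `∏ₖ M_{m k}(ℂ)` of bounded sequences of matrices. -/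
abbrev BoundedSeq (m : ℕ → ℕ+) : Type :=
  lp (fun k : ℕ ↦ Matrix (Fin (m k)) (Fin (m k)) ℂ) ∞

/-- The ideal `∑ₖ M_{m k}(ℂ)` of the sequences of matrices whose norms tend to `0`. -/
def nullIdeal (m : ℕ → ℕ+) : Ideal (BoundedSeq m) where
  carrier := {T | Tendsto (fun k ↦ ‖T k‖) atTop (𝓝 0)}
  zero_mem' := by simp
  add_mem' {S T} hS hT := by
    refine squeeze_zero (fun _ ↦ norm_nonneg _) (fun k ↦ ?_) (by simpa using hS.add hT)
    simpa using norm_add_le (S k) (T k)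
  smul_mem' S T hT := by
    refine squeeze_zero (fun _ ↦ norm_nonneg _) (fun k ↦ ?_) (by simpa using hT.const_mul ‖S‖)
    calc ‖(S • T) k‖ = ‖S k * T k‖ := by simp
      _ ≤ ‖S k‖ * ‖T k‖ := norm_mul_le _ _
      _ ≤ ‖S‖ * ‖T k‖ := by gcongr; exact lp.norm_apply_le_norm (by simp) S k

instance nullIdeal_isTwoSided (m : ℕ → ℕ+) : (nullIdeal m).IsTwoSided where
  mul_mem_of_left {T} S hT := by
    refine squeeze_zero (fun _ ↦ norm_nonneg _) (fun k ↦ ?_)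
      (by simpa using Tendsto.mul_const ‖S‖ hT)
    calc ‖(T * S) k‖ = ‖T k * S k‖ := by simp
      _ ≤ ‖T k‖ * ‖S k‖ := norm_mul_le _ _
      _ ≤ ‖T k‖ * ‖S‖ := by gcongr; exact lp.norm_apply_le_norm (by simp) S k

/-- The quotient `∏ₖ M_{m k}(ℂ) / ∑ₖ M_{m k}(ℂ)`. -/
abbrev SeqQuotient (m : ℕ → ℕ+) : Type := BoundedSeq m ⧸ nullIdeal m

/-- The adjoint on the quotient, induced by the entrywise adjoint. -/
instance instStarSeqQuotient (m : ℕ → ℕ+) : Star (SeqQuotient m) where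
  star := Quotient.map' (star : BoundedSeq m → BoundedSeq m) fun S T h ↦ by
    rw [Submodule.quotientRel_def] at h ⊢
    rw [← star_sub]
    change Tendsto (fun k ↦ ‖(star (S - T)) k‖) atTop (𝓝 0)
    have h' : Tendsto (fun k ↦ ‖(S - T) k‖) atTop (𝓝 0) := h
    simpa only [lp.star_apply, norm_star] using h'

/-- `A` is an MF algebra: it embeds, by an injective ⋆-homomorphism, in
`∏ₖ M_{m k}(ℂ) / ∑ₖ M_{m k}(ℂ)` for an increasing sequence `m` of positive integers. -/
def IsMFAlgebra (A : Type*) [CStarAlgebra A] : Prop :=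
  ∃ m : ℕ → ℕ+, StrictMono m ∧ ∃ Φ : A →⋆ₙₐ[ℂ] SeqQuotient m, Function.Injective Φ

/-! ### MF-traces, hyperfiniteness, MF-nuclear algebras -/

/-- Evaluation of a noncommutative ⋆-polynomial in `n` variables: the indeterminate `Sum.inl i` is
replaced by `x i` and the indeterminate `Sum.inr i` by `star (x i)`. -/
def starEval {B : Type*} [Ring B] [Algebra ℂ B] [Star B] {n : ℕ} (x : Fin n → B)
    (p : FreeAlgebra ℂ (Fin n ⊕ Fin n)) : B :=
  FreeAlgebra.lift ℂ (Sum.elim x fun i ↦ star (x i)) p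

variable {A : Type*} [CStarAlgebra A] [PartialOrder A] [StarOrderedRing A]

/-- Tracial states. -/
def IsTracialState (τ : A →ₚ[ℂ] ℂ) : Prop :=
  τ 1 = 1 ∧ ∀ a b : A, τ (a * b) = τ (b * a)

/-- `τ` is an MF-trace on the C⋆-algebra generated by `x₁, …, xₙ`: a tracial state which, along
some sequence of tuples of matrices, is on every ⋆-polynomial the limit of the normalized traces
while the norm of the ⋆-polynomial is the limit of the matrix norms. -/
def IsMFTrace {n : ℕ} (x : Fin n → A) (τ : A →ₚ[ℂ] ℂ) : Prop :=
  IsTracialState τ ∧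
  ∃ (m : ℕ → ℕ+) (a : ∀ k : ℕ, Fin n → Matrix (Fin (m k)) (Fin (m k)) ℂ),
    ∀ p : FreeAlgebra ℂ (Fin n ⊕ Fin n),
      Tendsto (fun k ↦ ‖starEval (a k) p‖) atTop (𝓝 ‖starEval x p‖) ∧
      Tendsto (fun k ↦ (starEval (a k) p).trace / ((m k : ℕ) : ℂ)) atTop (𝓝 (τ (starEval x p)))

/-- The von Neumann algebra `S''` generated by a unital ⋆-algebra `S` of operators: the commutant of
the von Neumann algebra `S'`. -/
def doubleCommutant {H : Type*} [NormedAddCommGroup H] [InnerProductSpace ℂ H] [CompleteSpace H]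
    (S : StarSubalgebra ℂ (H →L[ℂ] H)) : VonNeumannAlgebra H :=
  VonNeumannAlgebra.commutant
    { StarSubalgebra.centralizer ℂ (S : Set (H →L[ℂ] H)) with
      centralizer_centralizer' := by
        change Set.centralizer (Set.centralizer
          (StarSubalgebra.centralizer ℂ (S : Set (H →L[ℂ] H)) : Set (H →L[ℂ] H))) =
            (StarSubalgebra.centralizer ℂ (S : Set (H →L[ℂ] H)) : Set (H →L[ℂ] H))
        rw [StarSubalgebra.coe_centralizer, Set.centralizer_centralizer_centralizer] }

/-- The carrier of `doubleCommutant S` is the double centralizer of `S`. -/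
theorem coe_doubleCommutant {H : Type*} [NormedAddCommGroup H] [InnerProductSpace ℂ H]
    [CompleteSpace H] (S : StarSubalgebra ℂ (H →L[ℂ] H)) :
    (doubleCommutant S : Set (H →L[ℂ] H)) =
      Set.centralizer (Set.centralizer (S : Set (H →L[ℂ] H))) := by
  have hS : star (S : Set (H →L[ℂ] H)) = S := by
    ext T
    simp
  rw [doubleCommutant, VonNeumannAlgebra.coe_commutant]
  change Set.centralizer
    (StarSubalgebra.centralizer ℂ (S : Set (H →L[ℂ] H)) : Set (H →L[ℂ] H)) = _
  rw [StarSubalgebra.coe_centralizer, hS, Set.union_self]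

/-- `M` is hyperfinite: it contains an increasing sequence of finite-dimensional ⋆-subalgebras
whose union is dense in `M` for the strong operator topology. -/
def IsHyperfinite {H : Type*} [NormedAddCommGroup H] [InnerProductSpace ℂ H] [CompleteSpace H]
    (M : VonNeumannAlgebra H) : Prop :=
  ∃ F : ℕ → StarSubalgebra ℂ (H →L[ℂ] H), Monotone F ∧
    (∀ j, F j ≤ M.toStarSubalgebra) ∧ (∀ j, FiniteDimensional ℂ (F j)) ∧
    ∀ T ∈ M, ∀ s : Finset H, ∀ ε > (0 : ℝ), ∃ j, ∃ S ∈ F j, ∀ v ∈ s, ‖T v - S v‖ < ε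

/-- The C⋆-algebra `A`, generated by `x₁, …, xₙ`, is MF-nuclear: it is an MF algebra, and
`π_τ(A)''` is hyperfinite for each MF-trace `τ`, where `π_τ` is the GNS representation of `τ`. -/
def IsMFNuclear {n : ℕ} (x : Fin n → A) : Prop :=
  IsMFAlgebra A ∧ ∀ τ : A →ₚ[ℂ] ℂ, IsMFTrace x τ →
    IsHyperfinite (doubleCommutant τ.gnsStarAlgHom.range)

/-- The unital C⋆-algebra `A` is generated by `x₁, …, xₙ`. -/
def Generates {A : Type*} [CStarAlgebra A] {n : ℕ} (x : Fin n → A) : Prop :=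
  (StarAlgebra.adjoin ℂ (Set.range x)).topologicalClosure = ⊤

end

end TopFreeEntropy

/-! The exponent 1 is the dimension of the unitary group: `U(k)` has real dimension `k²`, hence an
operator-norm net at scale `ω` of about `(C / ω) ^ k²` points. The rest is to show that everything
else about a microstate costs only a factor `K ^ k²` with `K` independent of `ω`; such a factor
disappears after division by `-k² log ω` as `ω → 0`.

Fix `ω₁ > 0`. Microstates of good precision and large size whose moments nearly agree are unitarily
conjugate up to `ω₁` in the normalized Hilbert–Schmidt norm (`exists_nhds_unitary_hs_le`). Otherwise
two sequences of counterexamples have the same limiting moments; their norms converge as well, so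
they define an MF-trace, whose von Neumann algebra is hyperfinite, and Jung's theorem
(`exists_unitary_hs_le`) makes the two sequences approximately conjugate. Moments range over a
compact product of discs, so finitely many unitary orbits suffice, their number being independent of
`k` (`exists_finset_unitary_hs_le`).

The definition uses operator-norm balls, so a Hilbert–Schmidt error must be covered in operator
norm. A self-adjoint matrix of small Hilbert–Schmidt norm has few large eigenvalues, hence is close
in operator norm to a matrix of rank at most a small proportion of `k`; if `ω₁` is chosen small
after `ω`, these errors have a net of at most `4 ^ k²` points (`exists_net_hs_ball`).

Jung's theorem reduces by hyperfiniteness to a finite-dimensional ⋆-algebra `F`. Lifting `F` to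
polynomials turns two microstate sequences into asymptotic homomorphisms `α`, `β` of `F` with
asymptotically equal traces. With a symmetric separability idempotent `∑ cₗ ⊗ cₗ⋆` of `F`, choose a
unitary maximizing the Hilbert–Schmidt norm of `∑ β(cₗ) u α(cₗ)⋆` and conjugate it to `1`.
Maximality makes the average of `1` asymptotically positive, hence a projection on which `α` and `β`
agree; on the complementary corner, maximality and equality of traces force the trace to vanish
(`IsCasimir.exists_unitary_tendsto_hs`). -/

namespace TopFreeEntropy

/-! ### The normalized trace and the normalized Hilbert–Schmidt norm -/

section HilbertSchmidt

variable {k : ℕ}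

/-- The normalized trace. -/
noncomputable def ntr (X : Matrix (Fin k) (Fin k) ℂ) : ℂ := X.trace / (k : ℂ)

/-- A matrix as a vector of the Euclidean space `ℂ^(k × k)`. -/
noncomputable def vecE : Matrix (Fin k) (Fin k) ℂ →ₗ[ℂ] EuclideanSpace ℂ (Fin k × Fin k) where
  toFun X := WithLp.toLp 2 fun p ↦ X p.1 p.2
  map_add' _ _ := by ext; simp
  map_smul' _ _ := by ext; simp

/-- The normalized Hilbert–Schmidt norm. -/
noncomputable def hs (X : Matrix (Fin k) (Fin k) ℂ) : ℝ := ‖vecE X‖ / √k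

theorem norm_sq_vecE (X : Matrix (Fin k) (Fin k) ℂ) :
    ‖vecE X‖ ^ 2 = ∑ j, ∑ i, ‖X i j‖ ^ 2 := by
  rw [EuclideanSpace.norm_sq_eq, Fintype.sum_prod_type, Finset.sum_comm]
  rfl

theorem inner_vecE (X Y : Matrix (Fin k) (Fin k) ℂ) :
    inner ℂ (vecE X) (vecE Y) = (star X * Y).trace := by
  rw [PiLp.inner_apply, Fintype.sum_prod_type, Finset.sum_comm, Matrix.trace]
  refine Finset.sum_congr rfl fun j _ ↦ ?_
  rw [Matrix.diag_apply, Matrix.mul_apply]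
  refine Finset.sum_congr rfl fun i _ ↦ ?_
  simp [vecE, Matrix.star_apply, mul_comm]

theorem hs_nonneg (X : Matrix (Fin k) (Fin k) ℂ) : 0 ≤ hs X := by
  unfold hs; positivity

@[simp] theorem hs_zero : hs (0 : Matrix (Fin k) (Fin k) ℂ) = 0 := by simp [hs]

theorem hs_add_le (X Y : Matrix (Fin k) (Fin k) ℂ) : hs (X + Y) ≤ hs X + hs Y := by
  unfold hs
  rw [← add_div, map_add]
  gcongr
  exact norm_add_le _ _

theorem hs_neg (X : Matrix (Fin k) (Fin k) ℂ) : hs (-X) = hs X := by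
  simp [hs]

theorem hs_sub_le (X Y : Matrix (Fin k) (Fin k) ℂ) : hs (X - Y) ≤ hs X + hs Y := by
  rw [sub_eq_add_neg, ← hs_neg Y]; exact hs_add_le _ _

theorem hs_sub_comm (X Y : Matrix (Fin k) (Fin k) ℂ) : hs (X - Y) = hs (Y - X) := by
  rw [← hs_neg, neg_sub]

theorem hs_smul (c : ℂ) (X : Matrix (Fin k) (Fin k) ℂ) : hs (c • X) = ‖c‖ * hs X := by
  rw [hs, map_smul, norm_smul, mul_div_assoc, hs]

theorem norm_vecE_star (X : Matrix (Fin k) (Fin k) ℂ) : ‖vecE (star X)‖ = ‖vecE X‖ := by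
  rw [← sq_eq_sq₀ (norm_nonneg _) (norm_nonneg _), norm_sq_vecE, norm_sq_vecE, Finset.sum_comm]
  simp [Matrix.star_apply]

theorem hs_star (X : Matrix (Fin k) (Fin k) ℂ) : hs (star X) = hs X := by
  rw [hs, norm_vecE_star, hs]

/-- Left multiplication acts on each column of `Y` separately, and the square of the Hilbert–Schmidt
norm is the sum over the columns. -/
theorem norm_vecE_mul_le (X Y : Matrix (Fin k) (Fin k) ℂ) :
    ‖vecE (X * Y)‖ ≤ ‖X‖ * ‖vecE Y‖ := by
  rw [← sq_le_sq₀ (norm_nonneg _) (by positivity), mul_pow, norm_sq_vecE, norm_sq_vecE,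
    Finset.mul_sum]
  refine Finset.sum_le_sum fun j _ ↦ ?_
  have h := Matrix.l2_opNorm_mulVec X (WithLp.toLp 2 fun i ↦ Y i j)
  rw [← sq_le_sq₀ (norm_nonneg _) (by positivity), mul_pow, EuclideanSpace.norm_sq_eq,
    EuclideanSpace.norm_sq_eq] at h
  simpa [Matrix.mulVec, dotProduct, Matrix.mul_apply] using h

theorem hs_mul_le_norm_mul (X Y : Matrix (Fin k) (Fin k) ℂ) : hs (X * Y) ≤ ‖X‖ * hs Y := by
  unfold hs
  rw [← mul_div_assoc]
  gcongr
  exact norm_vecE_mul_le X Y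

theorem hs_mul_le_mul_norm (X Y : Matrix (Fin k) (Fin k) ℂ) : hs (X * Y) ≤ hs X * ‖Y‖ := by
  rw [← hs_star, star_mul, mul_comm, ← norm_star Y, ← hs_star X]
  exact hs_mul_le_norm_mul _ _

theorem hs_one_le : hs (1 : Matrix (Fin k) (Fin k) ℂ) ≤ 1 := by
  unfold hs
  refine div_le_one_of_le₀ ?_ (by positivity)
  apply Real.le_sqrt_of_sq_le
  rw [norm_sq_vecE]
  simp [Matrix.one_apply, apply_ite]

theorem hs_le_norm (X : Matrix (Fin k) (Fin k) ℂ) : hs X ≤ ‖X‖ := by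
  have h := hs_mul_le_norm_mul X 1
  rw [mul_one] at h
  exact h.trans (mul_le_of_le_one_right (norm_nonneg _) hs_one_le)

theorem ntr_add (X Y : Matrix (Fin k) (Fin k) ℂ) : ntr (X + Y) = ntr X + ntr Y := by
  simp [ntr, add_div]

theorem ntr_sub (X Y : Matrix (Fin k) (Fin k) ℂ) : ntr (X - Y) = ntr X - ntr Y := by
  simp [ntr, sub_div]

theorem ntr_smul (c : ℂ) (X : Matrix (Fin k) (Fin k) ℂ) : ntr (c • X) = c * ntr X := by
  simp [ntr, mul_div_assoc]

theorem ntr_sum {ι : Type*} (s : Finset ι) (X : ι → Matrix (Fin k) (Fin k) ℂ) :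
    ntr (∑ i ∈ s, X i) = ∑ i ∈ s, ntr (X i) := by
  simp [ntr, Matrix.trace_sum, Finset.sum_div]

theorem ntr_mul_comm (X Y : Matrix (Fin k) (Fin k) ℂ) : ntr (X * Y) = ntr (Y * X) := by
  rw [ntr, Matrix.trace_mul_comm, ntr]

theorem ntr_star (X : Matrix (Fin k) (Fin k) ℂ) : ntr (star X) = star (ntr X) := by
  simp [ntr, Matrix.star_eq_conjTranspose, Matrix.trace_conjTranspose]

theorem ntr_star_mul_self (X : Matrix (Fin k) (Fin k) ℂ) :
    ntr (star X * X) = ((hs X ^ 2 : ℝ) : ℂ) := by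
  rw [ntr, ← inner_vecE, inner_self_eq_norm_sq_to_K, hs, div_pow, Real.sq_sqrt (by positivity)]
  simp

theorem norm_ntr_star_mul_le (X Y : Matrix (Fin k) (Fin k) ℂ) :
    ‖ntr (star X * Y)‖ ≤ hs X * hs Y := by
  rw [ntr, ← inner_vecE, norm_div, hs, hs, div_mul_div_comm, Real.mul_self_sqrt (by positivity)]
  simp only [RCLike.norm_natCast]
  gcongr
  exact norm_inner_le_norm _ _

theorem norm_ntr_mul_le (X Y : Matrix (Fin k) (Fin k) ℂ) :
    ‖ntr (X * Y)‖ ≤ hs X * hs Y := by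
  have := norm_ntr_star_mul_le (star X) Y
  rwa [star_star, hs_star] at this

theorem norm_ntr_le (X : Matrix (Fin k) (Fin k) ℂ) : ‖ntr X‖ ≤ hs X := by
  have := norm_ntr_mul_le 1 X
  rw [one_mul] at this
  exact this.trans (mul_le_of_le_one_left (hs_nonneg _) hs_one_le)

theorem norm_le_one_of_mem_unitary {u : Matrix (Fin k) (Fin k) ℂ} (hu : u ∈ unitary _) :
    ‖u‖ ≤ 1 := by
  cases subsingleton_or_nontrivial (Matrix (Fin k) (Fin k) ℂ)
  · simp [Subsingleton.elim u 0]
  · exact (CStarRing.norm_of_mem_unitary hu).le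

theorem hs_unitary_mul {u : Matrix (Fin k) (Fin k) ℂ} (hu : u ∈ unitary _)
    (X : Matrix (Fin k) (Fin k) ℂ) : hs (u * X) = hs X := by
  have h1 := hs_mul_le_norm_mul u X
  have h2 := hs_mul_le_norm_mul (star u) (u * X)
  rw [← mul_assoc, Unitary.star_mul_self_of_mem hu, one_mul, norm_star] at h2
  have hu := norm_le_one_of_mem_unitary hu
  exact le_antisymm (h1.trans (mul_le_of_le_one_left (hs_nonneg _) hu))
    (h2.trans (mul_le_of_le_one_left (hs_nonneg _) hu))

theorem hs_mul_unitary {u : Matrix (Fin k) (Fin k) ℂ} (hu : u ∈ unitary _)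
    (X : Matrix (Fin k) (Fin k) ℂ) : hs (X * u) = hs X := by
  rw [← hs_star, star_mul, hs_unitary_mul (Unitary.star_mem hu), hs_star]

theorem continuous_hs : Continuous (hs : Matrix (Fin k) (Fin k) ℂ → ℝ) := by
  unfold hs
  have : Continuous (vecE : Matrix (Fin k) (Fin k) ℂ →ₗ[ℂ] EuclideanSpace ℂ (Fin k × Fin k)) :=
    LinearMap.continuous_of_finiteDimensional _
  fun_prop

end HilbertSchmidt

/-! ### Bounded sequences of matrices modulo sequences null in Hilbert–Schmidt norm -/

section SequenceQuotient

variable (m : ℕ → ℕ+)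

/-- The algebra of bounded sequences of matrices. -/
def boundedSeq : Subalgebra ℂ (∀ j : ℕ, Matrix (Fin (m j)) (Fin (m j)) ℂ) where
  carrier := {X | ∃ C : ℝ, ∀ j, ‖X j‖ ≤ C}
  mul_mem' := by
    rintro X Y ⟨C, hC⟩ ⟨D, hD⟩
    refine ⟨C * D, fun j ↦ (norm_mul_le _ _).trans ?_⟩
    exact mul_le_mul (hC j) (hD j) (norm_nonneg _) ((norm_nonneg _).trans (hC j))
  add_mem' := by
    rintro X Y ⟨C, hC⟩ ⟨D, hD⟩
    exact ⟨C + D, fun j ↦ (norm_add_le _ _).trans (add_le_add (hC j) (hD j))⟩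
  algebraMap_mem' r := by
    refine ⟨‖r‖ * 1, fun j ↦ ?_⟩
    rw [Pi.algebraMap_apply, Algebra.algebraMap_eq_smul_one, norm_smul]
    gcongr
    exact norm_le_one_of_mem_unitary (one_mem _)

/-- The ideal of the bounded sequences that are null in the normalized Hilbert–Schmidt norm. -/
def hsNull : Ideal (boundedSeq m) where
  carrier := {X | Tendsto (fun j ↦ hs ((X : ∀ j, Matrix (Fin (m j)) (Fin (m j)) ℂ) j)) atTop (𝓝 0)}
  zero_mem' := by simp
  add_mem' {S T} hS hT :=
    squeeze_zero (fun _ ↦ hs_nonneg _) (fun _ ↦ hs_add_le _ _) (by simpa using hS.add hT)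
  smul_mem' S T hT := by
    obtain ⟨C, hC⟩ := S.2
    refine squeeze_zero (fun _ ↦ hs_nonneg _) (fun j ↦ ?_) (by simpa using hT.const_mul C)
    exact (hs_mul_le_norm_mul _ _).trans (mul_le_mul_of_nonneg_right (hC j) (hs_nonneg _))

instance : (hsNull m).IsTwoSided where
  mul_mem_of_left {T} S hT := by
    obtain ⟨C, hC⟩ := S.2
    refine squeeze_zero (fun _ ↦ hs_nonneg _) (fun j ↦ ?_) (by simpa using Tendsto.mul_const C hT)
    exact (hs_mul_le_mul_norm _ _).trans (mul_le_mul_of_nonneg_left (hC j) (hs_nonneg _))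

/-- Bounded sequences of matrices modulo sequences null in Hilbert–Schmidt norm. -/
def HSQuotient : Type := boundedSeq m ⧸ hsNull m

noncomputable instance : Ring (HSQuotient m) := inferInstanceAs (Ring (boundedSeq m ⧸ hsNull m))

noncomputable instance : Algebra ℂ (HSQuotient m) :=
  inferInstanceAs (Algebra ℂ (boundedSeq m ⧸ hsNull m))

/-- The quotient map. -/
noncomputable def toHSQuotient : boundedSeq m →ₐ[ℂ] HSQuotient m := Ideal.Quotient.mkₐ ℂ (hsNull m)

end SequenceQuotient
/-! ### Averaging over the Heisenberg group -/

section Twirl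

/-- The clock-and-shift unitary matrices. -/
noncomputable def clockShift {k : ℕ} [NeZero k] (g : ZMod k × ZMod k) :
    Matrix (ZMod k) (ZMod k) ℂ :=
  Matrix.of fun i j ↦ if i = j + g.2 then ZMod.stdAddChar (g.1 * i) else 0

theorem star_clockShift_mul_mul_apply {k : ℕ} [NeZero k] (g : ZMod k × ZMod k)
    (X : Matrix (ZMod k) (ZMod k) ℂ) (i j : ZMod k) :
    (star (clockShift g) * X * clockShift g) i j =
      ZMod.stdAddChar (g.1 * (j - i)) * X (i + g.2) (j + g.2) := by
  simp only [Matrix.mul_apply, Matrix.star_apply, clockShift, Matrix.of_apply, apply_ite star,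
    star_zero, ite_mul, zero_mul, mul_ite, mul_zero, Finset.sum_ite_eq',
    Finset.mem_univ, if_true]
  rw [← starRingEnd_apply, ← AddChar.map_neg_eq_conj, mul_right_comm, ← AddChar.map_add_eq_mul]
  congr 2
  ring

theorem clockShift_mem_unitary {k : ℕ} [NeZero k] (g : ZMod k × ZMod k) :
    clockShift g ∈ unitary (Matrix (ZMod k) (ZMod k) ℂ) := by
  rw [← Matrix.unitaryGroup, Matrix.mem_unitaryGroup_iff']
  ext i j
  have := star_clockShift_mul_mul_apply g 1 i j
  rw [mul_one] at this
  rw [this, Matrix.one_apply, Matrix.one_apply]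
  by_cases h : i = j <;> simp [h]

/-- Orthogonality of characters in the clock variable kills the off-diagonal entries; summing over
shifts replaces each diagonal entry by the trace. -/
theorem sum_star_clockShift_mul_mul {k : ℕ} [NeZero k] (X : Matrix (ZMod k) (ZMod k) ℂ) :
    ∑ g : ZMod k × ZMod k, star (clockShift g) * X * clockShift g = ((k : ℂ) * X.trace) • 1 := by
  ext i j
  rw [Matrix.sum_apply]
  simp only [star_clockShift_mul_mul_apply]
  rw [Fintype.sum_prod_type, Finset.sum_comm]
  simp only [← Finset.sum_mul]
  rw [AddChar.sum_mulShift _ (ZMod.isPrimitive_stdAddChar k)]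
  by_cases h : i = j
  · subst h
    simp only [sub_self, if_true, ZMod.card, ← Finset.mul_sum, Matrix.smul_apply,
      Matrix.one_apply_eq, smul_eq_mul, mul_one]
    congr 1
    exact Fintype.sum_equiv (Equiv.addLeft i) _ _ fun b ↦ rfl
  · simp [h, sub_eq_zero, Ne.symm h]

theorem exists_unitary_family_twirl (k : ℕ+) :
    ∃ (ι : Type) (_ : Fintype ι) (W : ι → Matrix (Fin k) (Fin k) ℂ), (∀ g, W g ∈ unitary _) ∧
      Fintype.card ι = (k : ℕ) ^ 2 ∧
      ∀ X : Matrix (Fin k) (Fin k) ℂ, ∑ g, star (W g) * X * W g = ((k : ℂ) * X.trace) • 1 := by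
  obtain ⟨k, hk⟩ := k
  cases k with
  | zero => exact absurd hk (lt_irrefl _)
  | succ k =>
    -- `ZMod (k + 1)` is `Fin (k + 1)` by definition, so the clock-and-shift matrices are matrices
    -- over `Fin (k + 1)` as they stand.
    refine ⟨ZMod (k + 1) × ZMod (k + 1), inferInstance, fun g ↦ clockShift g,
      fun g ↦ clockShift_mem_unitary g, ?_, fun X ↦ sum_star_clockShift_mul_mul (k := k + 1) X⟩
    rw [Fintype.card_prod, ZMod.card]
    exact (sq _).symm

/-- The left side is the mean of the right side over the clock-and-shift unitaries, so some member
of that family does at least as well. One unitary serves all indices `l` together. -/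
theorem exists_unitary_le_re_sum_ntr {ι : Type*} [Fintype ι] (k : ℕ+)
    (X Y : ι → Matrix (Fin k) (Fin k) ℂ) :
    ∃ W : Matrix (Fin k) (Fin k) ℂ, W ∈ unitary _ ∧
      (∑ l, ntr (X l) * ntr (Y l)).re ≤ (∑ l, ntr (star W * X l * W * Y l)).re := by
  obtain ⟨γ, _, W, hW, hcard, hsum⟩ := exists_unitary_family_twirl k
  have hk : (k : ℂ) ≠ 0 := by exact_mod_cast k.ne_zero
  have key : ∑ g : γ, ∑ l, ntr (star (W g) * X l * W g * Y l)
      = ∑ g : γ, ∑ l, ntr (X l) * ntr (Y l) := by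
    rw [Finset.sum_comm, Finset.sum_const, Finset.card_univ, hcard, Finset.smul_sum]
    refine Finset.sum_congr rfl fun l _ ↦ ?_
    rw [← ntr_sum, ← Finset.sum_mul, hsum, smul_mul_assoc, one_mul, ntr_smul]
    simp only [ntr, nsmul_eq_mul]
    push_cast
    field_simp
  have hne : (Finset.univ : Finset γ).Nonempty := by
    rw [← Finset.card_pos, Finset.card_univ, hcard]
    exact pow_pos k.pos 2
  obtain ⟨g, -, hg⟩ := Finset.exists_le_of_sum_le hne
    (f := fun _ ↦ (∑ l, ntr (X l) * ntr (Y l)).re)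
    (g := fun g ↦ (∑ l, ntr (star (W g) * X l * W g * Y l)).re) (by
      rw [← Complex.re_sum, ← Complex.re_sum, key])
  exact ⟨W g, hW g, hg⟩

end Twirl

/-! ### Positivity, spectral projections and contractions -/

section MatrixLemmas

variable {k : ℕ}

/-- This element multiplies the range of the projection `p` by the phase `w` and fixes its
complement. -/
theorem one_add_smul_mem_unitary {B : Type*} [Ring B] [StarRing B] [Algebra ℂ B] [StarModule ℂ B]
    {p : B} (hp : IsSelfAdjoint p) (hpp : p * p = p) {w : ℂ} (hw : ‖w‖ = 1) :
    1 + (w - 1) • p ∈ unitary B := by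
  have hw' : star w * w = 1 := by
    rw [← starRingEnd_apply, Complex.conj_mul', hw]; simp
  have h : star (w - 1) + (w - 1) + star (w - 1) * (w - 1) = 0 := by
    rw [star_sub, star_one, sub_mul, mul_sub, hw']; ring
  have h' : (w - 1) + star (w - 1) + (w - 1) * star (w - 1) = 0 := by
    rw [mul_comm (w - 1), add_comm (w - 1)]; exact h
  rw [Unitary.mem_iff, star_add, star_one, star_smul, hp.star_eq]
  constructor
  · rw [add_mul, one_mul, mul_add, mul_one, smul_mul_smul_comm, hpp]
    rw [show (1 + (w - 1) • p + (star (w - 1) • p + (star (w - 1) * (w - 1)) • p) : B)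
      = 1 + (star (w - 1) + (w - 1) + star (w - 1) * (w - 1)) • p by module, h, zero_smul, add_zero]
  · rw [add_mul, one_mul, mul_add, mul_one, smul_mul_smul_comm, hpp]
    rw [show (1 + star (w - 1) • p + ((w - 1) • p + ((w - 1) * star (w - 1)) • p) : B)
      = 1 + ((w - 1) + star (w - 1) + (w - 1) * star (w - 1)) • p by module, h', zero_smul,
      add_zero]

/-- Test the hypothesis on unitaries that rotate a single vector `v` by a phase `w`: it gives `Re
((w - 1) z) ≤ 0` for `z = ⟨v, T v⟩` and all phases, which forces `z ≥ 0`. -/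
theorem exists_eq_star_mul_self_of_re_ntr_mul_unitary_le (k : ℕ+) (T : Matrix (Fin k) (Fin k) ℂ)
    (hT : ∀ V ∈ unitary (Matrix (Fin k) (Fin k) ℂ), (ntr (T * V)).re ≤ (ntr T).re) :
    ∃ S, T = star S * S := by
  have hk : (0 : ℝ) < (k : ℕ) := by exact_mod_cast k.pos
  have hnonneg : ∀ v : Fin k → ℂ, 0 ≤ star v ⬝ᵥ (T.mulVec v) := by
    intro v
    by_cases hv : v = 0
    · simp [hv]
    set z := star v ⬝ᵥ (T.mulVec v) with hz
    set s : ℂ := star v ⬝ᵥ v with hs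
    have hspos : 0 < s := Matrix.dotProduct_star_self_pos_iff.2 hv
    obtain ⟨r, hr, hrs⟩ : ∃ r : ℝ, 0 < r ∧ s = r :=
      ⟨s.re, (Complex.pos_iff.1 hspos).1, (Complex.eq_re_of_ofReal_le hspos.le)⟩
    set p : Matrix (Fin k) (Fin k) ℂ := (r : ℂ)⁻¹ • Matrix.vecMulVec v (star v) with hp
    have hr0 : (r : ℂ) ≠ 0 := by exact_mod_cast hr.ne'
    have hpsa : IsSelfAdjoint p := by
      rw [IsSelfAdjoint, hp, star_smul, Matrix.star_eq_conjTranspose, Matrix.conjTranspose_vecMulVec,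
        star_star]
      simp
    have hpp : p * p = p := by
      rw [hp, smul_mul_smul_comm, Matrix.vecMulVec_mul_vecMulVec, ← hs, hrs,
        Matrix.vecMulVec_smul, smul_smul]
      congr 1
      field_simp
    have htr : ntr (T * p) = (r : ℂ)⁻¹ * z / (k : ℕ) := by
      rw [hp, mul_smul_comm, ntr_smul, ntr, Matrix.mul_vecMulVec, Matrix.trace_vecMulVec,
        dotProduct_comm, ← hz, mul_div_assoc]
    have hw : ∀ w : ℂ, ‖w‖ = 1 → ((w - 1) * z).re ≤ 0 := by
      intro w hw
      have h := hT _ (one_add_smul_mem_unitary hpsa hpp hw)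
      rw [mul_add, mul_one, mul_smul_comm, ntr_add, ntr_smul, htr, Complex.add_re] at h
      have h2 : ((w - 1) * ((r : ℂ)⁻¹ * z / (k : ℕ))) =
          ((r⁻¹ / (k : ℕ) : ℝ) : ℂ) * ((w - 1) * z) := by push_cast; ring
      rw [h2, Complex.re_ofReal_mul] at h
      have : 0 < r⁻¹ / (k : ℕ) := by positivity
      by_contra! hcon
      have := mul_pos this hcon
      linarith
    by_cases hz0 : z = 0
    · rw [hz0]
    have hn : (‖z‖ : ℂ) ≠ 0 := by exact_mod_cast norm_ne_zero_iff.2 hz0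
    -- The phase that rotates `z` onto the positive axis gives `‖z‖ ≤ Re z`.
    have h1 := hw (star z / ‖z‖) (by simp [norm_ne_zero_iff.2 hz0])
    have h3 : (star z / ‖z‖ - 1) * z = (‖z‖ : ℂ) - z := by
      rw [sub_mul, one_mul, div_mul_eq_mul_div, ← starRingEnd_apply, Complex.conj_mul']
      field_simp
    rw [h3, Complex.sub_re, Complex.ofReal_re] at h1
    have h4 : z.re = ‖z‖ := le_antisymm (Complex.re_le_norm z) (by linarith)
    have h5 : z = ‖z‖ := by
      apply Complex.ext
      · simpa using h4
      · have := Complex.sq_norm_sub_sq_re z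
        rw [h4, sub_self] at this
        simpa using (pow_eq_zero_iff two_ne_zero).1 this.symm
    rw [h5]
    exact_mod_cast norm_nonneg z
  have hherm : T.IsHermitian := by
    rw [← Matrix.isSymmetric_toEuclideanLin_iff, LinearMap.isSymmetric_iff_inner_map_self_real]
    intro v
    have h := hnonneg v.ofLp
    have : inner ℂ (Matrix.toEuclideanLin T v) v = star (star v.ofLp ⬝ᵥ (T.mulVec v.ofLp)) := by
      rw [EuclideanSpace.inner_eq_star_dotProduct, Matrix.star_dotProduct, star_star]
      simp [Matrix.toLpLin_apply, dotProduct_comm]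
    rw [this]
    simp only [starRingEnd_apply, star_star]
    exact (IsSelfAdjoint.of_nonneg h).star_eq.symm
  open scoped MatrixOrder in
  have hpsd : 0 ≤ T := Matrix.nonneg_iff_posSemidef.2
    (Matrix.PosSemidef.of_dotProduct_mulVec_nonneg hherm hnonneg)
  open scoped MatrixOrder in
  exact CStarAlgebra.nonneg_iff_eq_star_mul_self.1 hpsd

/-- The spectral projection below `1/2` differs from `1 - T` by a controlled multiple of the defect
`T - T²`, so an approximate projection yields an exact one nearby in whichever norm makes the defect
small. -/
theorem exists_projection_sub_eq (T : Matrix (Fin k) (Fin k) ℂ) (hT : IsSelfAdjoint T) :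
    ∃ P K : Matrix (Fin k) (Fin k) ℂ, P * P = P ∧ star P = P ∧ ‖P‖ ≤ 1 ∧ ‖K‖ ≤ 2 ∧
      P - (1 - T) = K * (T - T * T) := by
  have hfin : (spectrum ℝ T).Finite := Matrix.finite_real_spectrum
  have hc : ∀ f : ℝ → ℝ, ContinuousOn f (spectrum ℝ T) := fun f ↦ hfin.continuousOn f
  let f : ℝ → ℝ := fun t ↦ if t < 1 / 2 then 1 else 0
  -- The quotient of `f t - (1 - t)` by `t - t²` after cancellation; cutting at `1/2` keeps it
  -- bounded by `2`. The jumps do no harm because the spectrum is finite.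
  let g : ℝ → ℝ := fun t ↦ if t < 1 / 2 then 1 / (1 - t) else -1 / t
  refine ⟨cfc f T, cfc g T, ?_, ?_, ?_, ?_, ?_⟩
  · rw [← cfc_mul f f T (hc _) (hc _)]
    refine cfc_congr fun t _ ↦ ?_
    simp [f]
  · exact (cfc_predicate f T).star_eq
  · refine norm_cfc_le zero_le_one fun t _ ↦ ?_
    simp only [f]
    split_ifs <;> simp
  · refine norm_cfc_le zero_le_two fun t _ ↦ ?_
    by_cases h : t < 1 / 2
    · simp only [g, h, if_true, Real.norm_eq_abs]
      rw [abs_of_pos (by apply one_div_pos.2; linarith), div_le_iff₀ (by linarith)]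
      linarith
    · simp only [g, h, if_false, Real.norm_eq_abs]
      push Not at h
      rw [neg_div, abs_neg, abs_of_pos (by positivity), div_le_iff₀ (by linarith)]
      linarith
  · have h1 : (1 : Matrix (Fin k) (Fin k) ℂ) = cfc (fun _ : ℝ ↦ (1 : ℝ)) T :=
      (cfc_const_one ℝ T).symm
    have h2 : T = cfc (fun t : ℝ ↦ t) T := (cfc_id' ℝ T).symm
    calc cfc f T - (1 - T)
        = cfc f T - (cfc (fun _ : ℝ ↦ (1 : ℝ)) T - cfc (fun t : ℝ ↦ t) T) := by rw [← h1, ← h2]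
      _ = cfc (fun t ↦ f t - (1 - t)) T := by
          rw [← cfc_sub _ _ T (hc _) (hc _), ← cfc_sub _ _ T (hc _) (hc _)]
      _ = cfc (fun t ↦ g t * (t - t * t)) T := by
          refine cfc_congr fun t _ ↦ ?_
          by_cases h : t < 1 / 2
          · simp only [f, g, h, if_true]
            have : 1 - t ≠ 0 := by linarith
            field_simp
            ring
          · simp only [f, g, h, if_false]
            push Not at h
            have : t ≠ 0 := by linarith
            field_simp
            ring
      _ = cfc g T * (T - T * T) := by
          rw [cfc_mul _ _ T (hc _) (hc _), cfc_sub _ _ T (hc _) (hc _), cfc_mul _ _ T (hc _) (hc _),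
            ← h2]

/-- The two summands live on orthogonal corners: the square is `1 - P + A²`, and `A² ≤ P`. -/
theorem norm_one_sub_add_le {P A : Matrix (Fin k) (Fin k) ℂ} (hP : P * P = P) (hPs : star P = P)
    (hA : IsSelfAdjoint A) (hPA : P * A * P = A) (hA1 : ‖A‖ ≤ 1) : ‖1 - P + A‖ ≤ 1 := by
  open scoped MatrixOrder in
  have h1 : P * A = A := by rw [← hPA, ← mul_assoc, ← mul_assoc, hP]
  have h2 : A * P = A := by rw [← hPA, mul_assoc, hP]
  have hsa : star (1 - P + A) = 1 - P + A := by simp [hPs, hA.star_eq]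
  have h3 : star (1 - P + A) * (1 - P + A) = 1 - P + A * A := by
    rw [hsa, add_mul, mul_add, mul_add, sub_mul, mul_sub, sub_mul, mul_sub, mul_sub, hP, h1, h2]
    simp
  have h4 : A * A ≤ P := by
    have := CStarAlgebra.star_left_conjugate_le_norm_smul (a := P) (b := A * A)
      (by simpa [hA.star_eq] using IsSelfAdjoint.star_mul_self A)
    rw [hPs, hP, ← mul_assoc, h1, mul_assoc, h2] at this
    refine this.trans ?_
    have hPn : 0 ≤ P := by have := star_mul_self_nonneg P; rwa [hPs, hP] at this
    have hn : ‖A * A‖ ≤ 1 := (norm_mul_le _ _).trans (mul_le_one₀ hA1 (norm_nonneg _) hA1)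
    calc ‖A * A‖ • P ≤ (1 : ℝ) • P := smul_le_smul_of_nonneg_right hn hPn
      _ = P := one_smul _ _
  have h5 : ‖star (1 - P + A) * (1 - P + A)‖ ≤ 1 := by
    rw [CStarAlgebra.norm_le_one_iff_of_nonneg _ (star_mul_self_nonneg _), h3]
    calc 1 - P + A * A ≤ 1 - P + P := by gcongr
      _ = 1 := by simp
  rw [CStarRing.norm_star_mul_self] at h5
  nlinarith [norm_nonneg (1 - P + A)]

/-- The unitaries are `Z ± i √(1 - Z²)`. -/
theorem exists_unitary_add_eq_two_smul {Z : Matrix (Fin k) (Fin k) ℂ} (hZ : IsSelfAdjoint Z)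
    (hZ1 : ‖Z‖ ≤ 1) : ∃ U V, U ∈ unitary (Matrix (Fin k) (Fin k) ℂ) ∧
      V ∈ unitary (Matrix (Fin k) (Fin k) ℂ) ∧ U + V = (2 : ℂ) • Z := by
  open scoped MatrixOrder in
  have hu := hZ.self_add_I_smul_cfcSqrt_sub_sq_mem_unitary _ hZ1
  refine ⟨_, _, hu, Unitary.star_mem hu, ?_⟩
  have h2 : IsSelfAdjoint (CFC.sqrt (1 - Z ^ 2)) := IsSelfAdjoint.of_nonneg (CFC.sqrt_nonneg _)
  simp [hZ.star_eq, h2.star_eq, two_smul]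
  abel

end MatrixLemmas

/-! ### Asymptotic homomorphisms of a separable ⋆-algebra -/

section SequenceStar

variable {m : ℕ → ℕ+}

instance : StarRing (boundedSeq m) where
  star X := ⟨fun j ↦ star (X.1 j), by
    obtain ⟨C, hC⟩ := X.2
    exact ⟨C, fun j ↦ by rw [norm_star]; exact hC j⟩⟩
  star_involutive X := Subtype.ext (funext fun j ↦ star_star (X.1 j))
  star_mul X Y := Subtype.ext (funext fun j ↦ star_mul (X.1 j) (Y.1 j))
  star_add X Y := Subtype.ext (funext fun j ↦ star_add (X.1 j) (Y.1 j))

theorem star_boundedSeq_apply (X : boundedSeq m) (j : ℕ) : (star X).1 j = star (X.1 j) := rfl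

theorem toHSQuotient_eq_iff {X Y : boundedSeq m} :
    toHSQuotient m X = toHSQuotient m Y ↔
      Tendsto (fun j ↦ hs (X.1 j - Y.1 j)) atTop (𝓝 0) :=
  Ideal.Quotient.eq

theorem toHSQuotient_eq_zero_iff {X : boundedSeq m} :
    toHSQuotient m X = 0 ↔ Tendsto (fun j ↦ hs (X.1 j)) atTop (𝓝 0) :=
  Ideal.Quotient.eq_zero_iff_mem

theorem toHSQuotient_star_congr {X Y : boundedSeq m} (h : toHSQuotient m X = toHSQuotient m Y) :
    toHSQuotient m (star X) = toHSQuotient m (star Y) := by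
  rw [toHSQuotient_eq_iff] at h ⊢
  simpa only [star_boundedSeq_apply, ← star_sub, hs_star] using h

theorem tendsto_ntr_of_toHSQuotient_eq_zero {X : boundedSeq m} (h : toHSQuotient m X = 0) :
    Tendsto (fun j ↦ ntr (X.1 j)) atTop (𝓝 0) :=
  squeeze_zero_norm (fun _ ↦ norm_ntr_le _) (toHSQuotient_eq_zero_iff.1 h)

theorem tendsto_ntr_sub_of_toHSQuotient_eq {X Y : boundedSeq m}
    (h : toHSQuotient m X = toHSQuotient m Y) :
    Tendsto (fun j ↦ ntr (X.1 j) - ntr (Y.1 j)) atTop (𝓝 0) := by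
  have : toHSQuotient m (X - Y) = 0 := by rw [map_sub, h, sub_self]
  refine (tendsto_ntr_of_toHSQuotient_eq_zero this).congr fun j ↦ ?_
  rw [← ntr_sub]; rfl

theorem tendsto_hs_of_tendsto_ntr_star_mul_self {X : boundedSeq m}
    (h : Tendsto (fun j ↦ (ntr (star (X.1 j) * X.1 j)).re) atTop (𝓝 0)) :
    toHSQuotient m X = 0 := by
  rw [toHSQuotient_eq_zero_iff]
  have h2 := h.sqrt
  rw [Real.sqrt_zero] at h2
  refine h2.congr fun j ↦ ?_
  rw [ntr_star_mul_self, Complex.ofReal_re, Real.sqrt_sq (hs_nonneg _)]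

/-- A positive element commutes with whatever its square commutes with. -/
theorem toHSQuotient_commute_of_sq {S T X : boundedSeq m} (hT : T = star S * S)
    (h : toHSQuotient m (T * T * X) = toHSQuotient m (X * T * T)) :
    toHSQuotient m (T * X) = toHSQuotient m (X * T) := by
  set Y := T * X - X * T with hY
  have hTs : star T = T := by rw [hT, star_mul, star_star]
  have h0 : toHSQuotient m (T * Y + Y * T) = 0 := by
    have : T * Y + Y * T = T * T * X - X * T * T := by
      rw [hY]; simp only [mul_sub, sub_mul, mul_assoc]; abel
    rw [this, map_sub, h, sub_self]
  have h1 := tendsto_ntr_of_toHSQuotient_eq_zero (X := star Y * (T * Y + Y * T))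
    (by rw [map_mul, h0, mul_zero])
  -- `Y` is the commutator of `T` and `X`, and `T Y + Y T` is that of `T²` and `X`, which is null.
  -- Paired with `Y`, it splits as a sum of two squares because `T = S⋆ S`, so `S Y` and `S Y⋆` are
  -- both null.
  have h2 : ∀ j, (ntr ((star Y * (T * Y + Y * T)).1 j)).re =
      hs ((S * Y).1 j) ^ 2 + hs ((S * star Y).1 j) ^ 2 := by
    intro j
    have e1 : ntr ((star Y * (T * Y + Y * T)).1 j) =
        ntr (star ((S * Y).1 j) * (S * Y).1 j) + ntr (star ((S * star Y).1 j) * (S * star Y).1 j) := by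
      have e2 : star Y * (T * Y + Y * T) = star (S * Y) * (S * Y) + star Y * (Y * star S * S) := by
        rw [hT, star_mul]; noncomm_ring
      have e3 : star (S * star Y) * (S * star Y) = Y * star S * S * star Y := by
        rw [star_mul, star_star]; noncomm_ring
      rw [e2]
      change ntr ((star (S * Y) * (S * Y)).1 j + (star Y).1 j * (Y * star S * S).1 j) =
        ntr ((star (S * Y) * (S * Y)).1 j) + ntr ((star (S * star Y) * (S * star Y)).1 j)
      rw [ntr_add, ntr_mul_comm ((star Y).1 j), e3]
      rfl
    rw [e1, ntr_star_mul_self, ntr_star_mul_self, ← Complex.ofReal_add, Complex.ofReal_re]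
  have h3 : Tendsto (fun j ↦ hs ((S * Y).1 j) ^ 2 + hs ((S * star Y).1 j) ^ 2) atTop (𝓝 0) := by
    have := (Complex.continuous_re.tendsto _).comp h1
    rw [Complex.zero_re] at this
    exact this.congr fun j ↦ h2 j
  have h4 : toHSQuotient m (S * Y) = 0 := tendsto_hs_of_tendsto_ntr_star_mul_self <| by
    refine squeeze_zero (fun j ↦ ?_) (fun j ↦ ?_) h3
    all_goals rw [ntr_star_mul_self, Complex.ofReal_re]
    · positivity
    · exact le_add_of_nonneg_right (sq_nonneg _)
  have h5 : toHSQuotient m (S * star Y) = 0 := tendsto_hs_of_tendsto_ntr_star_mul_self <| by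
    refine squeeze_zero (fun j ↦ ?_) (fun j ↦ ?_) h3
    all_goals rw [ntr_star_mul_self, Complex.ofReal_re]
    · positivity
    · exact le_add_of_nonneg_left (sq_nonneg _)
  have h6 : toHSQuotient m (T * Y) = 0 := by rw [hT, mul_assoc, map_mul, h4, mul_zero]
  have h7 : toHSQuotient m (T * star Y) = 0 := by rw [hT, mul_assoc, map_mul, h5, mul_zero]
  have h8 : toHSQuotient m (star Y * T) = 0 := by
    have := toHSQuotient_star_congr (X := T * Y) (Y := 0) (by rw [h6, map_zero])
    rwa [star_mul, hTs, star_zero, map_zero] at this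
  -- The trace of `Y⋆ Y` is that of `Y⋆ T X` minus that of `Y⋆ X T`; by traciality each contains one
  -- of the null products `Y⋆ T`, `T Y⋆`.
  have h9 : toHSQuotient m Y = 0 := tendsto_hs_of_tendsto_ntr_star_mul_self <| by
    have a1 := tendsto_ntr_of_toHSQuotient_eq_zero (X := star Y * T * X)
      (by rw [map_mul, h8, zero_mul])
    have a2 := tendsto_ntr_of_toHSQuotient_eq_zero (X := T * star Y * X)
      (by rw [map_mul, h7, zero_mul])
    have a3 := (Complex.continuous_re.tendsto _).comp (a1.sub a2)
    rw [sub_zero, Complex.zero_re] at a3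
    refine a3.congr fun j ↦ ?_
    have e1 : ntr ((T * star Y * X).1 j) = ntr ((star Y * X * T).1 j) := by
      change ntr (T.1 j * (star Y).1 j * X.1 j) = ntr ((star Y).1 j * X.1 j * T.1 j)
      rw [mul_assoc, ntr_mul_comm]
    simp only [Function.comp]
    rw [e1, ← ntr_sub]
    congr 2
    have e2 : star Y * Y = star Y * T * X - star Y * X * T :=
      calc star Y * Y = star Y * (T * X - X * T) := rfl
        _ = _ := by simp only [mul_sub, mul_assoc]
    exact congrArg (fun Z : boundedSeq m ↦ Z.1 j) e2.symm
  rw [hY, map_sub, sub_eq_zero] at h9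
  exact h9

end SequenceStar

/-! ### Averages `∑ β(cₗ) Z α(cₗ)⋆` and unitaries that maximize them. -/

section Averaging

variable {F : Type*} [AddCommGroup F] [Module ℂ F]
variable {ι : Type*} [Fintype ι]

/-- The averaging map `Z ↦ ∑ β(cₗ) Z α(cₗ)⋆`. -/
def avg {k : ℕ} (c : ι → F) (α β : F →ₗ[ℂ] Matrix (Fin k) (Fin k) ℂ)
    (Z : Matrix (Fin k) (Fin k) ℂ) : Matrix (Fin k) (Fin k) ℂ :=
  ∑ l, β (c l) * Z * star (α (c l))

theorem avg_add {k : ℕ} (c : ι → F) (α β : F →ₗ[ℂ] Matrix (Fin k) (Fin k) ℂ)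
    (Y Z : Matrix (Fin k) (Fin k) ℂ) : avg c α β (Y + Z) = avg c α β Y + avg c α β Z := by
  simp only [avg, mul_add, add_mul, Finset.sum_add_distrib]

theorem avg_smul {k : ℕ} (c : ι → F) (α β : F →ₗ[ℂ] Matrix (Fin k) (Fin k) ℂ)
    (r : ℂ) (Z : Matrix (Fin k) (Fin k) ℂ) : avg c α β (r • Z) = r • avg c α β Z := by
  simp only [avg, mul_smul_comm, smul_mul_assoc, Finset.smul_sum]

/-- A self-adjoint contraction is the mean of two unitaries, so convexity of the norm carries
maximality over to it. -/
theorem hs_avg_le_of_norm_le_one {k : ℕ} {c : ι → F} {α β : F →ₗ[ℂ] Matrix (Fin k) (Fin k) ℂ}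
    (hmax : ∀ u ∈ unitary (Matrix (Fin k) (Fin k) ℂ), hs (avg c α β u) ≤ hs (avg c α β 1))
    {Z : Matrix (Fin k) (Fin k) ℂ} (hZ : IsSelfAdjoint Z) (hZ1 : ‖Z‖ ≤ 1) :
    hs (avg c α β Z) ≤ hs (avg c α β 1) := by
  obtain ⟨U, V, hU, hV, h⟩ := exists_unitary_add_eq_two_smul hZ hZ1
  have h1 : hs (avg c α β U + avg c α β V) = 2 * hs (avg c α β Z) := by
    rw [← avg_add, h, avg_smul, hs_smul]; norm_num
  linarith [hs_add_le (avg c α β U) (avg c α β V), hmax U hU, hmax V hV]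

/-- The sum is the adjoint of the averaging map applied to the average of `1`. Pairing its adjoint
with a unitary `V` gives the inner product of the averages of `1` and of `V`; by Cauchy–Schwarz and
`hmax` the real part is largest at `V = 1`, and the unitary criterion for positivity applies. -/
theorem exists_sum_star_mul_avg_mul_eq {k : ℕ+} {c : ι → F}
    {α β : F →ₗ[ℂ] Matrix (Fin k) (Fin k) ℂ}
    (hmax : ∀ u ∈ unitary (Matrix (Fin k) (Fin k) ℂ), hs (avg c α β u) ≤ hs (avg c α β 1)) :
    ∃ S, ∑ l, star (β (c l)) * avg c α β 1 * α (c l) = star S * S := by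
  set T := ∑ l, star (β (c l)) * avg c α β 1 * α (c l) with hT
  have key : ∀ V, ntr (star T * V) = ntr (star (avg c α β 1) * avg c α β V) := by
    intro V
    rw [hT, star_sum, Finset.sum_mul, ntr_sum, avg, avg, Finset.mul_sum, ntr_sum]
    refine Finset.sum_congr rfl fun l _ ↦ ?_
    rw [star_mul, star_mul, star_star, mul_assoc, ntr_mul_comm]
    simp only [mul_assoc]
  obtain ⟨S, hS⟩ := exists_eq_star_mul_self_of_re_ntr_mul_unitary_le k (star T) fun V hV ↦ by
    have h1 := key 1
    rw [mul_one, ntr_star_mul_self] at h1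
    rw [h1, key V, Complex.ofReal_re]
    refine (Complex.re_le_norm _).trans ((norm_ntr_star_mul_le _ _).trans ?_)
    rw [sq]
    exact mul_le_mul_of_nonneg_left (hmax V hV) (hs_nonneg _)
  refine ⟨S, ?_⟩
  rw [← star_star T, hS, star_mul, star_star]

theorem exists_unitary_forall_hs_avg_le {k : ℕ} (c : ι → F)
    (α β : F →ₗ[ℂ] Matrix (Fin k) (Fin k) ℂ) :
    ∃ u ∈ unitary (Matrix (Fin k) (Fin k) ℂ), ∀ v ∈ unitary (Matrix (Fin k) (Fin k) ℂ),
      hs (avg c α β v) ≤ hs (avg c α β u) := by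
  have hcl : IsClosed (unitary (Matrix (Fin k) (Fin k) ℂ) : Set (Matrix (Fin k) (Fin k) ℂ)) := by
    have : (unitary (Matrix (Fin k) (Fin k) ℂ) : Set (Matrix (Fin k) (Fin k) ℂ)) =
        {u | star u * u = 1} ∩ {u | u * star u = 1} := by
      ext u; exact Unitary.mem_iff
    rw [this]
    exact (isClosed_eq (by fun_prop) continuous_const).inter
      (isClosed_eq (by fun_prop) continuous_const)
  have : ProperSpace (Matrix (Fin k) (Fin k) ℂ) := FiniteDimensional.proper ℂ _
  have hcp : IsCompact (unitary (Matrix (Fin k) (Fin k) ℂ) : Set (Matrix (Fin k) (Fin k) ℂ)) :=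
    (isCompact_closedBall 0 1).of_isClosed_subset hcl fun u hu ↦ by
      simpa using norm_le_one_of_mem_unitary hu
  have hcont : Continuous fun u ↦ hs (avg c α β u) := by
    refine continuous_hs.comp ?_
    unfold avg
    fun_prop
  obtain ⟨u, hu, h⟩ := hcp.exists_isMaxOn ⟨1, one_mem _⟩ hcont.continuousOn
  exact ⟨u, hu, h⟩

end Averaging

/-! ### Asymptotic homomorphisms and separability idempotents. -/

section AsymptoticHom

variable {m : ℕ → ℕ+} {F : Type*} [Ring F] [StarRing F] [Algebra ℂ F]

/-- A sequence of linear maps into matrix algebras that is, asymptotically in Hilbert–Schmidt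
norm, a unital ⋆-homomorphism. -/
structure IsAsymptoticHom (α : ∀ j, F →ₗ[ℂ] Matrix (Fin (m j)) (Fin (m j)) ℂ) : Prop where
  bounded : ∀ f, ∃ C, ∀ j, ‖α j f‖ ≤ C
  map_one : Tendsto (fun j ↦ hs (α j 1 - 1)) atTop (𝓝 0)
  map_mul : ∀ f g, Tendsto (fun j ↦ hs (α j (f * g) - α j f * α j g)) atTop (𝓝 0)
  map_star : ∀ f, Tendsto (fun j ↦ hs (α j (star f) - star (α j f))) atTop (𝓝 0)

namespace IsAsymptoticHom

variable {α : ∀ j, F →ₗ[ℂ] Matrix (Fin (m j)) (Fin (m j)) ℂ}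

/-- The linear map into the algebra of bounded sequences. -/
def lift (hα : IsAsymptoticHom α) : F →ₗ[ℂ] boundedSeq m where
  toFun f := ⟨fun j ↦ α j f, hα.bounded f⟩
  map_add' f g := Subtype.ext (funext fun j ↦ (α j).map_add f g)
  map_smul' c f := Subtype.ext (funext fun j ↦ (α j).map_smul c f)

/-- The homomorphism into the quotient. -/
noncomputable def hom (hα : IsAsymptoticHom α) : F →ₗ[ℂ] HSQuotient m :=
  (toHSQuotient m).toLinearMap ∘ₗ hα.lift

theorem toHSQuotient_lift (hα : IsAsymptoticHom α) (f : F) :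
    toHSQuotient m (hα.lift f) = hα.hom f := rfl

theorem hom_one (hα : IsAsymptoticHom α) : hα.hom 1 = 1 := by
  rw [← toHSQuotient_lift, ← _root_.map_one (toHSQuotient m), toHSQuotient_eq_iff]
  exact hα.map_one

theorem hom_mul (hα : IsAsymptoticHom α) (f g : F) : hα.hom (f * g) = hα.hom f * hα.hom g := by
  rw [← toHSQuotient_lift, ← toHSQuotient_lift, ← toHSQuotient_lift, ← _root_.map_mul,
    toHSQuotient_eq_iff]
  exact hα.map_mul f g

theorem toHSQuotient_star_lift (hα : IsAsymptoticHom α) (f : F) :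
    toHSQuotient m (star (hα.lift f)) = hα.hom (star f) := by
  symm
  rw [← toHSQuotient_lift, toHSQuotient_eq_iff]
  exact hα.map_star f

end IsAsymptoticHom

open scoped TensorProduct in
/-- A finite family `c` such that `∑ cₗ ⊗ cₗ⋆` is a symmetric separability idempotent. -/
structure IsCasimir {ι : Type*} [Fintype ι] (c : ι → F) : Prop where
  mul_comm : ∀ f, ∑ l, (f * c l) ⊗ₜ[ℂ] star (c l) = ∑ l, c l ⊗ₜ[ℂ] (star (c l) * f)
  sum_mul_star : ∑ l, c l * star (c l) = 1
  sum_star_mul : ∑ l, star (c l) * c l = 1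
  one_mem_span : (1 : F) ∈ Submodule.span ℂ (Set.range c)

end AsymptoticHom

/-! ### Asymptotic unitary equivalence from equality of traces. -/

section AsymptoticEquivalence

variable {m : ℕ → ℕ+} {F : Type*} [Ring F] [StarRing F] [Algebra ℂ F]
  {ι : Type*} [Fintype ι] {c : ι → F}
  {α β : ∀ j, F →ₗ[ℂ] Matrix (Fin (m j)) (Fin (m j)) ℂ}

open scoped TensorProduct in
-- Apply the bilinear map `(x, y) ↦ β(x) z α(y)` to the tensor identity `mul_comm`: the average of
-- any `z` intertwines `α` and `β`.
theorem IsCasimir.sum_hom_mul (hc : IsCasimir c) (hα : IsAsymptoticHom α) (hβ : IsAsymptoticHom β)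
    (z : HSQuotient m) (f : F) :
    hβ.hom f * ∑ l, hβ.hom (c l) * z * hα.hom (star (c l)) =
      (∑ l, hβ.hom (c l) * z * hα.hom (star (c l))) * hα.hom f := by
  let B : F →ₗ[ℂ] F →ₗ[ℂ] HSQuotient m :=
    LinearMap.mk₂ ℂ (fun x y ↦ hβ.hom x * z * hα.hom y)
      (fun x x' y ↦ by rw [map_add, add_mul, add_mul])
      (fun r x y ↦ by rw [map_smul, smul_mul_assoc, smul_mul_assoc])
      (fun x y y' ↦ by rw [map_add, mul_add])
      (fun r x y ↦ by rw [map_smul, mul_smul_comm])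
  have h := congrArg (TensorProduct.lift B) (hc.mul_comm f)
  simp only [map_sum, TensorProduct.lift.tmul] at h
  have e1 : ∀ l, B (f * c l) (star (c l)) =
      hβ.hom f * (hβ.hom (c l) * z * hα.hom (star (c l))) := fun l ↦ by
    change hβ.hom (f * c l) * z * hα.hom (star (c l)) = _
    rw [hβ.hom_mul, mul_assoc, mul_assoc, mul_assoc]
  have e2 : ∀ l, B (c l) (star (c l) * f) =
      (hβ.hom (c l) * z * hα.hom (star (c l))) * hα.hom f := fun l ↦ by
    change hβ.hom (c l) * z * hα.hom (star (c l) * f) = _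
    rw [hα.hom_mul]; simp only [mul_assoc]
  simp only [e1, e2] at h
  rw [Finset.mul_sum, h, Finset.sum_mul]

theorem boundedSeq_sum_apply {κ : Type*} (s : Finset κ) (X : κ → boundedSeq m) (j : ℕ) :
    (∑ l ∈ s, X l).1 j = ∑ l ∈ s, (X l).1 j := by
  rw [← Finset.sum_apply]
  exact congrFun (AddSubmonoidClass.coe_finsetSum X s) j

/-- The averaging map on bounded sequences. -/
noncomputable def seqAvg (c : ι → F) (hα : IsAsymptoticHom α) (hβ : IsAsymptoticHom β)
    (Z : boundedSeq m) : boundedSeq m :=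
  ∑ l, hβ.lift (c l) * Z * star (hα.lift (c l))

theorem seqAvg_apply (hα : IsAsymptoticHom α) (hβ : IsAsymptoticHom β) (Z : boundedSeq m) (j : ℕ) :
    (seqAvg c hα hβ Z).1 j = avg c (α j) (β j) (Z.1 j) :=
  boundedSeq_sum_apply _ _ j

theorem seqAvg_add (hα : IsAsymptoticHom α) (hβ : IsAsymptoticHom β) (Y Z : boundedSeq m) :
    seqAvg c hα hβ (Y + Z) = seqAvg c hα hβ Y + seqAvg c hα hβ Z := by
  simp only [seqAvg, mul_add, add_mul, Finset.sum_add_distrib]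

theorem seqAvg_smul (hα : IsAsymptoticHom α) (hβ : IsAsymptoticHom β) (r : ℂ) (Z : boundedSeq m) :
    seqAvg c hα hβ (r • Z) = r • seqAvg c hα hβ Z := by
  simp only [seqAvg, mul_smul_comm, smul_mul_assoc, Finset.smul_sum]

theorem toHSQuotient_seqAvg (hα : IsAsymptoticHom α) (hβ : IsAsymptoticHom β) (Z : boundedSeq m) :
    toHSQuotient m (seqAvg c hα hβ Z) =
      ∑ l, hβ.hom (c l) * toHSQuotient m Z * hα.hom (star (c l)) := by
  simp only [seqAvg, map_sum, map_mul, hα.toHSQuotient_star_lift, hβ.toHSQuotient_lift]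

/-- If the identity maximizes the norm of the average over the unitary group, there is an
asymptotically idempotent positive sequence intertwining the two asymptotic homomorphisms. -/
theorem IsCasimir.exists_intertwiner (hc : IsCasimir c) (hα : IsAsymptoticHom α)
    (hβ : IsAsymptoticHom β)
    (hmax : ∀ j, ∀ u ∈ unitary (Matrix (Fin (m j)) (Fin (m j)) ℂ),
      hs (avg c (α j) (β j) u) ≤ hs (avg c (α j) (β j) 1)) :
    ∃ T : boundedSeq m, star T = T ∧ toHSQuotient m T = toHSQuotient m (seqAvg c hα hβ 1) ∧
      toHSQuotient m T * toHSQuotient m T = toHSQuotient m T ∧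
      (∀ f, hβ.hom f * toHSQuotient m T = hα.hom f * toHSQuotient m T) ∧
      (∀ f, toHSQuotient m T * hα.hom f = hα.hom f * toHSQuotient m T) := by
  let T : boundedSeq m := ∑ l, star (hβ.lift (c l)) * seqAvg c hα hβ 1 * hα.lift (c l)
  have hTj : ∀ j, T.1 j = ∑ l, star (β j (c l)) * avg c (α j) (β j) 1 * α j (c l) := by
    intro j
    rw [boundedSeq_sum_apply]
    refine Finset.sum_congr rfl fun l _ ↦ ?_
    change star (β j (c l)) * (seqAvg c hα hβ 1).1 j * α j (c l) = _
    rw [seqAvg_apply]; rfl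
  have hS : ∀ j, ∃ S, T.1 j = star S * S := fun j ↦ by
    rw [hTj]; exact exists_sum_star_mul_avg_mul_eq (hmax j)
  -- The factors `S j` stay bounded because `‖S j‖² = ‖T j‖`, so they form an element of `boundedSeq
  -- m`.
  choose S hS using hS
  obtain ⟨C, hC⟩ := T.2
  let S' : boundedSeq m := ⟨S, √C, fun j ↦ by
    apply Real.le_sqrt_of_sq_le
    rw [sq, ← CStarRing.norm_star_mul_self, ← hS]; exact hC j⟩
  have hTS : T = star S' * S' := Subtype.ext (funext fun j ↦ hS j)
  have hTs : star T = T := by rw [hTS, star_mul, star_star]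
  set q := toHSQuotient m with hq
  have hE1 : q (seqAvg c hα hβ 1) = ∑ l, hβ.hom (c l) * 1 * hα.hom (star (c l)) := by
    rw [toHSQuotient_seqAvg, map_one]
  -- Modulo null sequences the average intertwines, so it moves out to the left and leaves `∑ cₗ⋆ cₗ
  -- = 1`. This makes the average of `1` asymptotically positive.
  have hqT : q T = q (seqAvg c hα hβ 1) := by
    have : q T = ∑ l, hβ.hom (star (c l)) * q (seqAvg c hα hβ 1) * hα.hom (c l) := by
      simp only [T, map_sum, map_mul, hq, hβ.toHSQuotient_star_lift, hα.toHSQuotient_lift]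
    have h : ∀ l, hβ.hom (star (c l)) * q (seqAvg c hα hβ 1) * hα.hom (c l) =
        q (seqAvg c hα hβ 1) * hα.hom (star (c l) * c l) := fun l ↦ by
      rw [hE1, hc.sum_hom_mul hα hβ, mul_assoc, ← hα.hom_mul]
    rw [this]
    simp only [h, ← Finset.mul_sum, ← map_sum, hc.sum_star_mul, hα.hom_one, mul_one]
  have h1 : ∀ f, hβ.hom f * q T = q T * hα.hom f := fun f ↦ by
    rw [hqT, hE1, hc.sum_hom_mul]
  have h2 : ∀ f, hα.hom f * q T = q T * hβ.hom f := fun f ↦ by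
    have h := toHSQuotient_star_congr (X := hβ.lift (star f) * T) (Y := T * hα.lift (star f)) (by
      rw [map_mul, map_mul, hβ.toHSQuotient_lift, hα.toHSQuotient_lift, h1])
    rw [star_mul, star_mul, hTs, map_mul, map_mul, hβ.toHSQuotient_star_lift,
      hα.toHSQuotient_star_lift, star_star] at h
    exact h.symm
  have h3 : ∀ f, q T * hα.hom f = hα.hom f * q T := fun f ↦ by
    -- Moving `α` past `T` turns it into `β`, and past a second `T` back into `α`, so `T²` commutes
    -- with `α`; by positivity `T` does too.
    have h := toHSQuotient_commute_of_sq (X := hα.lift f) hTS (by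
      simp only [map_mul, hα.toHSQuotient_lift]
      rw [mul_assoc, ← h1, ← mul_assoc, ← h2])
    rwa [map_mul, map_mul, hα.toHSQuotient_lift] at h
  have h4 : ∀ f, hβ.hom f * q T = hα.hom f * q T := fun f ↦ by rw [h1, h3]
  refine ⟨T, hTs, hqT, ?_, h4, h3⟩
  calc q T * q T = ∑ l, q T * (hβ.hom (c l) * hα.hom (star (c l))) := by
        nth_rewrite 2 [hqT]
        rw [hE1, Finset.mul_sum]
        simp only [mul_one]
    _ = ∑ l, q T * (hα.hom (c l) * hα.hom (star (c l))) := by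
        refine Finset.sum_congr rfl fun l _ ↦ ?_
        rw [← mul_assoc, ← mul_assoc, ← h2, h3]
    _ = q T := by
        rw [← Finset.mul_sum]
        simp only [← hα.hom_mul, ← map_sum, hc.sum_mul_star, hα.hom_one, mul_one]

/-- Averages of self-adjoint contractions of a corner complementary to the intertwiner vanish. -/
theorem toHSQuotient_seqAvg_eq_zero_of_corner (hc : IsCasimir c) (hα : IsAsymptoticHom α)
    (hβ : IsAsymptoticHom β)
    (hmax : ∀ j, ∀ u ∈ unitary (Matrix (Fin (m j)) (Fin (m j)) ℂ),
      hs (avg c (α j) (β j) u) ≤ hs (avg c (α j) (β j) 1))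
    {T P A : boundedSeq m} (hTs : star T = T)
    (hTE : toHSQuotient m T = toHSQuotient m (seqAvg c hα hβ 1))
    (hTT : toHSQuotient m T * toHSQuotient m T = toHSQuotient m T)
    (hβT : ∀ f, hβ.hom f * toHSQuotient m T = hα.hom f * toHSQuotient m T)
    (hTα : ∀ f, toHSQuotient m T * hα.hom f = hα.hom f * toHSQuotient m T)
    (hqP : toHSQuotient m P = 1 - toHSQuotient m T) (hPP : P * P = P) (hPs : star P = P)
    (hA : ∀ j, IsSelfAdjoint (A.1 j)) (hA1 : ∀ j, ‖A.1 j‖ ≤ 1) (hPA : P * A * P = A) :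
    toHSQuotient m (seqAvg c hα hβ A) = 0 := by
  set q := toHSQuotient m with hq
  set e := q (seqAvg c hα hβ A) with he
  set G := seqAvg c hα hβ (1 - P) with hG
  set H := seqAvg c hα hβ A with hH
  -- As `β` agrees with `α` on `T` and `T` commutes with `α`, averaging fixes `T`, which is the
  -- class of `1 - P`.
  have hqG : q G = q T := by
    rw [hG, toHSQuotient_seqAvg, ← hq, map_sub, map_one, hqP, sub_sub_cancel]
    have : ∀ l, hβ.hom (c l) * q T * hα.hom (star (c l)) =
        q T * hα.hom (c l * star (c l)) := fun l ↦ by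
      rw [hβT, ← hTα, mul_assoc, hα.hom_mul]
    simp only [this, ← Finset.mul_sum, ← map_sum, hc.sum_mul_star, hα.hom_one, mul_one]
  have hTe : q T * e = 0 := by
    have hTA : q T * q A = 0 := by
      have hTP : q T * q P = 0 := by rw [hqP, mul_sub, mul_one, hTT, sub_self]
      conv_lhs => rw [← hPA]
      rw [map_mul, map_mul, ← mul_assoc, ← mul_assoc, hTP, zero_mul, zero_mul]
    have hβT' : ∀ f, q T * hβ.hom f = hβ.hom f * q T := fun f ↦ by
      have h := toHSQuotient_star_congr (X := hβ.lift (star f) * T) (Y := hα.lift (star f) * T) (by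
        rw [map_mul, map_mul, hβ.toHSQuotient_lift, hα.toHSQuotient_lift, hβT])
      rw [star_mul, star_mul, hTs, map_mul, map_mul, hβ.toHSQuotient_star_lift,
        hα.toHSQuotient_star_lift, star_star] at h
      rw [hβT, ← hTα]; exact h
    rw [he, toHSQuotient_seqAvg, Finset.mul_sum]
    refine Finset.sum_eq_zero fun l _ ↦ ?_
    rw [← mul_assoc, ← mul_assoc, hβT', mul_assoc (hβ.hom _), hTA, mul_zero, zero_mul]
  have hTH : q (star H) * q T = 0 := by
    have h := toHSQuotient_star_congr (X := T * H) (Y := 0) (by rw [map_mul, map_zero]; exact hTe)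
    rwa [star_mul, hTs, star_zero, map_zero, map_mul] at h
  have hqG' : q (star G) = q T := by
    rw [toHSQuotient_star_congr (X := G) (Y := T) hqG, hTs]
  -- Pythagoras: the averages of `1 - P` and of `A` are orthogonal. As `1 - P + A` is a contraction,
  -- the left side has trace at most that of the average of `1`, which is asymptotically that of
  -- `T²`; no room is left for `H`.
  have hq1 : q (star (G + H) * (G + H)) = q (T * T + star H * H) := by
    rw [map_mul, star_add, map_add, map_add, map_add, map_mul, map_mul, hqG, hqG', add_mul,
      mul_add, mul_add, hTH, zero_add]
    change q T * q T + q T * e + _ = _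
    rw [hTe, add_zero]
  set D := seqAvg c hα hβ 1 with hD
  have hq2 : q (star D * D) = q (T * T) := by
    rw [map_mul, map_mul, ← hTE, ← toHSQuotient_star_congr hTE, hTs]
  have hlim := (Complex.continuous_re.tendsto _).comp
    ((tendsto_ntr_sub_of_toHSQuotient_eq hq2).sub (tendsto_ntr_sub_of_toHSQuotient_eq hq1))
  rw [sub_zero, Complex.zero_re] at hlim
  refine tendsto_hs_of_tendsto_ntr_star_mul_self (squeeze_zero (fun j ↦ ?_) (fun j ↦ ?_) hlim)
  · rw [ntr_star_mul_self, Complex.ofReal_re]; positivity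
  · have hZ : hs ((G + H).1 j) ≤ hs (D.1 j) := by
      have := hs_avg_le_of_norm_le_one (hmax j) (Z := 1 - P.1 j + A.1 j)
        (by
          rw [IsSelfAdjoint, star_add, star_sub, star_one, ← star_boundedSeq_apply, hPs,
            (hA j).star_eq])
        (norm_one_sub_add_le (congrArg (fun X : boundedSeq m ↦ X.1 j) hPP)
          (congrArg (fun X : boundedSeq m ↦ X.1 j) hPs) (hA j)
          (congrArg (fun X : boundedSeq m ↦ X.1 j) hPA) (hA1 j))
      rw [hG, hH, hD, ← seqAvg_add, seqAvg_apply, seqAvg_apply]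
      exact this
    have e1 : ntr ((star D * D).1 j) = ((hs (D.1 j) ^ 2 : ℝ) : ℂ) := ntr_star_mul_self _
    have e2 : ntr ((star (G + H) * (G + H)).1 j) = ((hs ((G + H).1 j) ^ 2 : ℝ) : ℂ) :=
      ntr_star_mul_self _
    have e3 : ntr ((T * T + star H * H).1 j) = ntr ((T * T).1 j) + ntr (star (H.1 j) * H.1 j) :=
      ntr_add _ _
    simp only [Function.comp]
    rw [e1, e2, e3]
    simp only [Complex.sub_re, Complex.add_re, Complex.ofReal_re]
    have := pow_le_pow_left₀ (hs_nonneg _) hZ 2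
    linarith

theorem isSelfAdjoint_half_add_star {k : ℕ} (X : Matrix (Fin k) (Fin k) ℂ) :
    IsSelfAdjoint ((1 / 2 : ℂ) • (X + star X)) := by
  rw [IsSelfAdjoint, star_smul, star_add, star_star, add_comm]
  simp

theorem isSelfAdjoint_half_sub_star {k : ℕ} (X : Matrix (Fin k) (Fin k) ℂ) :
    IsSelfAdjoint ((-Complex.I / 2 : ℂ) • (X - star X)) := by
  rw [IsSelfAdjoint, star_smul, star_sub, star_star, ← neg_sub X, smul_neg, ← neg_smul]
  congr 1
  simp [neg_div]

theorem eq_half_add_star_add {k : ℕ} (X : Matrix (Fin k) (Fin k) ℂ) :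
    X = (1 / 2 : ℂ) • (X + star X) + Complex.I • (-Complex.I / 2 : ℂ) • (X - star X) := by
  rw [smul_smul, show Complex.I * (-Complex.I / 2) = 1 / 2 by
    rw [mul_div_assoc', mul_neg, Complex.I_mul_I, neg_neg]]
  module

/-- Under the hypothesis that averages of self-adjoint contractions of the corner of `P` vanish,
the correlation of the two asymptotic homomorphisms on that corner vanishes. -/
theorem exists_tendsto_re_sum_ntr_le (hα : IsAsymptoticHom α) (hβ : IsAsymptoticHom β)
    {P : boundedSeq m} (hPP : P * P = P) (hPs : star P = P) (hP1 : ∀ j, ‖P.1 j‖ ≤ 1)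
    (hvanish : ∀ A : boundedSeq m, (∀ j, IsSelfAdjoint (A.1 j)) → (∀ j, ‖A.1 j‖ ≤ 1) →
      P * A * P = A → toHSQuotient m (seqAvg c hα hβ A) = 0) :
    ∃ g : ℕ → ℝ, Tendsto g atTop (𝓝 0) ∧ ∀ j,
      (∑ l, ntr (β j (c l) * P.1 j) * ntr (P.1 j * star (α j (c l)))).re ≤ g j := by
  choose W' hW hWle using fun j ↦ exists_unitary_le_re_sum_ntr (m j)
    (fun l ↦ β j (c l) * P.1 j) (fun l ↦ P.1 j * star (α j (c l)))
  refine ⟨_, ?_, hWle⟩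
  let W : boundedSeq m := ⟨W', 1, fun j ↦ norm_le_one_of_mem_unitary (hW j)⟩
  -- The twirled sum supplied by `W` is the trace of `W⋆` times the average of `P W P`. Real and
  -- imaginary parts of `P W P` are self-adjoint contractions of the corner, so this average is
  -- null.
  set X : boundedSeq m := P * W * P with hX
  have hcorner : ∀ Z : boundedSeq m, P * (P * Z * P) * P = P * Z * P := fun Z ↦ by
    have : P * (P * Z * P) * P = (P * P) * Z * (P * P) := by simp only [mul_assoc]
    rw [this, hPP]
  have hcX : P * X * P = X := hcorner W
  have hcX' : P * star X * P = star X := by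
    rw [hX, star_mul, star_mul, hPs, ← mul_assoc P (star W), hcorner]
  have hX1 : ∀ j, ‖X.1 j‖ ≤ 1 := fun j ↦ by
    have h1 := norm_le_one_of_mem_unitary (hW j)
    calc ‖P.1 j * W' j * P.1 j‖ ≤ ‖P.1 j‖ * ‖W' j‖ * ‖P.1 j‖ :=
          (norm_mul_le _ _).trans (by gcongr; exact norm_mul_le _ _)
      _ ≤ 1 * 1 * 1 := by gcongr <;> exact hP1 j
      _ = 1 := by norm_num
  have hXs1 : ∀ j, ‖star (X.1 j)‖ ≤ 1 := fun j ↦ by rw [norm_star]; exact hX1 j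
  set A₁ : boundedSeq m := (1 / 2 : ℂ) • (X + star X) with hA₁
  set A₂ : boundedSeq m := (-Complex.I / 2 : ℂ) • (X - star X) with hA₂
  have hv₁ : toHSQuotient m (seqAvg c hα hβ A₁) = 0 := by
    refine hvanish A₁ (fun j ↦ isSelfAdjoint_half_add_star (X.1 j)) (fun j ↦ ?_) ?_
    · change ‖(1 / 2 : ℂ) • (X.1 j + star (X.1 j))‖ ≤ 1
      rw [norm_smul]
      have := norm_add_le (X.1 j) (star (X.1 j))
      have h1 := hX1 j
      have h2 := hXs1 j
      norm_num
      linarith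
    · rw [hA₁, mul_smul_comm, smul_mul_assoc, mul_add, add_mul, hcX, hcX']
  have hv₂ : toHSQuotient m (seqAvg c hα hβ A₂) = 0 := by
    refine hvanish A₂ (fun j ↦ isSelfAdjoint_half_sub_star (X.1 j)) (fun j ↦ ?_) ?_
    · change ‖(-Complex.I / 2 : ℂ) • (X.1 j - star (X.1 j))‖ ≤ 1
      rw [norm_smul]
      have := norm_sub_le (X.1 j) (star (X.1 j))
      have h1 := hX1 j
      have h2 := hXs1 j
      norm_num
      linarith
    · rw [hA₂, mul_smul_comm, smul_mul_assoc, mul_sub, sub_mul, hcX, hcX']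
  have hXA : X = A₁ + Complex.I • A₂ :=
    Subtype.ext (funext fun j ↦ eq_half_add_star_add (X.1 j))
  have hvX : toHSQuotient m (seqAvg c hα hβ X) = 0 := by
    rw [hXA, seqAvg_add, map_add, hv₁, seqAvg_smul, map_smul, hv₂, smul_zero, add_zero]
  have h := tendsto_ntr_of_toHSQuotient_eq_zero (X := star W * seqAvg c hα hβ X)
    (by rw [map_mul, hvX, mul_zero])
  have h := (Complex.continuous_re.tendsto _).comp h
  rw [Complex.zero_re] at h
  refine h.congr fun j ↦ ?_
  change (ntr (star (W' j) * (seqAvg c hα hβ X).1 j)).re = _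
  rw [seqAvg_apply, avg, Finset.mul_sum, ntr_sum]
  congr 1
  refine Finset.sum_congr rfl fun l _ ↦ ?_
  change ntr (star (W' j) * (β j (c l) * (P.1 j * W' j * P.1 j) * star (α j (c l)))) = _
  simp only [mul_assoc]

/-- Replacing `y` by `x` changes the sum by `o(1)` and turns it into `∑ ‖xₗ‖²`. -/
theorem tendsto_zero_of_re_sum_mul_star_le {x y : ι → ℕ → ℂ} {g : ℕ → ℝ}
    (hg : Tendsto g atTop (𝓝 0)) (hle : ∀ j, (∑ l, y l j * star (x l j)).re ≤ g j)
    (hxy : ∀ l, Tendsto (fun j ↦ y l j - x l j) atTop (𝓝 0))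
    (hb : ∀ l, ∃ C, ∀ j, ‖x l j‖ ≤ C) (l : ι) : Tendsto (x l) atTop (𝓝 0) := by
  have h1 : Tendsto (fun j ↦ ∑ l, (y l j - x l j) * star (x l j)) atTop (𝓝 0) := by
    rw [show (0 : ℂ) = ∑ l : ι, 0 by simp]
    refine tendsto_finsetSum _ fun l _ ↦ ?_
    obtain ⟨C, hC⟩ := hb l
    have h2 := (hxy l).norm.mul_const C
    rw [norm_zero, zero_mul] at h2
    refine squeeze_zero_norm (fun j ↦ ?_) h2
    rw [norm_mul, norm_star]
    exact mul_le_mul_of_nonneg_left (hC j) (norm_nonneg _)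
  have h2 := hg.sub ((Complex.continuous_re.tendsto _).comp h1)
  rw [Complex.zero_re, sub_zero] at h2
  have h3 : ∀ j, ‖x l j‖ ^ 2 ≤ g j - (∑ l, (y l j - x l j) * star (x l j)).re := fun j ↦ by
    have e : (∑ l, x l j * star (x l j)).re = ∑ l, ‖x l j‖ ^ 2 := by
      rw [Complex.re_sum]
      refine Finset.sum_congr rfl fun l _ ↦ ?_
      rw [← starRingEnd_apply, Complex.mul_conj', ← Complex.ofReal_pow, Complex.ofReal_re]
    have h4 : ‖x l j‖ ^ 2 ≤ ∑ l, ‖x l j‖ ^ 2 :=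
      Finset.single_le_sum (f := fun l ↦ ‖x l j‖ ^ 2) (fun _ _ ↦ sq_nonneg _) (Finset.mem_univ l)
    have h5 := hle j
    simp only [sub_mul, Finset.sum_sub_distrib, Complex.sub_re] at h5 ⊢
    linarith
  have h4 := (squeeze_zero (fun j ↦ sq_nonneg _) h3 h2).sqrt
  rw [Real.sqrt_zero] at h4
  exact tendsto_zero_iff_norm_tendsto_zero.2 (h4.congr fun j ↦ Real.sqrt_sq (norm_nonneg _))

/-- The homomorphisms agree on the projection `T`. Were its complement `P` not null, they would have
correlated traces on that corner, and some unitary in the corner would have a nonzero average,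
against maximality. -/
theorem IsCasimir.tendsto_hs_sub_of_forall_hs_avg_le (hc : IsCasimir c) (hα : IsAsymptoticHom α)
    (hβ : IsAsymptoticHom β)
    (htr : ∀ f, Tendsto (fun j ↦ ntr (β j f) - ntr (α j f)) atTop (𝓝 0))
    (hmax : ∀ j, ∀ u ∈ unitary (Matrix (Fin (m j)) (Fin (m j)) ℂ),
      hs (avg c (α j) (β j) u) ≤ hs (avg c (α j) (β j) 1)) (f : F) :
    Tendsto (fun j ↦ hs (α j f - β j f)) atTop (𝓝 0) := by
  obtain ⟨T, hTs, hTE, hTT, hβT, hTα⟩ := hc.exists_intertwiner hα hβ hmax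
  choose P' K' hPP hPs hP1 hK2 hPK using fun j ↦
    exists_projection_sub_eq (T.1 j) (congrArg (fun X : boundedSeq m ↦ X.1 j) hTs)
  let P : boundedSeq m := ⟨P', 1, hP1⟩
  let K : boundedSeq m := ⟨K', 2, hK2⟩
  set q := toHSQuotient m with hq
  have hqP : q P = 1 - q T := by
    have h : P - (1 - T) = K * (T - T * T) := Subtype.ext (funext hPK)
    have h2 := congrArg q h
    rw [map_sub, map_mul, map_sub q T, map_mul, hTT, sub_self, mul_zero, sub_eq_zero] at h2
    rw [h2, map_sub, map_one]
  have hPP' : P * P = P := Subtype.ext (funext hPP)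
  have hPsj : star P = P := Subtype.ext (funext hPs)
  obtain ⟨g, hg, hle⟩ := exists_tendsto_re_sum_ntr_le hα hβ hPP' hPsj hP1 fun A ↦
    toHSQuotient_seqAvg_eq_zero_of_corner hc hα hβ hmax hTs hTE hTT hβT hTα hqP hPP' hPsj
  -- `β - α` vanishes on `T`, so cutting it down by `P ≡ 1 - T` changes nothing and `htr` applies.
  have hdiff : ∀ f, Tendsto (fun j ↦ ntr (β j f * P' j) - ntr (α j f * P' j)) atTop (𝓝 0) := by
    intro f
    have h1 : q (hβ.lift f * P - hα.lift f * P) = q (hβ.lift f - hα.lift f) := by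
      rw [map_sub, map_sub, map_mul, map_mul, hqP, mul_sub, mul_sub, mul_one, mul_one]
      change hβ.hom f - hβ.hom f * q T - (hα.hom f - hα.hom f * q T) = _
      rw [hβT]
      change _ = hβ.hom f - hα.hom f
      abel
    have h2 := (tendsto_ntr_sub_of_toHSQuotient_eq h1).add (htr f)
    rw [zero_add] at h2
    refine h2.congr fun j ↦ ?_
    change ntr (β j f * P' j - α j f * P' j) - ntr (β j f - α j f) + _ = _
    rw [ntr_sub, ntr_sub]
    ring
  have hbound : ∀ f, ∃ C, ∀ j, ‖ntr (α j f * P' j)‖ ≤ C := fun f ↦ by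
    obtain ⟨C, hC⟩ := hα.bounded f
    refine ⟨C, fun j ↦ (norm_ntr_le _).trans ((hs_le_norm _).trans ((norm_mul_le _ _).trans ?_))⟩
    exact (mul_le_of_le_one_right (norm_nonneg _) (hP1 j)).trans (hC j)
  have hcl : ∀ l, Tendsto (fun j ↦ ntr (α j (c l) * P' j)) atTop (𝓝 0) := by
    refine tendsto_zero_of_re_sum_mul_star_le (y := fun l j ↦ ntr (β j (c l) * P' j))
      (x := fun l j ↦ ntr (α j (c l) * P' j)) hg (fun j ↦ ?_) (fun l ↦ hdiff _) fun l ↦ hbound _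
    refine le_of_eq_of_le ?_ (hle j)
    congr 1
    refine Finset.sum_congr rfl fun l _ ↦ ?_
    rw [← ntr_star, star_mul, hPs]
  have hspan : ∀ f ∈ Submodule.span ℂ (Set.range c),
      Tendsto (fun j ↦ ntr (α j f * P' j)) atTop (𝓝 0) := by
    intro f hf
    induction hf using Submodule.span_induction with
    | mem x hx => obtain ⟨l, rfl⟩ := hx; exact hcl l
    | zero => simp [ntr]
    | add x y _ _ hx hy =>
      have := hx.add hy
      rw [zero_add] at this
      refine this.congr fun j ↦ ?_
      rw [map_add, add_mul, ntr_add]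
    | smul r x _ hx =>
      have := hx.const_mul r
      rw [mul_zero] at this
      refine this.congr fun j ↦ ?_
      rw [map_smul, smul_mul_assoc, ntr_smul]
  -- The traces `ntr (α(f) P)` vanish asymptotically for `f` in the span of the `cₗ`; for `f = 1`
  -- this is the trace of `P` itself.
  have hPnull : q P = 0 := by
    refine tendsto_hs_of_tendsto_ntr_star_mul_self ?_
    have h1 : q (star P * P) = q (hα.lift 1 * P) := by
      rw [hPsj, hPP', map_mul]
      change _ = hα.hom 1 * q P
      rw [hα.hom_one, one_mul]
    have h2 := (tendsto_ntr_sub_of_toHSQuotient_eq h1).add (hspan 1 hc.one_mem_span)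
    have h3 := (Complex.continuous_re.tendsto _).comp h2
    rw [zero_add, Complex.zero_re] at h3
    refine h3.congr fun j ↦ ?_
    change (ntr (star (P.1 j) * P.1 j) - ntr (α j 1 * P' j) + ntr (α j 1 * P' j)).re = _
    rw [sub_add_cancel]
  have hT1 : q T = 1 := by rw [hqP, sub_eq_zero] at hPnull; exact hPnull.symm
  have := hβT f
  rw [hT1, mul_one, mul_one, ← hα.toHSQuotient_lift, ← hβ.toHSQuotient_lift, eq_comm,
    toHSQuotient_eq_iff] at this
  exact this

/-- Two asymptotic homomorphisms of a separable ⋆-algebra with asymptotically equal traces are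
asymptotically unitarily equivalent in Hilbert–Schmidt norm. -/
theorem IsCasimir.exists_unitary_tendsto_hs (hc : IsCasimir c) (hα : IsAsymptoticHom α)
    (hβ : IsAsymptoticHom β)
    (htr : ∀ f, Tendsto (fun j ↦ ntr (β j f) - ntr (α j f)) atTop (𝓝 0)) :
    ∃ u : ∀ j, Matrix (Fin (m j)) (Fin (m j)) ℂ, (∀ j, u j ∈ unitary _) ∧
      ∀ f, Tendsto (fun j ↦ hs (u j * α j f * star (u j) - β j f)) atTop (𝓝 0) := by
  choose u hu hmax using fun j ↦ exists_unitary_forall_hs_avg_le c (α j) (β j)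
  refine ⟨u, hu, ?_⟩
  -- After conjugating `β` by the maximizer, the new average of `Z` is `u⋆` times the old average of
  -- `u Z`, so the maximum is attained at `1`.
  let β' : ∀ j, F →ₗ[ℂ] Matrix (Fin (m j)) (Fin (m j)) ℂ := fun j ↦
    LinearMap.mulLeft ℂ (star (u j)) ∘ₗ LinearMap.mulRight ℂ (u j) ∘ₗ β j
  have happ : ∀ j f, β' j f = star (u j) * (β j f * u j) := fun j f ↦ rfl
  have hus : ∀ j, u j * star (u j) = 1 := fun j ↦ Unitary.mul_star_self_of_mem (hu j)
  have hsu : ∀ j, star (u j) * u j = 1 := fun j ↦ Unitary.star_mul_self_of_mem (hu j)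
  have hconj : ∀ j (X : Matrix (Fin (m j)) (Fin (m j)) ℂ), hs (star (u j) * (X * u j)) = hs X :=
    fun j X ↦ by rw [hs_unitary_mul (Unitary.star_mem (hu j)), hs_mul_unitary (hu j)]
  have hβ' : IsAsymptoticHom β' := by
    refine ⟨fun f ↦ ?_, ?_, fun f g ↦ ?_, fun f ↦ ?_⟩
    · obtain ⟨C, hC⟩ := hβ.bounded f
      refine ⟨C, fun j ↦ ?_⟩
      have h1 := norm_le_one_of_mem_unitary (hu j)
      have h2 := norm_le_one_of_mem_unitary (Unitary.star_mem (hu j))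
      calc ‖star (u j) * (β j f * u j)‖ ≤ ‖star (u j)‖ * (‖β j f‖ * ‖u j‖) :=
            (norm_mul_le _ _).trans (by gcongr; exact norm_mul_le _ _)
        _ ≤ 1 * (‖β j f‖ * 1) := by gcongr
        _ ≤ C := by rw [one_mul, mul_one]; exact hC j
    · refine hβ.map_one.congr fun j ↦ ?_
      rw [happ, ← hconj j, sub_mul, mul_sub, one_mul, hsu]
    · refine (hβ.map_mul f g).congr fun j ↦ ?_
      rw [happ, happ, happ, ← hconj j, sub_mul, mul_sub]
      congr 2
      simp only [mul_assoc]
      rw [← mul_assoc (u j) (star (u j)), hus, one_mul]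
    · refine (hβ.map_star f).congr fun j ↦ ?_
      rw [happ, happ, ← hconj j, sub_mul, mul_sub, star_mul, star_mul, star_star, mul_assoc]
  have htr' : ∀ f, Tendsto (fun j ↦ ntr (β' j f) - ntr (α j f)) atTop (𝓝 0) := fun f ↦ by
    refine (htr f).congr fun j ↦ ?_
    rw [happ, ntr_mul_comm, mul_assoc, hus, mul_one]
  have havg : ∀ j Z, hs (avg c (α j) (β' j) Z) = hs (avg c (α j) (β j) (u j * Z)) := fun j Z ↦ by
    rw [← hs_unitary_mul (Unitary.star_mem (hu j)) (avg c (α j) (β j) (u j * Z)), avg, avg,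
      Finset.mul_sum]
    simp only [happ, mul_assoc]
  intro f
  refine (hc.tendsto_hs_sub_of_forall_hs_avg_le hα hβ' htr' (fun j v hv ↦ ?_) f).congr fun j ↦ ?_
  · rw [havg, havg, mul_one]
    exact hmax j _ (mul_mem (hu j) hv)
  · rw [happ, ← hconj j (u j * α j f * star (u j) - β j f), sub_mul, mul_sub]
    congr 2
    rw [mul_assoc (u j * α j f), hsu, mul_one, ← mul_assoc, hsu, one_mul]

end AsymptoticEquivalence

/-! ### The separability idempotent of a finite-dimensional ⋆-algebra of operators -/

section CasimirExistence

/-- An orthonormal basis of the range is pulled back, so `V` itself needs no norm. -/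
theorem exists_basis_repr_eq_inner {V H : Type*} [AddCommGroup V] [Module ℂ V]
    [FiniteDimensional ℂ V] [NormedAddCommGroup H] [InnerProductSpace ℂ H] (φ : V →ₗ[ℂ] H)
    (hφ : Function.Injective φ) :
    ∃ (d : ℕ) (b : Module.Basis (Fin d) ℂ V), ∀ i x, b.repr x i = inner ℂ (φ (b i)) (φ x) := by
  let e := LinearEquiv.ofInjective φ hφ
  let o := stdOrthonormalBasis ℂ (LinearMap.range φ)
  refine ⟨_, o.toBasis.map e.symm, fun i x ↦ ?_⟩
  have h1 : φ ((o.toBasis.map e.symm) i) = (o i : H) := by simp [e]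
  rw [h1]
  change o.toBasis.repr (e x) i = inner ℂ (o i : H) (e x : H)
  rw [OrthonormalBasis.coe_toBasis_repr_apply, OrthonormalBasis.repr_apply_apply]
  rfl

/-- The trace of left multiplication. -/
noncomputable def regTrace {F : Type*} [Ring F] [Algebra ℂ F] (x : F) : ℂ := LinearMap.trace ℂ F (LinearMap.mulLeft ℂ x)

theorem regTrace_mul_comm {F : Type*} [Ring F] [Algebra ℂ F] (x y : F) : regTrace (x * y) = regTrace (y * x) := by
  rw [regTrace, LinearMap.mulLeft_mul, ← Module.End.mul_eq_comp, LinearMap.trace_mul_comm,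
    Module.End.mul_eq_comp, ← LinearMap.mulLeft_mul, regTrace]

variable {F H : Type*} [Ring F] [StarRing F] [Algebra ℂ F] [FiniteDimensional ℂ F]
  [NormedAddCommGroup H] [InnerProductSpace ℂ H]

/-- In the pulled-back orthonormal basis `e`, the adjunction `hadj` rewrites the trace of left
multiplication by `x⋆ y` as `∑ ⟨φ(x eᵢ), φ(y eᵢ)⟩`. The regular trace is thus positive definite,
whatever the vector state behind `φ`. -/
theorem exists_embedding_regTrace (φ : F →ₗ[ℂ] H) (hφ : Function.Injective φ)
    (hadj : ∀ x y z, inner ℂ (φ (x * y)) (φ z) = inner ℂ (φ y) (φ (star x * z))) :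
    ∃ (d : ℕ) (ψ : F →ₗ[ℂ] PiLp 2 (fun _ : Fin d ↦ H)), Function.Injective ψ ∧
      ∀ x y, inner ℂ (ψ x) (ψ y) = regTrace (star x * y) := by
  obtain ⟨d, e, he⟩ := exists_basis_repr_eq_inner φ hφ
  refine ⟨d, { toFun := fun x ↦ WithLp.toLp 2 fun i ↦ φ (x * e i), map_add' := ?_, map_smul' := ?_ },
    ?_, ?_⟩
  · intro x y; ext i; simp [add_mul]
  · intro c x; ext i; simp
  · rw [injective_iff_map_eq_zero]
    intro x hx
    have h : LinearMap.mulLeft ℂ x = 0 := e.ext fun i ↦ by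
      have := congrArg (fun v : PiLp 2 (fun _ : Fin d ↦ H) ↦ v i) hx
      simp only [LinearMap.coe_mk, AddHom.coe_mk, PiLp.zero_apply] at this
      simpa using hφ (this.trans (map_zero φ).symm)
    simpa using congrArg (fun L : F →ₗ[ℂ] F ↦ L 1) h
  · intro x y
    rw [regTrace, LinearMap.trace_eq_matrix_trace ℂ e, Matrix.trace, PiLp.inner_apply]
    refine Finset.sum_congr rfl fun i _ ↦ ?_
    rw [Matrix.diag_apply, LinearMap.toMatrix_apply, he, LinearMap.mulLeft_apply, mul_assoc, ← hadj]
    rfl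

open scoped TensorProduct in
/-- A finite-dimensional ⋆-algebra with a faithful ⋆-representation having a separating vector
contains a symmetric separability idempotent. -/
theorem exists_isCasimir (φ : F →ₗ[ℂ] H) (hφ : Function.Injective φ)
    (hadj : ∀ x y z, inner ℂ (φ (x * y)) (φ z) = inner ℂ (φ y) (φ (star x * z)))
    [StarModule ℂ F] : ∃ (d : ℕ) (c : Fin d → F), IsCasimir c := by
  obtain ⟨_, ψ, hψ, hin⟩ := exists_embedding_regTrace φ hφ hadj
  obtain ⟨d, c, hc⟩ := exists_basis_repr_eq_inner ψ hψ
  simp only [hin] at hc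
  have hstar : ∀ x : F, regTrace (star x) = star (regTrace x) := fun x ↦ by
    have h1 := hin x 1
    have h2 := hin 1 x
    rw [mul_one] at h1
    rw [star_one, one_mul] at h2
    rw [← h1, ← h2]
    exact (inner_conj_symm _ _).symm
  -- `c` is orthonormal for the regular trace, so `cₗ` and `cₗ⋆` are dual bases of the symmetric
  -- form `regTrace (x y)`. The tensor identity comes from expanding in both.
  have hexp : ∀ x, ∑ l, regTrace (star (c l) * x) • c l = x := fun x ↦ by
    simp only [← hc]; exact c.sum_repr x
  have hexp' : ∀ x, ∑ l, regTrace (c l * x) • star (c l) = x := fun x ↦ by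
    have h := congrArg star (hexp (star x))
    rw [star_star, star_sum] at h
    conv_rhs => rw [← h]
    refine Finset.sum_congr rfl fun l _ ↦ ?_
    rw [star_smul, ← star_mul, hstar, star_star, regTrace_mul_comm x]
  have hw : ∑ l, c l * star (c l) = 1 := by
    set w := ∑ l, c l * star (c l) with hwdef
    -- The left side is the trace of left multiplication by `x` computed in the basis `c`;
    -- nondegeneracy then gives `w = 1`. The regular trace, rather than an arbitrary faithful one,
    -- gives this normalization.
    have h1 : ∀ x, regTrace (x * w) = regTrace x := fun x ↦ by
      have e1 : regTrace x = ∑ l, regTrace (star (c l) * (x * c l)) := by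
        conv_lhs => rw [regTrace, LinearMap.trace_eq_matrix_trace ℂ c, Matrix.trace]
        refine Finset.sum_congr rfl fun i _ ↦ ?_
        rw [Matrix.diag_apply, LinearMap.toMatrix_apply, hc, LinearMap.mulLeft_apply]
      have e2 : regTrace (x * w) = ∑ l, regTrace (x * (c l * star (c l))) := by
        rw [hwdef, Finset.mul_sum, regTrace, show LinearMap.mulLeft ℂ (∑ l, x * (c l * star (c l))) =
          ∑ l, LinearMap.mulLeft ℂ (x * (c l * star (c l))) from
          map_sum (LinearMap.mul ℂ F) _ _, map_sum]
        rfl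
      rw [e1, e2]
      refine Finset.sum_congr rfl fun l _ ↦ ?_
      rw [regTrace_mul_comm (star (c l)), ← mul_assoc, mul_assoc]
    have h2 : inner ℂ (ψ (w - 1)) (ψ (w - 1)) = 0 := by
      rw [hin, mul_sub, mul_one, regTrace, show LinearMap.mulLeft ℂ (star (w - 1) * w - star (w - 1)) =
          LinearMap.mulLeft ℂ (star (w - 1) * w) - LinearMap.mulLeft ℂ (star (w - 1)) from
          map_sub (LinearMap.mul ℂ F) _ _, map_sub]
      exact sub_eq_zero.2 (h1 _)
    rw [inner_self_eq_zero] at h2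
    exact sub_eq_zero.1 (hψ (h2.trans (map_zero ψ).symm))
  refine ⟨d, c, fun f ↦ ?_, hw, ?_, ?_⟩
  · calc ∑ l, (f * c l) ⊗ₜ[ℂ] star (c l)
        = ∑ l, ∑ k, c k ⊗ₜ[ℂ] (regTrace (c l * (star (c k) * f)) • star (c l)) := by
          refine Finset.sum_congr rfl fun l _ ↦ ?_
          conv_lhs => rw [← hexp (f * c l)]
          rw [TensorProduct.sum_tmul]
          refine Finset.sum_congr rfl fun k _ ↦ ?_
          rw [TensorProduct.smul_tmul, regTrace_mul_comm (c l), mul_assoc]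
      _ = ∑ k, c k ⊗ₜ[ℂ] (star (c k) * f) := by
          rw [Finset.sum_comm]
          refine Finset.sum_congr rfl fun k _ ↦ ?_
          rw [← TensorProduct.tmul_sum, hexp']
  · calc ∑ l, star (c l) * c l
        = ∑ l, ∑ k, c k * (regTrace (star (c l) * star (c k)) • c l) := by
          refine Finset.sum_congr rfl fun l _ ↦ ?_
          conv_lhs => rw [← hexp (star (c l)), Finset.sum_mul]
          refine Finset.sum_congr rfl fun k _ ↦ ?_
          rw [smul_mul_assoc, mul_smul_comm, regTrace_mul_comm]
      _ = 1 := by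
          rw [Finset.sum_comm, ← hw]
          refine Finset.sum_congr rfl fun k _ ↦ ?_
          rw [← Finset.mul_sum, hexp]
  · rw [c.span_eq]; trivial

end CasimirExistence

/-! ### Cyclic tracial representations -/

section TracialRepresentation

variable {A H : Type*} [CStarAlgebra A] [NormedAddCommGroup H] [InnerProductSpace ℂ H]
  [CompleteSpace H]

/-- A representation with a cyclic vector inducing a trace. -/
structure IsTracialCyclic (π : A →⋆ₐ[ℂ] (H →L[ℂ] H)) (ξ : H) : Prop where
  dense : DenseRange fun a ↦ π a ξ
  inner_eq : ∀ a b, inner ℂ (π a ξ) (π b ξ) = inner ℂ (π (star b) ξ) (π (star a) ξ)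

namespace IsTracialCyclic

variable {π : A →⋆ₐ[ℂ] (H →L[ℂ] H)} {ξ : H}

theorem norm_star (h : IsTracialCyclic π ξ) (a : A) : ‖π (star a) ξ‖ = ‖π a ξ‖ := by
  have h1 := h.inner_eq a a
  rw [inner_self_eq_norm_sq_to_K, inner_self_eq_norm_sq_to_K] at h1
  have h2 : ‖π a ξ‖ ^ 2 = ‖π (star a) ξ‖ ^ 2 := by exact_mod_cast h1
  exact ((sq_eq_sq₀ (norm_nonneg _) (norm_nonneg _)).1 h2).symm

/-- By traciality `‖π(a b) ξ‖ = ‖π(b⋆) π(a⋆) ξ‖ ≤ ‖π(b⋆)‖ ‖π(a) ξ‖`. These operators lie in the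
commutant and make `ξ` separating for the double commutant. -/
theorem exists_right_mul (h : IsTracialCyclic π ξ) (b : A) :
    ∃ R : H →L[ℂ] H, ∀ a, R (π a ξ) = π (a * b) ξ := by
  let e : A →ₗ[ℂ] H :=
    { toFun := fun a ↦ π a ξ, map_add' := fun a b ↦ by simp, map_smul' := fun r a ↦ by simp }
  let f : A →ₗ[ℂ] H := e ∘ₗ LinearMap.mulRight ℂ b
  refine ⟨f.extendOfNorm e, fun a ↦ ?_⟩
  refine LinearMap.extendOfNorm_eq (f := f) (e := e) h.dense ⟨‖π (star b)‖, fun a ↦ ?_⟩ a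
  change ‖π (a * b) ξ‖ ≤ _ * ‖π a ξ‖
  rw [← h.norm_star, star_mul, map_mul, ← h.norm_star a]
  exact (π (star b)).le_opNorm _

theorem ext_of_forall (h : IsTracialCyclic π ξ) {S T : H →L[ℂ] H}
    (hST : ∀ a, S (π a ξ) = T (π a ξ)) : S = T :=
  ContinuousLinearMap.ext fun v ↦ congrFun
    (h.dense.equalizer S.continuous T.continuous (funext hST)) v

theorem right_mul_mem_centralizer (h : IsTracialCyclic π ξ) {b : A} {R : H →L[ℂ] H}
    (hR : ∀ a, R (π a ξ) = π (a * b) ξ) : R ∈ Set.centralizer (π.range : Set (H →L[ℂ] H)) := by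
  rintro _ ⟨a, rfl⟩
  refine h.ext_of_forall fun a' ↦ ?_
  have h1 : ∀ a₁ a₂, π a₁ (π a₂ ξ) = π (a₁ * a₂) ξ := fun a₁ a₂ ↦ by rw [map_mul]; rfl
  change π a (R (π a' ξ)) = R (π a (π a' ξ))
  rw [hR, h1, h1, hR, mul_assoc]

theorem apply_right_mul (h : IsTracialCyclic π ξ) {T : H →L[ℂ] H}
    (hT : T ∈ doubleCommutant π.range) {b : A} {R : H →L[ℂ] H}
    (hR : ∀ a, R (π a ξ) = π (a * b) ξ) (v : H) : T (R v) = R (T v) := by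
  have hT' : T ∈ (doubleCommutant π.range : Set (H →L[ℂ] H)) := hT
  rw [coe_doubleCommutant] at hT'
  exact (congrArg (fun S : H →L[ℂ] H ↦ S v) (hT' R (h.right_mul_mem_centralizer hR))).symm

theorem apply_apply_eq (h : IsTracialCyclic π ξ) {T : H →L[ℂ] H}
    (hT : T ∈ doubleCommutant π.range) {b : A} {R : H →L[ℂ] H}
    (hR : ∀ a, R (π a ξ) = π (a * b) ξ) : T (π b ξ) = R (T ξ) := by
  rw [← h.apply_right_mul hT hR]
  have := hR 1
  rw [map_one, one_mul, one_apply_eq_self] at this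
  rw [this]

theorem eq_zero_of_apply_eq_zero (h : IsTracialCyclic π ξ) {T : H →L[ℂ] H}
    (hT : T ∈ doubleCommutant π.range) (h0 : T ξ = 0) : T = 0 := by
  refine h.ext_of_forall fun a ↦ ?_
  obtain ⟨R, hR⟩ := h.exists_right_mul a
  rw [h.apply_apply_eq hT hR, h0, map_zero, zero_apply]

/-- This extends traciality from `π(A)` to its double commutant. If `π(bₙ) ξ → T ξ`, then `π(bₙ⋆) ξ`
is Cauchy with the same norms, and testing against `π(a) ξ` through right multiplication identifies
its limit as `T⋆ ξ`. -/
theorem norm_star_apply (h : IsTracialCyclic π ξ) {T : H →L[ℂ] H}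
    (hT : T ∈ doubleCommutant π.range) : ‖star T ξ‖ = ‖T ξ‖ := by
  obtain ⟨v, hv, hlim⟩ := mem_closure_iff_seq_limit.1 (h.dense (T ξ))
  choose b hb using hv
  simp only at hb
  have hbv : Tendsto (fun n ↦ π (b n) ξ) atTop (𝓝 (T ξ)) := by simpa only [hb] using hlim
  have hcau : CauchySeq fun n ↦ π (star (b n)) ξ := by
    have h1 := hbv.cauchySeq
    rw [Metric.cauchySeq_iff'] at h1 ⊢
    intro ε hε
    obtain ⟨N, hN⟩ := h1 ε hε
    refine ⟨N, fun n hn ↦ ?_⟩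
    have h2 := hN n hn
    rw [dist_eq_norm, ← sub_apply, ← map_sub] at h2 ⊢
    rwa [← star_sub, h.norm_star]
  obtain ⟨ζ, hζ⟩ := cauchySeq_tendsto_of_complete hcau
  have hζT : ζ = star T ξ := by
    have hdense : ∀ a, inner ℂ (π a ξ) ζ = inner ℂ (π a ξ) (star T ξ) := by
      intro a
      obtain ⟨R, hR⟩ := h.exists_right_mul a
      have h1 : inner ℂ (π a ξ) (star T ξ) = inner ℂ (R (T ξ)) ξ := by
        rw [ContinuousLinearMap.star_eq_adjoint, ContinuousLinearMap.adjoint_inner_right,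
          h.apply_apply_eq hT hR]
      have h2 : Tendsto (fun n ↦ inner ℂ (R (π (b n) ξ)) ξ) atTop (𝓝 (inner ℂ (R (T ξ)) ξ)) :=
        ((R.continuous.tendsto _).comp hbv).inner tendsto_const_nhds
      have h3 : Tendsto (fun n ↦ inner ℂ (π a ξ) (π (star (b n)) ξ)) atTop
          (𝓝 (inner ℂ (π a ξ) ζ)) := tendsto_const_nhds.inner hζ
      rw [h1]
      refine tendsto_nhds_unique h3 (h2.congr fun n ↦ ?_)
      have h4 := h.inner_eq (b n * a) 1
      rw [map_one, star_one, map_one, one_apply_eq_self] at h4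
      rw [hR, h4, star_mul, map_mul, mul_apply_eq_comp, map_star,
        ContinuousLinearMap.star_eq_adjoint, ContinuousLinearMap.adjoint_inner_right]
    have h2 : ∀ v : H, inner ℂ v ζ = inner ℂ v (star T ξ) := fun v ↦ congrFun
      (DenseRange.equalizer (g := fun v : H ↦ (inner ℂ v ζ : ℂ))
        (h := fun v : H ↦ (inner ℂ v (star T ξ) : ℂ)) h.dense
        (by fun_prop) (by fun_prop) (funext hdense)) v
    exact ext_inner_left ℂ h2
  rw [← hζT]
  refine tendsto_nhds_unique hζ.norm (hbv.norm.congr fun n ↦ ?_)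
  rw [h.norm_star]

theorem norm_mul_apply_le (h : IsTracialCyclic π ξ) {S T : H →L[ℂ] H}
    (hS : S ∈ doubleCommutant π.range) (hT : T ∈ doubleCommutant π.range) :
    ‖S (T ξ)‖ ≤ ‖T‖ * ‖S ξ‖ := by
  rw [← h.norm_star_apply hS, ← mul_apply_eq_comp, ← h.norm_star_apply (mul_mem hS hT),
    star_mul, mul_apply_eq_comp, ← _root_.norm_star T]
  exact (star T).le_opNorm _

theorem map_mem (π : A →⋆ₐ[ℂ] (H →L[ℂ] H)) (a : A) : π a ∈ doubleCommutant π.range := by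
  change π a ∈ (doubleCommutant π.range : Set (H →L[ℂ] H))
  rw [coe_doubleCommutant]
  exact Set.subset_centralizer_centralizer ⟨a, rfl⟩

theorem cfc_mem {S : StarSubalgebra ℂ (H →L[ℂ] H)} {T : H →L[ℂ] H}
    (hT : T ∈ doubleCommutant S) (f : ℝ → ℝ) : cfc f T ∈ doubleCommutant S := by
  change cfc f T ∈ (doubleCommutant S : Set (H →L[ℂ] H))
  have hT' : T ∈ (doubleCommutant S : Set (H →L[ℂ] H)) := hT
  rw [coe_doubleCommutant] at hT' ⊢
  intro g hg
  exact (Commute.cfc_real (show Commute T g from (hT' g hg).symm) f).eq.symm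

/-- Cyclicity gives an approximant; its self-adjoint part is as good, since adjoints preserve norms
at `ξ`. -/
theorem exists_approx_of_isSelfAdjoint (h : IsTracialCyclic π ξ) {T : H →L[ℂ] H}
    (hT : T ∈ doubleCommutant π.range) (hsa : IsSelfAdjoint T) {δ : ℝ} (hδ : 0 < δ) :
    ∃ y, IsSelfAdjoint y ∧ ‖(π y - T) ξ‖ < δ := by
  obtain ⟨y, hy⟩ := h.dense.exists_dist_lt (T ξ) hδ
  refine ⟨(1 / 2 : ℝ) • (y + star y), ?_, ?_⟩
  · rw [IsSelfAdjoint, star_smul, star_add, star_star, add_comm]; simp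
  · have h1 : ‖(π y - T) ξ‖ < δ := by
      rw [dist_comm, dist_eq_norm] at hy; exact hy
    have h2 : ‖(star (π y - T)) ξ‖ < δ := by
      rwa [h.norm_star_apply (sub_mem (map_mem π y) hT)]
    have h3 : π ((1 / 2 : ℝ) • (y + star y)) - T =
        (1 / 2 : ℂ) • ((π y - T) + star (π y - T)) := by
      rw [star_sub, hsa.star_eq, ← map_star, show (1 / 2 : ℝ) • (y + star y) =
        (1 / 2 : ℂ) • (y + star y) by rw [← Complex.coe_smul]; norm_num, map_smul, map_add]
      module
    rw [h3, smul_apply, add_apply, norm_smul]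
    have := norm_add_le ((π y - T) ξ) ((star (π y - T)) ξ)
    have h4 : ‖(1 / 2 : ℂ)‖ = 1 / 2 := by norm_num
    rw [h4]
    linarith

/-- The Kaplansky density theorem at the trace vector, for self-adjoint contractions. -/
theorem exists_norm_le_one_approx (h : IsTracialCyclic π ξ) {T : H →L[ℂ] H}
    (hT : T ∈ doubleCommutant π.range) (hsa : IsSelfAdjoint T) (hT1 : ‖T‖ ≤ 1) {δ : ℝ}
    (hδ : 0 < δ) : ∃ y, ‖y‖ ≤ 1 ∧ ‖(π y - T) ξ‖ < δ := by
  -- Kaplansky's device: `s` is a right inverse on `[-1, 1]` of `t ↦ 2 t / (1 + t²)`, which maps the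
  -- line into `[-1, 1]`, and `r = 1 / (1 + s²)`. Approximating `s(T)` and mapping back gives a
  -- contraction.
  let s : ℝ → ℝ := fun t ↦ t / (1 + √(1 - t ^ 2))
  let r : ℝ → ℝ := fun t ↦ (1 + √(1 - t ^ 2)) / 2
  have hpos : ∀ t : ℝ, 1 + √(1 - t ^ 2) ≠ 0 := fun t ↦ by positivity
  have hs : Continuous s := by
    refine Continuous.div ?_ ?_ hpos <;> fun_prop
  have hr : Continuous r := by fun_prop
  have hspec : ∀ t ∈ spectrum ℝ T, t ^ 2 ≤ 1 := fun t ht ↦ by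
    have := (spectrum.norm_le_norm_mul_of_mem ht)
    have h1 : ‖t‖ ≤ 1 := this.trans (by
      refine mul_le_one₀ hT1 (norm_nonneg _) ?_
      exact ContinuousLinearMap.norm_id_le)
    rw [Real.norm_eq_abs] at h1
    exact (sq_le_one_iff_abs_le_one t).2 h1
  set S := cfc s T with hSdef
  set rS := cfc r T with hrdef
  have hSm : S ∈ doubleCommutant π.range := cfc_mem hT s
  have hrm : rS ∈ doubleCommutant π.range := cfc_mem hT r
  have e1 : (1 + S * S) * rS = 1 := by
    rw [hSdef, hrdef, ← cfc_mul s s T, ← cfc_one ℝ T, ← cfc_add .., ← cfc_mul ..]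
    refine cfc_congr fun t ht ↦ ?_
    have h1 := hspec t ht
    have h2 := Real.sq_sqrt (show 0 ≤ 1 - t ^ 2 by linarith)
    have h3 := hpos t
    simp only [s, r, Pi.one_apply]
    set w := √(1 - t ^ 2)
    have h4 : t ^ 2 = 1 - w ^ 2 := by linarith
    field_simp
    rw [h4]
    ring
  have e2 : S * rS + S * rS = T := by
    conv_rhs => rw [← cfc_id ℝ T]
    rw [hSdef, hrdef, ← cfc_mul s r T, ← cfc_add ..]
    refine cfc_congr fun t ht ↦ ?_
    have h3 := hpos t
    simp only [s, r, id]
    field_simp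
    ring
  -- The denominator collects the coefficients of the three terms of `hkey`, plus one for
  -- positivity.
  obtain ⟨y, hy, hyS⟩ := h.exists_approx_of_isSelfAdjoint hSm (cfc_predicate s T)
    (δ := δ / (2 * ‖rS‖ + ‖S * rS‖ + 1)) (by positivity)
  let ρ : A := cfc (fun t : ℝ ↦ 1 / (1 + t ^ 2)) y
  let z : A := cfc (fun t : ℝ ↦ 2 * t / (1 + t ^ 2)) y
  have hne : ∀ t : ℝ, 1 + t ^ 2 ≠ 0 := fun t ↦ by positivity
  have hc1 : Continuous fun t : ℝ ↦ 1 / (1 + t ^ 2) := by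
    refine Continuous.div ?_ ?_ hne <;> fun_prop
  have hρ1 : ‖ρ‖ ≤ 1 := by
    refine norm_cfc_le zero_le_one fun t _ ↦ ?_
    rw [Real.norm_eq_abs, abs_of_pos (by positivity), div_le_one (by positivity)]
    nlinarith [sq_nonneg t]
  have hz1 : ‖z‖ ≤ 1 := by
    refine norm_cfc_le zero_le_one fun t _ ↦ ?_
    rw [Real.norm_eq_abs, abs_div, abs_of_pos (show 0 < 1 + t ^ 2 by positivity),
      div_le_one (by positivity), abs_le]
    constructor <;> nlinarith [sq_nonneg (t - 1), sq_nonneg (t + 1)]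
  have e3 : ρ * (1 + y * y) = 1 := by
    have : (1 + y * y : A) = cfc (fun t : ℝ ↦ 1 + t * t) y := by
      rw [cfc_add .., cfc_mul .., cfc_id' ℝ y, cfc_const_one ℝ y]
    rw [this, ← cfc_mul _ _ y hc1.continuousOn, ← cfc_const_one ℝ y]
    refine cfc_congr fun t _ ↦ ?_
    have := hne t
    field_simp
  have e4 : ρ * y + ρ * y = z := by
    have hy' : cfc (fun t : ℝ ↦ t) y = y := cfc_id' ℝ y
    have : ρ * cfc (fun t : ℝ ↦ t) y + ρ * cfc (fun t : ℝ ↦ t) y = z := by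
      rw [← cfc_mul _ _ y hc1.continuousOn,
        ← cfc_add (a := y) _ _ (by fun_prop) (by fun_prop)]
      refine cfc_congr fun t _ ↦ ?_
      ring
    rwa [hy'] at this
  refine ⟨z, hz1, ?_⟩
  -- A resolvent identity: each term contains one factor `π y - S`, with a contraction on its left
  -- and a fixed element of the double commutant on its right. Traciality bounds such a term at `ξ`.
  have hkey : π z - T =
      π ρ * (π y - S) * rS + π ρ * (π y - S) * rS - π z * (π y - S) * (S * rS) := by
    have e5 : π ρ * (1 + π y * π y) = 1 := by
      rw [← map_mul, ← map_one π, ← map_add, ← map_mul, e3, map_one]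
    have e6 : π ρ * π y + π ρ * π y = π z := by rw [← map_mul, ← map_add, e4]
    have e7 : π ρ * (π y - S) * rS + π ρ * (π y - S) * rS - π z * (π y - S) * (S * rS) =
        π ρ * π y * ((1 + S * S) * rS) + π ρ * π y * ((1 + S * S) * rS) -
        ((π ρ * (1 + π y * π y)) * (S * rS) + (π ρ * (1 + π y * π y)) * (S * rS)) := by
      rw [← e6]
      simp only [mul_add, add_mul, mul_sub, sub_mul, mul_one, one_mul, mul_assoc]
      abel
    rw [e7, e1, e5, mul_one, one_mul, e2, e6]
  have hm : π y - S ∈ doubleCommutant π.range := sub_mem (map_mem π y) hSm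
  have hπ : ∀ (a : A) (v : H), ‖a‖ ≤ 1 → ‖π a v‖ ≤ ‖v‖ := fun a v ha ↦ by
    refine ((π a).le_opNorm v).trans (mul_le_of_le_one_left (norm_nonneg _) ?_)
    exact (NonUnitalStarAlgHom.norm_apply_le π a).trans ha
  have b1 : ‖(π ρ * (π y - S) * rS) ξ‖ ≤ ‖rS‖ * ‖(π y - S) ξ‖ :=
    (hπ ρ _ hρ1).trans (h.norm_mul_apply_le hm hrm)
  have b2 : ‖(π z * (π y - S) * (S * rS)) ξ‖ ≤ ‖S * rS‖ * ‖(π y - S) ξ‖ :=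
    (hπ z _ hz1).trans (h.norm_mul_apply_le hm (mul_mem hSm hrm))
  rw [lt_div_iff₀ (by positivity), mul_add, mul_add, mul_one] at hyS
  rw [hkey, sub_apply, add_apply]
  have b3 := norm_sub_le ((π ρ * (π y - S) * rS) ξ + (π ρ * (π y - S) * rS) ξ)
    ((π z * (π y - S) * (S * rS)) ξ)
  have b4 := norm_add_le ((π ρ * (π y - S) * rS) ξ) ((π ρ * (π y - S) * rS) ξ)
  have b5 := norm_nonneg ((π y - S) ξ)
  linarith

/-- The Kaplansky density theorem at the trace vector. -/
theorem exists_norm_le_approx (h : IsTracialCyclic π ξ) {T : H →L[ℂ] H}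
    (hT : T ∈ doubleCommutant π.range) :
    ∃ C : ℝ, ∀ δ > 0, ∃ y, ‖y‖ ≤ C ∧ ‖(π y - T) ξ‖ < δ := by
  have hsmul : ∀ (r : ℂ) (T : H →L[ℂ] H), (∃ C : ℝ, ∀ δ > 0, ∃ y, ‖y‖ ≤ C ∧ ‖(π y - T) ξ‖ < δ) →
      ∃ C : ℝ, ∀ δ > 0, ∃ y, ‖y‖ ≤ C ∧ ‖(π y - r • T) ξ‖ < δ := by
    rintro r T ⟨C, hC⟩
    refine ⟨‖r‖ * C, fun δ hδ ↦ ?_⟩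
    obtain ⟨y, hy, hyT⟩ := hC (δ / (‖r‖ + 1)) (by positivity)
    refine ⟨r • y, by rw [norm_smul]; gcongr, ?_⟩
    rw [map_smul, ← smul_sub, smul_apply, norm_smul]
    rw [lt_div_iff₀ (by positivity)] at hyT
    nlinarith [norm_nonneg ((π y - T) ξ)]
  have hself : ∀ T ∈ doubleCommutant π.range, IsSelfAdjoint T →
      ∃ C : ℝ, ∀ δ > 0, ∃ y, ‖y‖ ≤ C ∧ ‖(π y - T) ξ‖ < δ := by
    intro T hT hsa
    have hn : ((‖T‖ + 1 : ℝ) : ℂ) ≠ 0 := by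
      exact_mod_cast (by positivity : (‖T‖ + 1 : ℝ) ≠ 0)
    have h1 : T = ((‖T‖ + 1 : ℝ) : ℂ) • (((‖T‖ + 1 : ℝ) : ℂ)⁻¹ • T) := by
      rw [smul_smul, mul_inv_cancel₀ hn, one_smul]
    rw [h1]
    refine hsmul _ _ ⟨1, fun δ hδ ↦ h.exists_norm_le_one_approx ?_ ?_ ?_ hδ⟩
    · exact (doubleCommutant π.range).toStarSubalgebra.smul_mem hT _
    · rw [IsSelfAdjoint, star_smul, hsa.star_eq]
      simp
    · rw [norm_smul, norm_inv, Complex.norm_real, Real.norm_of_nonneg (by positivity),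
        inv_mul_le_iff₀ (by positivity)]
      linarith
  have hst : star T ∈ doubleCommutant π.range := star_mem hT
  have h1 : IsSelfAdjoint (T + star T) := IsSelfAdjoint.add_star_self T
  have h2 : IsSelfAdjoint (Complex.I • (T - star T)) := by
    rw [IsSelfAdjoint, star_smul, star_sub, star_star, ← neg_sub T, smul_neg, ← neg_smul]
    simp
  obtain ⟨C₁, hC₁⟩ := hsmul (1 / 2) _ (hself _ (add_mem hT hst) h1)
  obtain ⟨C₂, hC₂⟩ := hsmul (-Complex.I / 2) _ (hself _
    ((doubleCommutant π.range).toStarSubalgebra.smul_mem (sub_mem hT hst) _) h2)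
  refine ⟨C₁ + C₂, fun δ hδ ↦ ?_⟩
  obtain ⟨y₁, hy₁, hd₁⟩ := hC₁ (δ / 2) (by positivity)
  obtain ⟨y₂, hy₂, hd₂⟩ := hC₂ (δ / 2) (by positivity)
  refine ⟨y₁ + y₂, (norm_add_le _ _).trans (add_le_add hy₁ hy₂), ?_⟩
  have h3 : π (y₁ + y₂) - T = (π y₁ - (1 / 2 : ℂ) • (T + star T)) +
      (π y₂ - (-Complex.I / 2 : ℂ) • (Complex.I • (T - star T))) := by
    rw [map_add, smul_smul, show -Complex.I / 2 * Complex.I = 1 / 2 by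
      rw [div_mul_eq_mul_div, neg_mul, Complex.I_mul_I, neg_neg]]
    module
  rw [h3, add_apply]
  linarith [norm_add_le ((π y₁ - (1 / 2 : ℂ) • (T + star T)) ξ)
    ((π y₂ - (-Complex.I / 2 : ℂ) • (Complex.I • (T - star T))) ξ)]

end IsTracialCyclic
end TracialRepresentation

/-! ### Noncommutative polynomials: bounds, rational approximation, adjoints -/

section Polynomials

variable {n : ℕ}

/-- `PolyBound ρ p C`: an expression of `p` shows that `‖p(b)‖ ≤ C` when `‖bᵢ‖ ≤ ρ` for all `i`. -/
inductive PolyBound (ρ : ℝ) : FreeAlgebra ℂ (Fin n) → ℝ → Prop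
  | algebraMap (r : ℂ) : PolyBound ρ (algebraMap ℂ _ r) ‖r‖
  | ι (i : Fin n) : PolyBound ρ (FreeAlgebra.ι ℂ i) ρ
  | add {p q : FreeAlgebra ℂ (Fin n)} {C D : ℝ} :
      PolyBound ρ p C → PolyBound ρ q D → PolyBound ρ (p + q) (C + D)
  | mul {p q : FreeAlgebra ℂ (Fin n)} {C D : ℝ} :
      PolyBound ρ p C → PolyBound ρ q D → PolyBound ρ (p * q) (C * D)

theorem exists_polyBound (ρ : ℝ) (p : FreeAlgebra ℂ (Fin n)) : ∃ C, PolyBound ρ p C := by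
  induction p using FreeAlgebra.induction with
  | grade0 r => exact ⟨_, .algebraMap r⟩
  | grade1 i => exact ⟨_, .ι i⟩
  | mul p q hp hq =>
    obtain ⟨C, hC⟩ := hp
    obtain ⟨D, hD⟩ := hq
    exact ⟨_, hC.mul hD⟩
  | add p q hp hq =>
    obtain ⟨C, hC⟩ := hp
    obtain ⟨D, hD⟩ := hq
    exact ⟨_, hC.add hD⟩

theorem PolyBound.nonneg {ρ : ℝ} (hρ : 0 ≤ ρ) {p : FreeAlgebra ℂ (Fin n)} {C : ℝ}
    (h : PolyBound ρ p C) : 0 ≤ C := by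
  induction h with
  | algebraMap r => exact norm_nonneg r
  | ι i => exact hρ
  | add _ _ h1 h2 => exact add_nonneg h1 h2
  | mul _ _ h1 h2 => exact mul_nonneg h1 h2

theorem PolyBound.norm_lift_le {B : Type*} [NormedRing B] [NormedAlgebra ℂ B] (h1 : ‖(1 : B)‖ ≤ 1)
    {ρ : ℝ} (hρ : 0 ≤ ρ) {b : Fin n → B} (hb : ∀ i, ‖b i‖ ≤ ρ) {p : FreeAlgebra ℂ (Fin n)} {C : ℝ}
    (h : PolyBound ρ p C) : ‖FreeAlgebra.lift ℂ b p‖ ≤ C := by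
  induction h with
  | algebraMap r =>
    rw [AlgHom.commutes, Algebra.algebraMap_eq_smul_one, norm_smul]
    exact mul_le_of_le_one_right (norm_nonneg _) h1
  | ι i => rw [FreeAlgebra.lift_ι_apply]; exact hb i
  | add _ _ h1 h2 => rw [map_add]; exact (norm_add_le _ _).trans (add_le_add h1 h2)
  | mul hp _ h1 h2 =>
    rw [map_mul]
    exact (norm_mul_le _ _).trans (mul_le_mul h1 h2 (norm_nonneg _) (hp.nonneg hρ))

theorem exists_complexRational_norm_sub_le (r : ℂ) {η : ℝ} (hη : 0 < η) :
    ∃ s : ℂ, ‖r - s‖ ≤ η ∧ algebraMap ℂ (FreeAlgebra ℂ (Fin n)) s ∈ complexRationalPolynomials n := by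
  obtain ⟨a, ha⟩ := exists_rat_near r.re (half_pos hη)
  obtain ⟨b, hb⟩ := exists_rat_near r.im (half_pos hη)
  refine ⟨a + b * Complex.I, ?_, ?_⟩
  · refine (Complex.norm_le_abs_re_add_abs_im _).trans ?_
    have h1 : (r - (a + b * Complex.I)).re = r.re - a := by simp
    have h2 : (r - (a + b * Complex.I)).im = r.im - b := by simp
    rw [h1, h2]
    linarith
  · have h : algebraMap ℂ (FreeAlgebra ℂ (Fin n)) (a + b * Complex.I) =
        algebraMap ℚ (FreeAlgebra ℂ (Fin n)) a +
          b • algebraMap ℂ (FreeAlgebra ℂ (Fin n)) Complex.I := by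
      have h' (c : ℚ) : algebraMap ℂ (FreeAlgebra ℂ (Fin n)) c =
          algebraMap ℚ (FreeAlgebra ℂ (Fin n)) c :=
        RingHom.congr_fun (Subsingleton.elim ((algebraMap ℂ (FreeAlgebra ℂ (Fin n))).comp
          (Rat.castHom ℂ)) (algebraMap ℚ (FreeAlgebra ℂ (Fin n)))) c
      rw [map_add, map_mul, Algebra.smul_def, h', h']
    rw [h]
    exact add_mem (Subalgebra.algebraMap_mem _ _)
      (Subalgebra.smul_mem _ (Algebra.subset_adjoin (Set.mem_insert _ _)) _)

theorem ι_mem_complexRationalPolynomials (i : Fin n) :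
    FreeAlgebra.ι ℂ i ∈ complexRationalPolynomials n :=
  Algebra.subset_adjoin (Set.mem_insert_of_mem _ ⟨i, rfl⟩)

/-- Bounding an expression of `p - q`, rather than its value in one algebra, makes the error uniform
over `A` and all matrix sizes. -/
theorem exists_complexRational_polyBound_sub {ρ : ℝ} (hρ : 0 ≤ ρ) (p : FreeAlgebra ℂ (Fin n)) :
    ∀ {η : ℝ}, 0 < η → ∃ q ∈ complexRationalPolynomials n, ∃ C ≤ η, PolyBound ρ (p - q) C := by
  induction p using FreeAlgebra.induction with
  | grade0 r =>
    intro η hη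
    obtain ⟨s, hs, hmem⟩ := exists_complexRational_norm_sub_le (n := n) r hη
    refine ⟨_, hmem, _, hs, ?_⟩
    rw [← map_sub]
    exact .algebraMap _
  | grade1 i =>
    intro η hη
    refine ⟨_, ι_mem_complexRationalPolynomials i, 0, hη.le, ?_⟩
    rw [sub_self]
    simpa using PolyBound.algebraMap (n := n) (ρ := ρ) 0
  | mul p q hp hq =>
    intro η hη
    obtain ⟨C, hC⟩ := exists_polyBound ρ p
    obtain ⟨D, hD⟩ := exists_polyBound ρ q
    have hC0 := hC.nonneg hρ
    have hD0 := hD.nonneg hρ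
    obtain ⟨q', hq', D', hD', hbq⟩ := hq (η := η / (2 * (C + 1))) (by positivity)
    -- The `1` bounds `p'` by `C + 1`, which is why `q` was approximated to within `η / (2 (C +
    -- 1))`.
    obtain ⟨p', hp', C', hC', hbp⟩ := hp (η := min 1 (η / (2 * (D + 1)))) (by positivity)
    have hC1 : C' ≤ 1 := hC'.trans (min_le_left _ _)
    have hC2 := hC'.trans (min_le_right _ _)
    have hb1 : PolyBound ρ p' (C + ‖(-1 : ℂ)‖ * C') := by
      have := hC.add ((PolyBound.algebraMap (-1)).mul hbp)
      rw [show p + algebraMap ℂ (FreeAlgebra ℂ (Fin n)) (-1) * (p - p') = p' by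
        rw [map_neg, map_one]; noncomm_ring] at this
      exact this
    have hb2 := (hbp.mul hD).add (hb1.mul hbq)
    rw [show (p - p') * q + p' * (q - q') = p * q - p' * q' by noncomm_ring] at hb2
    refine ⟨p' * q', mul_mem (S := Subalgebra ℚ (FreeAlgebra ℂ (Fin n))) hp' hq', _, ?_, hb2⟩
    rw [norm_neg, norm_one, one_mul]
    rw [le_div_iff₀ (by positivity)] at hD' hC2
    have := hbq.nonneg hρ
    have := hbp.nonneg hρ
    nlinarith
  | add p q hp hq =>
    intro η hη
    obtain ⟨p', hp', C', hC', hbp⟩ := hp (half_pos hη)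
    obtain ⟨q', hq', D', hD', hbq⟩ := hq (half_pos hη)
    refine ⟨p' + q', add_mem (S := Subalgebra ℚ (FreeAlgebra ℂ (Fin n))) hp' hq', _, ?_,
      (add_sub_add_comm p q p' q').symm ▸ hbp.add hbq⟩
    linarith

/-- `PolyStar p q`: an expression of `p` shows that `q(b) = p(b)⋆` for self-adjoint tuples `b`. -/
inductive PolyStar : FreeAlgebra ℂ (Fin n) → FreeAlgebra ℂ (Fin n) → Prop
  | algebraMap (r : ℂ) : PolyStar (algebraMap ℂ _ r) (algebraMap ℂ _ (star r))
  | ι (i : Fin n) : PolyStar (FreeAlgebra.ι ℂ i) (FreeAlgebra.ι ℂ i)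
  | add {p q p' q' : FreeAlgebra ℂ (Fin n)} :
      PolyStar p p' → PolyStar q q' → PolyStar (p + q) (p' + q')
  | mul {p q p' q' : FreeAlgebra ℂ (Fin n)} :
      PolyStar p p' → PolyStar q q' → PolyStar (p * q) (q' * p')

theorem exists_polyStar (p : FreeAlgebra ℂ (Fin n)) : ∃ q, PolyStar p q := by
  induction p using FreeAlgebra.induction with
  | grade0 r => exact ⟨_, .algebraMap r⟩
  | grade1 i => exact ⟨_, .ι i⟩
  | mul p q hp hq =>
    obtain ⟨C, hC⟩ := hp
    obtain ⟨D, hD⟩ := hq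
    exact ⟨_, hC.mul hD⟩
  | add p q hp hq =>
    obtain ⟨C, hC⟩ := hp
    obtain ⟨D, hD⟩ := hq
    exact ⟨_, hC.add hD⟩

/-- A polynomial whose value at self-adjoint tuples is the adjoint of that of `p`. -/
noncomputable def polyStar (p : FreeAlgebra ℂ (Fin n)) : FreeAlgebra ℂ (Fin n) :=
  (exists_polyStar p).choose

theorem star_lift {B : Type*} [Ring B] [StarRing B] [Algebra ℂ B] [StarModule ℂ B] {b : Fin n → B}
    (hb : ∀ i, IsSelfAdjoint (b i)) (p : FreeAlgebra ℂ (Fin n)) :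
    star (FreeAlgebra.lift ℂ b p) = FreeAlgebra.lift ℂ b (polyStar p) := by
  have h : PolyStar p (polyStar p) := (exists_polyStar p).choose_spec
  generalize polyStar p = q at h
  induction h with
  | algebraMap r => rw [AlgHom.commutes, AlgHom.commutes, algebraMap_star_comm]
  | ι i => rw [FreeAlgebra.lift_ι_apply, (hb i).star_eq]
  | add _ _ h1 h2 => rw [map_add, map_add, star_add, h1, h2]
  | mul _ _ h1 h2 => rw [map_mul, map_mul, star_mul, h1, h2]

/-- Identification of the formal adjoints of the indeterminates with the indeterminates. -/
noncomputable def selfAdjointPoly :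
    FreeAlgebra ℂ (Fin n ⊕ Fin n) →ₐ[ℂ] FreeAlgebra ℂ (Fin n) :=
  FreeAlgebra.lift ℂ (Sum.elim (FreeAlgebra.ι ℂ) (FreeAlgebra.ι ℂ))

theorem starEval_eq_lift {B : Type*} [Ring B] [StarRing B] [Algebra ℂ B] {b : Fin n → B}
    (hb : ∀ i, IsSelfAdjoint (b i)) (p : FreeAlgebra ℂ (Fin n ⊕ Fin n)) :
    starEval b p = FreeAlgebra.lift ℂ b (selfAdjointPoly p) := by
  have : FreeAlgebra.lift ℂ (Sum.elim b fun i ↦ star (b i)) =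
      (FreeAlgebra.lift ℂ b).comp selfAdjointPoly := by
    ext i
    cases i with
    | inl i => simp [selfAdjointPoly]
    | inr i => simp [selfAdjointPoly, (hb i).star_eq]
  exact congrArg (fun f : FreeAlgebra ℂ (Fin n ⊕ Fin n) →ₐ[ℂ] B ↦ f p) this

theorem denseRange_lift {A : Type*} [CStarAlgebra A] {x : Fin n → A}
    (hsa : ∀ i, IsSelfAdjoint (x i)) (hgen : Generates x) :
    DenseRange (FreeAlgebra.lift ℂ x) := by
  intro a
  have h : a ∈ (StarAlgebra.adjoin ℂ (Set.range x)).topologicalClosure := by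
    rw [show (StarAlgebra.adjoin ℂ (Set.range x)).topologicalClosure = ⊤ from hgen]; trivial
  have h2 : a ∈ closure (StarAlgebra.adjoin ℂ (Set.range x) : Set A) := h
  refine closure_mono ?_ h2
  intro b hb
  have h3 : b ∈ (StarAlgebra.adjoin ℂ (Set.range x)).toSubalgebra := hb
  rw [StarAlgebra.adjoin_toSubalgebra] at h3
  have h4 : star (Set.range x) = Set.range x := by
    ext y
    constructor
    · rintro ⟨i, hi⟩
      exact ⟨i, by rw [← (hsa i).star_eq, hi, star_star]⟩
    · rintro ⟨i, rfl⟩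
      exact ⟨i, (hsa i).star_eq.symm⟩
  rw [h4, Set.union_self, Algebra.adjoin_range_eq_range_freeAlgebra_lift] at h3
  exact h3

end Polynomials

/-! ### MF-traces from convergent moments -/

section LimitTrace

theorem cauchySeq_of_approx {E : Type*} [SeminormedAddCommGroup E] {f : ℕ → E}
    (h : ∀ η > 0, ∃ g : ℕ → E, CauchySeq g ∧ ∀ j, ‖f j - g j‖ ≤ η) : CauchySeq f := by
  rw [Metric.cauchySeq_iff]
  intro ε hε
  obtain ⟨g, hg, hfg⟩ := h (ε / 4) (by positivity)
  obtain ⟨N, hN⟩ := Metric.cauchySeq_iff.1 hg (ε / 4) (by positivity)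
  refine ⟨N, fun k hk l hl ↦ ?_⟩
  have h1 := hN k hk l hl
  have h2 := hfg k
  have h3 := hfg l
  rw [dist_eq_norm] at h1 ⊢
  have h4 : f k - f l = (f k - g k) + (g k - g l) - (f l - g l) := by abel
  rw [h4]
  have := norm_sub_le ((f k - g k) + (g k - g l)) (f l - g l)
  have := norm_add_le (f k - g k) (g k - g l)
  linarith

theorem tendsto_of_approx {E : Type*} [SeminormedAddCommGroup E] {f : ℕ → E} {L : E}
    (h : ∀ η > 0, ∃ (g : ℕ → E) (M : E), Tendsto g atTop (𝓝 M) ∧ (∀ j, ‖f j - g j‖ ≤ η) ∧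
      ‖L - M‖ ≤ η) : Tendsto f atTop (𝓝 L) := by
  rw [Metric.tendsto_atTop]
  intro ε hε
  obtain ⟨g, M, hg, hfg, hLM⟩ := h (ε / 4) (by positivity)
  obtain ⟨N, hN⟩ := Metric.tendsto_atTop.1 hg (ε / 4) (by positivity)
  refine ⟨N, fun k hk ↦ ?_⟩
  have h1 := hN k hk
  have h2 := hfg k
  rw [dist_eq_norm] at h1 ⊢
  have h4 : f k - L = (f k - g k) + (g k - M) - (L - M) := by abel
  rw [h4]
  have := norm_sub_le ((f k - g k) + (g k - M)) (L - M)
  have := norm_add_le (f k - g k) (g k - M)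
  linarith

theorem norm_one_matrix_le (k : ℕ) : ‖(1 : Matrix (Fin k) (Fin k) ℂ)‖ ≤ 1 :=
  norm_le_one_of_mem_unitary (one_mem _)

theorem norm_one_le_one (A : Type*) [CStarAlgebra A] : ‖(1 : A)‖ ≤ 1 := by
  cases subsingleton_or_nontrivial A
  · simp [Subsingleton.elim (1 : A) 0]
  · exact CStarRing.norm_one.le

variable {A : Type*} [CStarAlgebra A] {n : ℕ} {x : Fin n → A} {m : ℕ → ℕ+}
  {a : ∀ j, Fin n → Matrix (Fin (m j)) (Fin (m j)) ℂ} {ρ : ℝ} {Q : ℕ → FreeAlgebra ℂ (Fin n)}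

theorem exists_index_norm_lift_sub_le (hQ : Set.range Q = complexRationalPolynomials n)
    (hρ : 0 ≤ ρ) (hx : ∀ i, ‖x i‖ ≤ ρ) (ha : ∀ j i, ‖a j i‖ ≤ ρ) (p : FreeAlgebra ℂ (Fin n))
    {η : ℝ} (hη : 0 < η) :
    ∃ r, (∀ j, ‖FreeAlgebra.lift ℂ (a j) p - FreeAlgebra.lift ℂ (a j) (Q r)‖ ≤ η) ∧
      ‖FreeAlgebra.lift ℂ x p - FreeAlgebra.lift ℂ x (Q r)‖ ≤ η := by
  obtain ⟨q, hq, C, hC, hb⟩ := exists_complexRational_polyBound_sub hρ p hη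
  rw [← hQ] at hq
  obtain ⟨r, rfl⟩ := hq
  refine ⟨r, fun j ↦ ?_, ?_⟩
  · rw [← map_sub]; exact (hb.norm_lift_le (norm_one_matrix_le _) hρ (ha j)).trans hC
  · rw [← map_sub]; exact (hb.norm_lift_le (norm_one_le_one A) hρ hx).trans hC

theorem tendsto_norm_lift (hQ : Set.range Q = complexRationalPolynomials n)
    (hρ : 0 ≤ ρ) (hx : ∀ i, ‖x i‖ ≤ ρ) (ha : ∀ j i, ‖a j i‖ ≤ ρ)
    (hnorm : ∀ r, Tendsto (fun j ↦ ‖FreeAlgebra.lift ℂ (a j) (Q r)‖) atTop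
      (𝓝 ‖FreeAlgebra.lift ℂ x (Q r)‖)) (p : FreeAlgebra ℂ (Fin n)) :
    Tendsto (fun j ↦ ‖FreeAlgebra.lift ℂ (a j) p‖) atTop (𝓝 ‖FreeAlgebra.lift ℂ x p‖) := by
  refine tendsto_of_approx fun η hη ↦ ?_
  obtain ⟨r, h1, h2⟩ := exists_index_norm_lift_sub_le hQ hρ hx ha p hη
  exact ⟨_, _, hnorm r, fun j ↦ (abs_norm_sub_norm_le _ _).trans (h1 j),
    (abs_norm_sub_norm_le _ _).trans h2⟩

theorem exists_tendsto_ntr_lift (hQ : Set.range Q = complexRationalPolynomials n)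
    (hρ : 0 ≤ ρ) (hx : ∀ i, ‖x i‖ ≤ ρ) (ha : ∀ j i, ‖a j i‖ ≤ ρ)
    (hmom : ∀ r, ∃ L, Tendsto (fun j ↦ ntr (FreeAlgebra.lift ℂ (a j) (Q r))) atTop (𝓝 L))
    (p : FreeAlgebra ℂ (Fin n)) :
    ∃ L, Tendsto (fun j ↦ ntr (FreeAlgebra.lift ℂ (a j) p)) atTop (𝓝 L) := by
  refine cauchySeq_tendsto_of_complete (cauchySeq_of_approx fun η hη ↦ ?_)
  obtain ⟨r, h1, -⟩ := exists_index_norm_lift_sub_le hQ hρ hx ha p hη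
  obtain ⟨L, hL⟩ := hmom r
  refine ⟨_, hL.cauchySeq, fun j ↦ ?_⟩
  rw [← ntr_sub]
  exact (norm_ntr_le _).trans ((hs_le_norm _).trans (h1 j))

variable [PartialOrder A] [StarOrderedRing A]

/-- Matrix tuples whose norms converge to those of `x` and whose moments converge define an
MF-trace. -/
theorem exists_isMFTrace (hsa : ∀ i, IsSelfAdjoint (x i)) (hgen : Generates x)
    (hasa : ∀ j i, IsSelfAdjoint (a j i))
    (hnorm : ∀ p, Tendsto (fun j ↦ ‖FreeAlgebra.lift ℂ (a j) p‖) atTop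
      (𝓝 ‖FreeAlgebra.lift ℂ x p‖))
    (hmom : ∀ p, ∃ L, Tendsto (fun j ↦ ntr (FreeAlgebra.lift ℂ (a j) p)) atTop (𝓝 L)) :
    ∃ τ : A →ₚ[ℂ] ℂ, IsMFTrace x τ ∧
      ∀ p, Tendsto (fun j ↦ ntr (FreeAlgebra.lift ℂ (a j) p)) atTop
        (𝓝 (τ (FreeAlgebra.lift ℂ x p))) := by
  choose L hL using hmom
  -- Convergence of the norms makes the limiting functional descend to values in `A` and extend
  -- continuously from the dense polynomials.
  have hle : ∀ p, ‖L p‖ ≤ 1 * ‖FreeAlgebra.lift ℂ x p‖ := fun p ↦ by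
    rw [one_mul]
    exact le_of_tendsto_of_tendsto' (hL p).norm (hnorm p)
      fun j ↦ (norm_ntr_le _).trans (hs_le_norm _)
  let L' : FreeAlgebra ℂ (Fin n) →ₗ[ℂ] ℂ :=
    { toFun := L
      map_add' := fun p q ↦ tendsto_nhds_unique (hL (p + q)) (((hL p).add (hL q)).congr fun j ↦ by
        rw [map_add, ntr_add])
      map_smul' := fun r p ↦ tendsto_nhds_unique (hL (r • p)) (((hL p).const_mul r).congr fun j ↦ by
        rw [map_smul, ntr_smul]) }
  let e : FreeAlgebra ℂ (Fin n) →ₗ[ℂ] A := (FreeAlgebra.lift ℂ x).toLinearMap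
  have hd : DenseRange (FreeAlgebra.lift ℂ x) := denseRange_lift hsa hgen
  let τ₀ : A →L[ℂ] ℂ := L'.extendOfNorm e
  have hτ₀ : ∀ p, τ₀ (FreeAlgebra.lift ℂ x p) = L p := fun p ↦
    LinearMap.extendOfNorm_eq (f := L') (e := e) hd ⟨1, hle⟩ p
  have hτ₀lim : ∀ p, Tendsto (fun j ↦ ntr (FreeAlgebra.lift ℂ (a j) p)) atTop
      (𝓝 (τ₀ (FreeAlgebra.lift ℂ x p))) := fun p ↦ by rw [hτ₀]; exact hL p
  have hpos : ∀ b : A, 0 ≤ τ₀ (star b * b) := fun b ↦ by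
    refine hd.induction_on (p := fun b ↦ 0 ≤ τ₀ (star b * b)) b ?_ fun p ↦ ?_
    · exact isClosed_le continuous_const (by fun_prop)
    · rw [star_lift hsa, ← map_mul]
      refine ge_of_tendsto' (hτ₀lim _) fun j ↦ ?_
      rw [map_mul, ← star_lift (hasa j), ntr_star_mul_self]
      exact_mod_cast sq_nonneg (hs (FreeAlgebra.lift ℂ (a j) p))
  have hcomm : ∀ b c : A, τ₀ (b * c) = τ₀ (c * b) := fun b c ↦ by
    refine hd.induction_on (p := fun b ↦ τ₀ (b * c) = τ₀ (c * b)) b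
      (isClosed_eq (by fun_prop) (by fun_prop)) fun p ↦ ?_
    refine hd.induction_on
      (p := fun c ↦ τ₀ (FreeAlgebra.lift ℂ x p * c) = τ₀ (c * FreeAlgebra.lift ℂ x p)) c
      (isClosed_eq (by fun_prop) (by fun_prop)) fun q ↦ ?_
    rw [← map_mul, ← map_mul]
    refine tendsto_nhds_unique (hτ₀lim (p * q)) ((hτ₀lim (q * p)).congr fun j ↦ ?_)
    rw [map_mul, ntr_mul_comm, map_mul]
  have hone : τ₀ 1 = 1 := by
    rw [← map_one (FreeAlgebra.lift ℂ x)]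
    refine tendsto_nhds_unique (hτ₀lim 1) (tendsto_const_nhds.congr fun j ↦ ?_)
    have : ((m j : ℕ) : ℂ) ≠ 0 := by exact_mod_cast (m j).ne_zero
    rw [map_one, ntr, Matrix.trace_one, Fintype.card_fin, div_self this]
  let τ : A →ₚ[ℂ] ℂ := PositiveLinearMap.mk₀ τ₀.toLinearMap fun b hb ↦ by
    obtain ⟨c, rfl⟩ := CStarAlgebra.nonneg_iff_eq_star_mul_self.1 hb
    exact hpos c
  refine ⟨τ, ⟨⟨hone, hcomm⟩, m, a, fun p ↦ ⟨?_, ?_⟩⟩, hτ₀lim⟩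
  · rw [starEval_eq_lift hsa]
    refine (hnorm _).congr fun j ↦ ?_
    rw [starEval_eq_lift (hasa j)]
  · rw [starEval_eq_lift hsa]
    refine (hτ₀lim _).congr fun j ↦ ?_
    rw [starEval_eq_lift (hasa j), ntr]

end LimitTrace

/-! ### The GNS representation of a tracial state -/

section GNS

variable {A : Type*} [CStarAlgebra A] [PartialOrder A] [StarOrderedRing A]

/-- The cyclic vector of the GNS representation. -/
noncomputable def gnsVector (τ : A →ₚ[ℂ] ℂ) : τ.GNS := (τ.toPreGNS 1 : τ.PreGNS)

theorem gnsStarAlgHom_apply_gnsVector (τ : A →ₚ[ℂ] ℂ) (a : A) :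
    τ.gnsStarAlgHom a (gnsVector τ) = (τ.toPreGNS a : τ.PreGNS) := by
  refine (PositiveLinearMap.gnsNonUnitalStarAlgHom_apply_coe (f := τ) (a := a)
    (b := τ.toPreGNS 1)).trans ?_
  simp

theorem inner_gnsVector (τ : A →ₚ[ℂ] ℂ) (a b : A) :
    inner ℂ (τ.gnsStarAlgHom a (gnsVector τ)) (τ.gnsStarAlgHom b (gnsVector τ)) =
      τ (star a * b) := by
  rw [gnsStarAlgHom_apply_gnsVector, gnsStarAlgHom_apply_gnsVector,
    UniformSpace.Completion.inner_coe, PositiveLinearMap.preGNS_inner_def]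
  simp

theorem isTracialCyclic_gns {τ : A →ₚ[ℂ] ℂ} (hτ : ∀ a b, τ (a * b) = τ (b * a)) :
    IsTracialCyclic τ.gnsStarAlgHom (gnsVector τ) where
  dense := by
    have h : (fun a ↦ τ.gnsStarAlgHom a (gnsVector τ)) =
        (fun v : τ.PreGNS ↦ (v : τ.GNS)) ∘ τ.toPreGNS :=
      funext fun a ↦ gnsStarAlgHom_apply_gnsVector τ a
    rw [h]
    exact UniformSpace.Completion.denseRange_coe.comp τ.toPreGNS.surjective.denseRange
      (UniformSpace.Completion.continuous_coe _)
  inner_eq a b := by rw [inner_gnsVector, inner_gnsVector, star_star, hτ]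

end GNS

/-! ### Approximate unitary equivalence of microstates of a hyperfinite trace -/

/-! ### Seminorm estimates checked on a basis. -/

section Seminorms

theorem _root_.Seminorm.le_sum_basis {F ι : Type*} [AddCommGroup F] [Module ℂ F] [Fintype ι]
    (e : Module.Basis ι ℂ F) (q : Seminorm ℂ F) (f : F) :
    q f ≤ ∑ i, ‖e.repr f i‖ * q (e i) := by
  conv_lhs => rw [← e.sum_repr f]
  refine (Finset.le_sum_of_subadditive q (map_zero q).le (map_add_le_add q) _ _).trans_eq ?_
  simp only [map_smul_eq_mul]

theorem _root_.Seminorm.tendsto_zero_of_basis {F ι : Type*} [AddCommGroup F] [Module ℂ F]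
    [Fintype ι] (e : Module.Basis ι ℂ F) {q : ℕ → Seminorm ℂ F}
    (h : ∀ i, Tendsto (fun t ↦ q t (e i)) atTop (𝓝 0)) (f : F) :
    Tendsto (fun t ↦ q t f) atTop (𝓝 0) := by
  refine squeeze_zero (fun t ↦ apply_nonneg _ _) (fun t ↦ (q t).le_sum_basis e f) ?_
  have : Tendsto (fun t ↦ ∑ i, ‖e.repr f i‖ * q t (e i)) atTop (𝓝 (∑ i, ‖e.repr f i‖ * 0)) :=
    tendsto_finsetSum _ fun i _ ↦ (h i).const_mul _
  simpa using this

/-- The normalized Hilbert–Schmidt norm as a seminorm. -/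
noncomputable def hsSeminorm (k : ℕ) : Seminorm ℂ (Matrix (Fin k) (Fin k) ℂ) :=
  Seminorm.of hs hs_add_le hs_smul

/-- The modulus of the normalized trace as a seminorm. -/
noncomputable def ntrSeminorm (k : ℕ) : Seminorm ℂ (Matrix (Fin k) (Fin k) ℂ) :=
  Seminorm.of (fun X ↦ ‖ntr X‖) (fun X Y ↦ by rw [ntr_add]; exact norm_add_le _ _)
    (fun r X ↦ by rw [ntr_smul, norm_mul])

end Seminorms

/-! ### Polynomial approximants at the trace vector. -/

section Polynomials

variable {A H : Type*} [CStarAlgebra A] [NormedAddCommGroup H] [InnerProductSpace ℂ H]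
  [CompleteSpace H] {π : A →⋆ₐ[ℂ] (H →L[ℂ] H)} {ξ : H} {n : ℕ} {x : Fin n → A}

theorem IsTracialCyclic.exists_poly_approx (h : IsTracialCyclic π ξ)
    (hsa : ∀ i, IsSelfAdjoint (x i)) (hgen : Generates x) {T : H →L[ℂ] H}
    (hT : T ∈ doubleCommutant π.range) :
    ∃ C : ℝ, ∀ δ > 0, ∃ p, ‖FreeAlgebra.lift ℂ x p‖ ≤ C ∧
      ‖(π (FreeAlgebra.lift ℂ x p) - T) ξ‖ < δ := by
  obtain ⟨C, hC⟩ := h.exists_norm_le_approx hT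
  refine ⟨C + 1, fun δ hδ ↦ ?_⟩
  obtain ⟨y, hy, hyT⟩ := hC (δ / 2) (half_pos hδ)
  have hpos : 0 < min 1 (δ / (2 * (‖ξ‖ + 1))) := by positivity
  obtain ⟨p, hp⟩ := (denseRange_lift hsa hgen).exists_dist_lt y hpos
  rw [dist_eq_norm] at hp
  refine ⟨p, ?_, ?_⟩
  · have h1 := norm_le_norm_add_norm_sub' (FreeAlgebra.lift ℂ x p) y
    have h2 := hp.le.trans (min_le_left _ _)
    rw [norm_sub_rev] at h2
    linarith
  · have h1 : (π (FreeAlgebra.lift ℂ x p) - T) ξ =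
        (π y - T) ξ - π (y - FreeAlgebra.lift ℂ x p) ξ := by
      rw [map_sub]; simp only [sub_apply]; abel
    have h2 : ‖π (y - FreeAlgebra.lift ℂ x p) ξ‖ ≤ δ / 2 := by
      refine ((π _).le_opNorm ξ).trans ?_
      have h3 : ‖π (y - FreeAlgebra.lift ℂ x p)‖ ≤ δ / (2 * (‖ξ‖ + 1)) :=
        (NonUnitalStarAlgHom.norm_apply_le π _).trans (hp.le.trans (min_le_right _ _))
      have h4 : δ / (2 * (‖ξ‖ + 1)) * (‖ξ‖ + 1) = δ / 2 := by field_simp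
      have := norm_nonneg ξ
      nlinarith [norm_nonneg (π (y - FreeAlgebra.lift ℂ x p))]
    rw [h1]
    have := norm_sub_le ((π y - T) ξ) (π (y - FreeAlgebra.lift ℂ x p) ξ)
    linarith

/-- Choosing approximants only on a basis and extending linearly makes each `p t` linear. The
uniform norm bound comes from Kaplansky density. -/
theorem IsTracialCyclic.exists_poly_lift (h : IsTracialCyclic π ξ)
    (hsa : ∀ i, IsSelfAdjoint (x i)) (hgen : Generates x) {F : StarSubalgebra ℂ (H →L[ℂ] H)}
    [FiniteDimensional ℂ F] (hF : F ≤ (doubleCommutant π.range).toStarSubalgebra) :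
    ∃ p : ℕ → F →ₗ[ℂ] FreeAlgebra ℂ (Fin n),
      (∀ f, ∃ C, ∀ t, ‖FreeAlgebra.lift ℂ x (p t f)‖ ≤ C) ∧
      ∀ f, Tendsto (fun t ↦ ‖(π (FreeAlgebra.lift ℂ x (p t f)) - (f : H →L[ℂ] H)) ξ‖) atTop
        (𝓝 0) := by
  let e := Module.finBasis ℂ F
  choose C hC using fun i ↦ h.exists_poly_approx hsa hgen (hF (e i).2)
  choose q hq1 hq2 using fun (t : ℕ) i ↦ hC i (1 / ((t : ℝ) + 1)) Nat.one_div_pos_of_nat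
  let p : ℕ → F →ₗ[ℂ] FreeAlgebra ℂ (Fin n) := fun t ↦ e.constr ℂ (q t)
  have hp : ∀ t i, p t (e i) = q t i := fun t i ↦ e.constr_basis ℂ _ _
  refine ⟨p, fun f ↦ ⟨∑ i, ‖e.repr f i‖ * C i, fun t ↦ ?_⟩, ?_⟩
  · refine (((normSeminorm ℂ A).comp ((FreeAlgebra.lift ℂ x).toLinearMap ∘ₗ p t)).le_sum_basis
      e f).trans ?_
    refine Finset.sum_le_sum fun i _ ↦ mul_le_mul_of_nonneg_left ?_ (norm_nonneg _)
    change ‖FreeAlgebra.lift ℂ x (p t (e i))‖ ≤ _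
    rw [hp]; exact hq1 t i
  · let D : ℕ → F →ₗ[ℂ] H := fun t ↦
      { toFun := fun f ↦ (π (FreeAlgebra.lift ℂ x (p t f)) - (f : H →L[ℂ] H)) ξ
        map_add' := fun f g ↦ by
          simp only [map_add, AddMemClass.coe_add, sub_apply, add_apply]; abel
        map_smul' := fun r f ↦ by
          simp only [map_smul, SetLike.val_smul, sub_apply, smul_apply, RingHom.id_apply,
            smul_sub] }
    refine Seminorm.tendsto_zero_of_basis e (q := fun t ↦ (normSeminorm ℂ H).comp (D t)) fun i ↦ ?_
    refine squeeze_zero (fun t ↦ norm_nonneg _) (fun t ↦ ?_) tendsto_one_div_add_atTop_nhds_zero_nat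
    change ‖(π (FreeAlgebra.lift ℂ x (p t (e i))) - (e i : H →L[ℂ] H)) ξ‖ ≤ _
    rw [hp]; exact (hq2 t i).le

end Polynomials

/-! ### Microstate sequences and Jung's theorem. -/

section Equivalence

variable {A H : Type*} [CStarAlgebra A] [NormedAddCommGroup H] [InnerProductSpace ℂ H]
  [CompleteSpace H]

/-- The self-adjoint tuples `a j` converge to `x` in norm and in moments with respect to the
vector state of `ξ`. -/
structure IsMicrostateSeq (π : A →⋆ₐ[ℂ] (H →L[ℂ] H)) (ξ : H) {n : ℕ} (x : Fin n → A) {m : ℕ → ℕ+}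
    (a : ∀ j, Fin n → Matrix (Fin (m j)) (Fin (m j)) ℂ) : Prop where
  isSelfAdjoint : ∀ j i, IsSelfAdjoint (a j i)
  tendsto_norm : ∀ p, Tendsto (fun j ↦ ‖FreeAlgebra.lift ℂ (a j) p‖) atTop
    (𝓝 ‖FreeAlgebra.lift ℂ x p‖)
  tendsto_ntr : ∀ p, Tendsto (fun j ↦ ntr (FreeAlgebra.lift ℂ (a j) p)) atTop
    (𝓝 (inner ℂ ξ (π (FreeAlgebra.lift ℂ x p) ξ)))

variable {π : A →⋆ₐ[ℂ] (H →L[ℂ] H)} {ξ : H} {n : ℕ} {x : Fin n → A} {m : ℕ → ℕ+}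
  {a b : ∀ j, Fin n → Matrix (Fin (m j)) (Fin (m j)) ℂ}

theorem IsMicrostateSeq.tendsto_hs (ha : IsMicrostateSeq π ξ x a)
    (hsa : ∀ i, IsSelfAdjoint (x i)) (p : FreeAlgebra ℂ (Fin n)) :
    Tendsto (fun j ↦ hs (FreeAlgebra.lift ℂ (a j) p)) atTop
      (𝓝 ‖π (FreeAlgebra.lift ℂ x p) ξ‖) := by
  have h1 := (Complex.continuous_re.tendsto _).comp (ha.tendsto_ntr (polyStar p * p))
  have h2 : (inner ℂ ξ (π (FreeAlgebra.lift ℂ x (polyStar p * p)) ξ)).re =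
      ‖π (FreeAlgebra.lift ℂ x p) ξ‖ ^ 2 := by
    rw [map_mul, ← star_lift hsa, map_mul, map_star, mul_apply_eq_comp,
      ContinuousLinearMap.star_eq_adjoint, ContinuousLinearMap.adjoint_inner_right]
    exact inner_self_eq_norm_sq (𝕜 := ℂ) _
  rw [h2] at h1
  have h3 := (Real.continuous_sqrt.tendsto _).comp h1
  rw [Real.sqrt_sq (norm_nonneg _)] at h3
  refine h3.congr fun j ↦ ?_
  rw [Function.comp_apply, Function.comp_apply, map_mul, ← star_lift (ha.isSelfAdjoint j),
    ntr_star_mul_self, Complex.ofReal_re, Real.sqrt_sq (hs_nonneg _)]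

/-- The tuple `a j` is, on the polynomial `d`, a good approximation of `x`. -/
structure IsGoodAt (π : A →⋆ₐ[ℂ] (H →L[ℂ] H)) (ξ : H) {n k : ℕ} (x : Fin n → A) (η : ℝ)
    (a : Fin n → Matrix (Fin k) (Fin k) ℂ) (d : FreeAlgebra ℂ (Fin n)) : Prop where
  norm_le : ‖FreeAlgebra.lift ℂ a d‖ ≤ ‖FreeAlgebra.lift ℂ x d‖ + 1
  hs_le : hs (FreeAlgebra.lift ℂ a d) ≤ ‖π (FreeAlgebra.lift ℂ x d) ξ‖ + η
  ntr_le : ‖ntr (FreeAlgebra.lift ℂ a d) - inner ℂ ξ (π (FreeAlgebra.lift ℂ x d) ξ)‖ ≤ η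

theorem IsMicrostateSeq.eventually_isGoodAt (ha : IsMicrostateSeq π ξ x a)
    (hsa : ∀ i, IsSelfAdjoint (x i)) {η : ℝ} (hη : 0 < η) (d : FreeAlgebra ℂ (Fin n)) :
    ∀ᶠ j in atTop, IsGoodAt π ξ x η (a j) d := by
  filter_upwards [(ha.tendsto_norm d).eventually_lt_const (lt_add_one _),
    (ha.tendsto_hs hsa d).eventually_lt_const (lt_add_of_pos_right _ hη),
    Metric.tendsto_nhds.1 (ha.tendsto_ntr d) η hη] with j h1 h2 h3
  rw [dist_eq_norm] at h3
  exact ⟨h1.le, h2.le, h3.le⟩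

/-- Linear lifts of a finite-dimensional ⋆-algebra of operators give asymptotic homomorphisms. -/
theorem isAsymptoticHom_of_isGoodAt (h : IsTracialCyclic π ξ) (hsa : ∀ i, IsSelfAdjoint (x i))
    {F : StarSubalgebra ℂ (H →L[ℂ] H)}
    (hF : F ≤ (doubleCommutant π.range).toStarSubalgebra) {d : ℕ} (e : Module.Basis (Fin d) ℂ F)
    {p : ℕ → F →ₗ[ℂ] FreeAlgebra ℂ (Fin n)}
    (hpC : ∀ f, ∃ C, ∀ t, ‖FreeAlgebra.lift ℂ x (p t f)‖ ≤ C)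
    (hp : ∀ f, Tendsto (fun t ↦ ‖(π (FreeAlgebra.lift ℂ x (p t f)) - (f : H →L[ℂ] H)) ξ‖) atTop
        (𝓝 0))
    (hasa : ∀ t i, IsSelfAdjoint (a t i))
    (hone : ∀ t : ℕ, IsGoodAt π ξ x (1 / ((t : ℝ) + 1)) (a t) (p t 1 - 1))
    (hbas : ∀ (t : ℕ) i, IsGoodAt π ξ x (1 / ((t : ℝ) + 1)) (a t) (p t (e i)))
    (hmul : ∀ (t : ℕ) i l, IsGoodAt π ξ x (1 / ((t : ℝ) + 1)) (a t)
      (p t (e i * e l) - p t (e i) * p t (e l)))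
    (hstar : ∀ (t : ℕ) i, IsGoodAt π ξ x (1 / ((t : ℝ) + 1)) (a t)
      (p t (star (e i)) - polyStar (p t (e i)))) :
    IsAsymptoticHom (m := m) fun t ↦ (FreeAlgebra.lift ℂ (a t)).toLinearMap ∘ₗ p t := by
  have hN : ∀ f : F, (f : H →L[ℂ] H) ∈ doubleCommutant π.range := fun f ↦ hF f.2
  have hη : Tendsto (fun t : ℕ ↦ 1 / ((t : ℝ) + 1)) atTop (𝓝 0) :=
    tendsto_one_div_add_atTop_nhds_zero_nat
  have key : ∀ (D : ℕ → FreeAlgebra ℂ (Fin n)),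
      (∀ t : ℕ, IsGoodAt π ξ x (1 / ((t : ℝ) + 1)) (a t) (D t)) →
      Tendsto (fun t ↦ ‖π (FreeAlgebra.lift ℂ x (D t)) ξ‖) atTop (𝓝 0) →
      Tendsto (fun t ↦ hs (FreeAlgebra.lift ℂ (a t) (D t))) atTop (𝓝 0) := fun D hD hlim ↦
    squeeze_zero (fun t ↦ hs_nonneg _) (fun t ↦ (hD t).hs_le) (by simpa using hlim.add hη)
  refine ⟨fun f ↦ ?_, ?_, fun f g ↦ ?_, fun f ↦ ?_⟩
  · choose C hC using hpC
    refine ⟨∑ i, ‖e.repr f i‖ * (C (e i) + 1), fun t ↦ ?_⟩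
    refine (((normSeminorm ℂ (Matrix (Fin (m t)) (Fin (m t)) ℂ)).comp
      ((FreeAlgebra.lift ℂ (a t)).toLinearMap ∘ₗ p t)).le_sum_basis e f).trans ?_
    refine Finset.sum_le_sum fun i _ ↦ mul_le_mul_of_nonneg_left ?_ (norm_nonneg _)
    exact (hbas t i).norm_le.trans (by linarith [hC (e i) t])
  · refine (key (fun t ↦ p t 1 - 1) hone ?_).congr fun t ↦ ?_
    · refine (hp 1).congr fun t ↦ ?_
      rw [map_sub, map_one (FreeAlgebra.lift ℂ x), map_sub, map_one π]; rfl
    · rw [map_sub, map_one (FreeAlgebra.lift ℂ (a t))]; rfl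
  · have hmulb : ∀ i l, Tendsto (fun t ↦ hs (FreeAlgebra.lift ℂ (a t) (p t (e i * e l)) -
        FreeAlgebra.lift ℂ (a t) (p t (e i)) * FreeAlgebra.lift ℂ (a t) (p t (e l)))) atTop
        (𝓝 0) := fun i l ↦ by
      refine (key (fun t ↦ p t (e i * e l) - p t (e i) * p t (e l)) (fun t ↦ hmul t i l) ?_).congr
        fun t ↦ by rw [map_sub, map_mul (FreeAlgebra.lift ℂ (a t))]
      obtain ⟨C, hC⟩ := hpC (e i)
      have hlim : Tendsto (fun t ↦
          ‖(π (FreeAlgebra.lift ℂ x (p t (e i * e l))) - ((e i * e l : F) : H →L[ℂ] H)) ξ‖ +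
          ‖(e l : H →L[ℂ] H)‖ * ‖(π (FreeAlgebra.lift ℂ x (p t (e i))) - (e i : H →L[ℂ] H)) ξ‖ +
          C * ‖(π (FreeAlgebra.lift ℂ x (p t (e l))) - (e l : H →L[ℂ] H)) ξ‖) atTop (𝓝 0) := by
        simpa using ((hp (e i * e l)).add ((hp (e i)).const_mul _)).add ((hp (e l)).const_mul C)
      refine squeeze_zero (fun t ↦ norm_nonneg _) (fun t ↦ ?_) hlim
      rw [map_sub, map_sub, map_mul (FreeAlgebra.lift ℂ x), map_mul π]
      generalize π (FreeAlgebra.lift ℂ x (p t (e i * e l))) = U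
      have hV : π (FreeAlgebra.lift ℂ x (p t (e i))) ∈ doubleCommutant π.range :=
        IsTracialCyclic.map_mem π _
      have hVn : ‖π (FreeAlgebra.lift ℂ x (p t (e i)))‖ ≤ C :=
        (NonUnitalStarAlgHom.norm_apply_le π _).trans (hC t)
      generalize π (FreeAlgebra.lift ℂ x (p t (e i))) = V at hV hVn
      generalize π (FreeAlgebra.lift ℂ x (p t (e l))) = W
      -- In the middle term the error acts on `eₗ ξ` instead of `ξ`; traciality
      -- (`norm_mul_apply_le`) removes `eₗ` at the cost of its norm.
      have h1 : (U - V * W) ξ = (U - ((e i * e l : F) : H →L[ℂ] H)) ξ -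
          (V - (e i : H →L[ℂ] H)) ((e l : H →L[ℂ] H) ξ) -
          V ((W - (e l : H →L[ℂ] H)) ξ) := by
        simp only [sub_apply, mul_apply_eq_comp, MulMemClass.coe_mul, map_sub]
        abel
      rw [h1]
      refine (norm_sub_le _ _).trans (add_le_add ((norm_sub_le _ _).trans (add_le_add le_rfl ?_))
        ((V.le_opNorm _).trans (mul_le_mul_of_nonneg_right hVn (norm_nonneg _))))
      exact h.norm_mul_apply_le (sub_mem hV (hN (e i))) (hN (e l))
    -- The multiplicative defect is bilinear; freezing one argument at a time reduces it to pairs of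
    -- basis elements.
    let L₂ : F → ∀ t, F →ₗ[ℂ] Matrix (Fin (m t)) (Fin (m t)) ℂ := fun f t ↦
      (FreeAlgebra.lift ℂ (a t)).toLinearMap ∘ₗ p t ∘ₗ LinearMap.mulLeft ℂ f -
        LinearMap.mulLeft ℂ (FreeAlgebra.lift ℂ (a t) (p t f)) ∘ₗ
          (FreeAlgebra.lift ℂ (a t)).toLinearMap ∘ₗ p t
    let L₁ : F → ∀ t, F →ₗ[ℂ] Matrix (Fin (m t)) (Fin (m t)) ℂ := fun g t ↦
      (FreeAlgebra.lift ℂ (a t)).toLinearMap ∘ₗ p t ∘ₗ LinearMap.mulRight ℂ g -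
        LinearMap.mulRight ℂ (FreeAlgebra.lift ℂ (a t) (p t g)) ∘ₗ
          (FreeAlgebra.lift ℂ (a t)).toLinearMap ∘ₗ p t
    refine Seminorm.tendsto_zero_of_basis e (q := fun t ↦ (hsSeminorm (m t)).comp (L₂ f t))
      (fun l ↦ ?_) g
    exact Seminorm.tendsto_zero_of_basis e (q := fun t ↦ (hsSeminorm (m t)).comp (L₁ (e l) t))
      (fun i ↦ hmulb i l) f
  -- The ⋆-defect is conjugate-linear; its adjoint is linear and has the same norm.
  · let L : ∀ t, F →ₗ[ℂ] Matrix (Fin (m t)) (Fin (m t)) ℂ := fun t ↦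
      { toFun := fun f ↦ star (FreeAlgebra.lift ℂ (a t) (p t (star f))) -
          FreeAlgebra.lift ℂ (a t) (p t f)
        map_add' := fun f g ↦ by simp only [star_add, map_add]; abel
        map_smul' := fun r f ↦ by
          simp only [star_smul, map_smul, star_star, RingHom.id_apply, smul_sub] }
    have hLs : ∀ t f, hs (FreeAlgebra.lift ℂ (a t) (p t (star f)) -
        star (FreeAlgebra.lift ℂ (a t) (p t f))) = hs (L t f) := fun t f ↦ by
      rw [← hs_star, star_sub, star_star]; rfl
    refine (Seminorm.tendsto_zero_of_basis e (q := fun t ↦ (hsSeminorm (m t)).comp (L t))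
      (fun i ↦ ?_) f).congr fun t ↦ (hLs t f).symm
    refine (key (fun t ↦ p t (star (e i)) - polyStar (p t (e i))) (fun t ↦ hstar t i) ?_).congr
      fun t ↦ ?_
    · have hlim := (hp (star (e i))).add (hp (e i))
      rw [add_zero] at hlim
      refine squeeze_zero (fun t ↦ norm_nonneg _) (fun t ↦ ?_) hlim
      rw [map_sub, map_sub, ← star_lift hsa, map_star π]
      have hV : π (FreeAlgebra.lift ℂ x (p t (e i))) ∈ doubleCommutant π.range :=
        IsTracialCyclic.map_mem π _
      rw [← h.norm_star_apply (sub_mem hV (hN (e i)))]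
      rw [star_sub]
      refine le_trans (le_of_eq ?_) (norm_sub_le _ _)
      congr 1
      simp only [sub_apply, StarMemClass.coe_star]
      abel
    · rw [map_sub, ← star_lift (hasa t)]
      exact hLs t (e i)

/-- Jung's theorem: two sequences of microstates of a hyperfinite trace are approximately
unitarily equivalent. -/
theorem exists_unitary_hs_le (h : IsTracialCyclic π ξ)
    (hyp : IsHyperfinite (doubleCommutant π.range)) (hsa : ∀ i, IsSelfAdjoint (x i))
    (hgen : Generates x) (ha : IsMicrostateSeq π ξ x a) (hb : IsMicrostateSeq π ξ x b) {ω : ℝ}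
    (hω : 0 < ω) :
    ∃ j, ∃ u ∈ unitary (Matrix (Fin (m j)) (Fin (m j)) ℂ),
      ∀ i, hs (u * a j i * star u - b j i) ≤ ω := by
  obtain ⟨F', hmono, hF', hfin, hdense⟩ := hyp
  have hex : ∀ i, ∃ j, ∃ S ∈ F' j, ‖π (x i) ξ - S ξ‖ < ω / 4 := fun i ↦ by
    obtain ⟨j, S, hS, hv⟩ := hdense (π (x i)) (IsTracialCyclic.map_mem π _) {ξ} (ω / 4)
      (by positivity)
    exact ⟨j, S, hS, hv ξ (Finset.mem_singleton_self _)⟩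
  choose J S hS hSω using hex
  obtain ⟨F, hF, hFfin, hSF⟩ : ∃ F : StarSubalgebra ℂ (H →L[ℂ] H),
      F ≤ (doubleCommutant π.range).toStarSubalgebra ∧ FiniteDimensional ℂ F ∧ ∀ i, S i ∈ F :=
    ⟨F' (Finset.univ.sup J), hF' _, hfin _, fun i ↦
      hmono (Finset.le_sup (Finset.mem_univ i)) (hS i)⟩
  let y : Fin n → F := fun i ↦ ⟨S i, hSF i⟩
  obtain ⟨p, hpC, hp⟩ := h.exists_poly_lift hsa hgen hF
  let e := Module.finBasis ℂ F
  let φ : F →ₗ[ℂ] H :=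
    { toFun := fun f ↦ (f : H →L[ℂ] H) ξ, map_add' := fun _ _ ↦ rfl, map_smul' := fun _ _ ↦ rfl }
  have hφ : Function.Injective φ := by
    rw [← LinearMap.ker_eq_bot, LinearMap.ker_eq_bot']
    exact fun f hf ↦ Subtype.ext (h.eq_zero_of_apply_eq_zero (hF f.2) hf)
  obtain ⟨d, c, hc⟩ := exists_isCasimir φ hφ fun f g k ↦ by
    change inner ℂ ((f : H →L[ℂ] H) ((g : H →L[ℂ] H) ξ)) ((k : H →L[ℂ] H) ξ) =
      inner ℂ ((g : H →L[ℂ] H) ξ) (star (f : H →L[ℂ] H) ((k : H →L[ℂ] H) ξ))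
    rw [ContinuousLinearMap.star_eq_adjoint, ContinuousLinearMap.adjoint_inner_right]
  -- For each lift `p t`, finitely many polynomials control the algebraic relations on a basis and
  -- the distance to the generators. A single index `j t` good for all of them, for both sequences,
  -- gives the diagonal sequence.
  let 𝒮 : ℕ → Set (FreeAlgebra ℂ (Fin n)) := fun t ↦
    {p t 1 - 1} ∪ Set.range (fun i ↦ p t (e i)) ∪
    Set.range (fun i : Fin _ × Fin _ ↦ p t (e i.1 * e i.2) - p t (e i.1) * p t (e i.2)) ∪
    Set.range (fun i ↦ p t (star (e i)) - polyStar (p t (e i))) ∪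
    Set.range (fun i ↦ FreeAlgebra.ι ℂ i - p t (y i))
  have h𝒮 : ∀ t, (𝒮 t).Finite := fun t ↦
    ((((Set.finite_singleton _).union (Set.finite_range _)).union (Set.finite_range _)).union
      (Set.finite_range _)).union (Set.finite_range _)
  have hex : ∀ t : ℕ, ∃ j, ∀ d ∈ 𝒮 t, IsGoodAt π ξ x (1 / ((t : ℝ) + 1)) (a j) d ∧
      IsGoodAt π ξ x (1 / ((t : ℝ) + 1)) (b j) d := fun t ↦
    ((eventually_all_finite (h𝒮 t)).2 fun d _ ↦
      (ha.eventually_isGoodAt hsa Nat.one_div_pos_of_nat d).and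
        (hb.eventually_isGoodAt hsa Nat.one_div_pos_of_nat d)).exists
  choose j hj using hex
  have m1 : ∀ t, p t 1 - 1 ∈ 𝒮 t := fun t ↦ .inl (.inl (.inl (.inl rfl)))
  have m2 : ∀ t i, p t (e i) ∈ 𝒮 t := fun t i ↦ .inl (.inl (.inl (.inr ⟨i, rfl⟩)))
  have m3 : ∀ t i l, p t (e i * e l) - p t (e i) * p t (e l) ∈ 𝒮 t := fun t i l ↦
    .inl (.inl (.inr ⟨(i, l), rfl⟩))
  have m4 : ∀ t i, p t (star (e i)) - polyStar (p t (e i)) ∈ 𝒮 t := fun t i ↦ .inl (.inr ⟨i, rfl⟩)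
  have m5 : ∀ t i, FreeAlgebra.ι ℂ i - p t (y i) ∈ 𝒮 t := fun t i ↦ .inr ⟨i, rfl⟩
  have hα := isAsymptoticHom_of_isGoodAt (m := fun t ↦ m (j t)) (a := fun t ↦ a (j t)) h hsa hF e
    hpC hp (fun t ↦ ha.isSelfAdjoint _) (fun t ↦ (hj t _ (m1 t)).1) (fun t i ↦ (hj t _ (m2 t i)).1)
    (fun t i l ↦ (hj t _ (m3 t i l)).1) (fun t i ↦ (hj t _ (m4 t i)).1)
  have hβ := isAsymptoticHom_of_isGoodAt (m := fun t ↦ m (j t)) (a := fun t ↦ b (j t)) h hsa hF e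
    hpC hp (fun t ↦ hb.isSelfAdjoint _) (fun t ↦ (hj t _ (m1 t)).2) (fun t i ↦ (hj t _ (m2 t i)).2)
    (fun t i l ↦ (hj t _ (m3 t i l)).2) (fun t i ↦ (hj t _ (m4 t i)).2)
  have hη : Tendsto (fun t : ℕ ↦ 1 / ((t : ℝ) + 1)) atTop (𝓝 0) :=
    tendsto_one_div_add_atTop_nhds_zero_nat
  have htr : ∀ f : F, Tendsto (fun t ↦ ntr (FreeAlgebra.lift ℂ (b (j t)) (p t f)) -
      ntr (FreeAlgebra.lift ℂ (a (j t)) (p t f))) atTop (𝓝 0) := fun f ↦ by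
    rw [tendsto_zero_iff_norm_tendsto_zero]
    let L : ∀ t, F →ₗ[ℂ] Matrix (Fin (m (j t))) (Fin (m (j t))) ℂ := fun t ↦
      (FreeAlgebra.lift ℂ (b (j t))).toLinearMap ∘ₗ p t -
        (FreeAlgebra.lift ℂ (a (j t))).toLinearMap ∘ₗ p t
    have hL : ∀ t f, ‖ntr (FreeAlgebra.lift ℂ (b (j t)) (p t f)) -
        ntr (FreeAlgebra.lift ℂ (a (j t)) (p t f))‖ = ‖ntr (L t f)‖ := fun t f ↦ by
      rw [← ntr_sub]; rfl
    refine (Seminorm.tendsto_zero_of_basis e (q := fun t ↦ (ntrSeminorm (m (j t))).comp (L t))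
      (fun i ↦ ?_) f).congr fun t ↦ (hL t f).symm
    have hη2 := hη.add hη
    rw [add_zero] at hη2
    refine squeeze_zero (fun t ↦ apply_nonneg _ _) (fun t ↦ ?_) hη2
    refine (hL t (e i)).symm.le.trans ?_
    have h1 := (hj t _ (m2 t i)).1.ntr_le
    have h2 := (hj t _ (m2 t i)).2.ntr_le
    rw [norm_sub_rev] at h1
    exact (norm_sub_le_norm_sub_add_norm_sub _ _ _).trans (add_le_add h2 h1)
  obtain ⟨u, hu, hlim⟩ := hc.exists_unitary_tendsto_hs hα hβ htr
  have hev : ∀ᶠ t : ℕ in atTop, ∀ i, 1 / ((t : ℝ) + 1) < ω / 16 ∧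
      ‖(π (FreeAlgebra.lift ℂ x (p t (y i))) - (y i : H →L[ℂ] H)) ξ‖ < ω / 16 ∧
      hs (u t * FreeAlgebra.lift ℂ (a (j t)) (p t (y i)) * star (u t) -
        FreeAlgebra.lift ℂ (b (j t)) (p t (y i))) < ω / 16 := by
    rw [eventually_all]
    intro i
    have hpos : 0 < ω / 16 := by positivity
    exact (hη.eventually_lt_const hpos).and (((hp (y i)).eventually_lt_const hpos).and
      ((hlim (y i)).eventually_lt_const hpos))
  obtain ⟨t, ht⟩ := hev.exists
  refine ⟨j t, u t, hu t, fun i ↦ ?_⟩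
  obtain ⟨h1, h2, h3⟩ := ht i
  -- With the precision `ω/16` each generator is within `6ω/16` of its image from `F`; two such
  -- errors and `ω/16` for the conjugation total `13ω/16`.
  have h4 : ‖π (FreeAlgebra.lift ℂ x (FreeAlgebra.ι ℂ i - p t (y i))) ξ‖ ≤ ω / 4 + ω / 16 := by
    have : π (FreeAlgebra.lift ℂ x (FreeAlgebra.ι ℂ i - p t (y i))) ξ = (π (x i) ξ - S i ξ) -
        (π (FreeAlgebra.lift ℂ x (p t (y i))) - (y i : H →L[ℂ] H)) ξ := by
      rw [map_sub, map_sub, FreeAlgebra.lift_ι_apply]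
      simp only [sub_apply, y]
      abel
    rw [this]
    exact (norm_sub_le _ _).trans (add_le_add (hSω i).le h2.le)
  have h5 := (hj t _ (m5 t i)).1.hs_le.trans (add_le_add h4 h1.le)
  have h6 := (hj t _ (m5 t i)).2.hs_le.trans (add_le_add h4 h1.le)
  rw [map_sub, FreeAlgebra.lift_ι_apply] at h5 h6
  have h7 : u t * a (j t) i * star (u t) - b (j t) i =
      u t * (a (j t) i - FreeAlgebra.lift ℂ (a (j t)) (p t (y i))) * star (u t) +
      (u t * FreeAlgebra.lift ℂ (a (j t)) (p t (y i)) * star (u t) -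
        FreeAlgebra.lift ℂ (b (j t)) (p t (y i))) -
      (b (j t) i - FreeAlgebra.lift ℂ (b (j t)) (p t (y i))) := by
    noncomm_ring
  rw [h7]
  have h8 := hs_sub_le (u t * (a (j t) i - FreeAlgebra.lift ℂ (a (j t)) (p t (y i))) * star (u t) +
      (u t * FreeAlgebra.lift ℂ (a (j t)) (p t (y i)) * star (u t) -
        FreeAlgebra.lift ℂ (b (j t)) (p t (y i))))
      (b (j t) i - FreeAlgebra.lift ℂ (b (j t)) (p t (y i)))
  have h9 := hs_add_le
    (u t * (a (j t) i - FreeAlgebra.lift ℂ (a (j t)) (p t (y i))) * star (u t))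
    (u t * FreeAlgebra.lift ℂ (a (j t)) (p t (y i)) * star (u t) -
        FreeAlgebra.lift ℂ (b (j t)) (p t (y i)))
  rw [hs_mul_unitary (Unitary.star_mem (hu t)), hs_unitary_mul (hu t)] at h9
  linarith

end Equivalence

/-! ### Microstates lie near finitely many unitary orbits -/

section Orbits

variable {A : Type*} [CStarAlgebra A] {n : ℕ} {x : Fin n → A} {Q : ℕ → FreeAlgebra ℂ (Fin n)}

theorem microstates_subset {R : ℝ} {k : ℕ} {ε ε' : ℝ} {r r' : ℕ} (hε : ε ≤ ε') (hr : r' ≤ r) :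
    microstates x Q R k ε r ⊆ microstates x Q R k ε' r' := fun _ ha ↦
  ⟨ha.1, ha.2.1, fun j hj ↦ (ha.2.2 j (hj.trans_le hr)).trans hε⟩

/-- The indeterminates occur among the `Q j`, so the cutoff `R` plays no part in the bound. -/
theorem exists_index_norm_le_of_mem_microstates (x : Fin n → A)
    (hQ : Set.range Q = complexRationalPolynomials n) :
    ∃ r, ∀ (R : ℝ) (k : ℕ) (ε : ℝ), ∀ a ∈ microstates x Q R k ε r, ∀ i, ‖a i‖ ≤ ‖x i‖ + ε := by
  have h : ∀ i, ∃ j, Q j = FreeAlgebra.ι ℂ i := fun i ↦ by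
    have := ι_mem_complexRationalPolynomials i
    rwa [← hQ] at this
  choose J hJ using h
  refine ⟨Finset.univ.sup J + 1, fun R k ε a ha i ↦ ?_⟩
  have h1 := ha.2.2 (J i) (Nat.lt_succ_of_le (Finset.le_sup (Finset.mem_univ i)))
  rw [hJ, FreeAlgebra.lift_ι_apply, FreeAlgebra.lift_ι_apply] at h1
  linarith [(abs_le.1 h1).2]

/-- The normalized traces of the values of the polynomials `Q`. -/
noncomputable def moments (Q : ℕ → FreeAlgebra ℂ (Fin n)) {k : ℕ}
    (a : Fin n → Matrix (Fin k) (Fin k) ℂ) : ℕ → ℂ := fun r ↦ ntr (FreeAlgebra.lift ℂ a (Q r))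

theorem tendsto_ntr_lift_sub {m : ℕ → ℕ+} {a b : ∀ j, Fin n → Matrix (Fin (m j)) (Fin (m j)) ℂ}
    {ρ : ℝ} (hQ : Set.range Q = complexRationalPolynomials n)
    (hρ : 0 ≤ ρ) (ha : ∀ j i, ‖a j i‖ ≤ ρ) (hb : ∀ j i, ‖b j i‖ ≤ ρ)
    {σ : ℕ → ℂ} (hma : Tendsto (fun j ↦ moments Q (a j)) atTop (𝓝 σ))
    (hmb : Tendsto (fun j ↦ moments Q (b j)) atTop (𝓝 σ)) (p : FreeAlgebra ℂ (Fin n)) :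
    Tendsto (fun j ↦ ntr (FreeAlgebra.lift ℂ (b j) p) - ntr (FreeAlgebra.lift ℂ (a j) p)) atTop
      (𝓝 0) := by
  rw [tendsto_pi_nhds] at hma hmb
  refine tendsto_of_approx fun η hη ↦ ?_
  obtain ⟨q, hq, C, hC, hbd⟩ := exists_complexRational_polyBound_sub hρ p (half_pos hη)
  rw [← hQ] at hq
  obtain ⟨r, rfl⟩ := hq
  refine ⟨_, _, (hmb r).sub (hma r), fun j ↦ ?_, by simpa using hη.le⟩
  have h1 : ∀ c : Fin n → Matrix (Fin (m j)) (Fin (m j)) ℂ, (∀ i, ‖c i‖ ≤ ρ) →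
      ‖ntr (FreeAlgebra.lift ℂ c p) - moments Q c r‖ ≤ η / 2 := fun c hc ↦ by
    rw [moments, ← ntr_sub, ← map_sub]
    exact (norm_ntr_le _).trans ((hs_le_norm _).trans
      ((hbd.norm_lift_le (norm_one_matrix_le _) hρ hc).trans hC))
  rw [sub_sub_sub_comm]
  refine (norm_sub_le _ _).trans ?_
  linarith [h1 _ (ha j), h1 _ (hb j)]

variable [PartialOrder A] [StarOrderedRing A]

/-- By contradiction along a countable neighbourhood basis of `σ`: two sequences of microstates,
both with moments tending to `σ`, induce the same MF-trace. Its von Neumann algebra is hyperfinite,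
so Jung's theorem applies. -/
theorem exists_nhds_unitary_hs_le (hsa : ∀ i, IsSelfAdjoint (x i)) (hgen : Generates x)
    (hnuc : IsMFNuclear x) (hQ : Set.range Q = complexRationalPolynomials n) (R : ℝ) {ω : ℝ}
    (hω : 0 < ω) (σ : ℕ → ℂ) :
    ∃ U ∈ 𝓝 σ, ∃ N : ℕ, ∀ k ≥ N + 1, ∀ a ∈ microstates x Q R k (1 / ((N : ℝ) + 1)) N,
      ∀ b ∈ microstates x Q R k (1 / ((N : ℝ) + 1)) N, moments Q a ∈ U → moments Q b ∈ U →
      ∃ u ∈ unitary (Matrix (Fin k) (Fin k) ℂ), ∀ i, hs (u * a i * star u - b i) ≤ ω := by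
  by_contra! hcon
  obtain ⟨V, hV⟩ := (𝓝 σ).exists_antitone_basis
  choose k hk a ha b hb haV hbV hu using fun j ↦ hcon (V j) (hV.mem j) j
  -- The bound `N + 1` on the size serves to make `k j` positive.
  let m : ℕ → ℕ+ := fun j ↦ ⟨k j, (Nat.succ_pos j).trans_le (hk j)⟩
  obtain ⟨ρ, hρ, hR, hx⟩ : ∃ ρ : ℝ, 0 ≤ ρ ∧ R ≤ ρ ∧ ∀ i, ‖x i‖ ≤ ρ :=
    ⟨|R| + ‖x‖, by positivity, by linarith [le_abs_self R, norm_nonneg x],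
      fun i ↦ (norm_le_pi_norm x i).trans (by linarith [abs_nonneg R])⟩
  have hnorm : ∀ c : ∀ j, Fin n → Matrix (Fin (m j)) (Fin (m j)) ℂ,
      (∀ j, c j ∈ microstates x Q R (k j) (1 / ((j : ℝ) + 1)) j) → ∀ p,
      Tendsto (fun j ↦ ‖FreeAlgebra.lift ℂ (c j) p‖) atTop (𝓝 ‖FreeAlgebra.lift ℂ x p‖) := by
    intro c hc
    refine tendsto_norm_lift hQ hρ hx (fun j i ↦ ((hc j).2.1 i).trans hR) fun r ↦ ?_
    rw [tendsto_iff_norm_sub_tendsto_zero]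
    refine squeeze_zero' (Eventually.of_forall fun j ↦ norm_nonneg _) ?_
      tendsto_one_div_add_atTop_nhds_zero_nat
    filter_upwards [eventually_gt_atTop r] with j hj using (hc j).2.2 r hj
  have hma : Tendsto (fun j ↦ moments Q (a j)) atTop (𝓝 σ) := hV.tendsto haV
  have hmb : Tendsto (fun j ↦ moments Q (b j)) atTop (𝓝 σ) := hV.tendsto hbV
  obtain ⟨τ, hτ, hlim⟩ := exists_isMFTrace (m := m) (a := a) hsa hgen (fun j ↦ (ha j).1)
    (hnorm a ha) (exists_tendsto_ntr_lift (m := m) hQ hρ hx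
      (fun j i ↦ ((ha j).2.1 i).trans hR) fun r ↦ ⟨σ r, (tendsto_pi_nhds.1 hma) r⟩)
  have hτξ : ∀ c, inner ℂ (gnsVector τ) (τ.gnsStarAlgHom c (gnsVector τ)) = τ c := fun c ↦ by
    have := inner_gnsVector τ 1 c
    rwa [map_one, one_apply_eq_self, star_one, one_mul] at this
  have hA : IsMicrostateSeq (m := m) τ.gnsStarAlgHom (gnsVector τ) x a :=
    ⟨fun j ↦ (ha j).1, hnorm a ha, fun p ↦ by rw [hτξ]; exact hlim p⟩
  have hB : IsMicrostateSeq (m := m) τ.gnsStarAlgHom (gnsVector τ) x b := by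
    refine ⟨fun j ↦ (hb j).1, hnorm b hb, fun p ↦ ?_⟩
    rw [hτξ]
    have := (tendsto_ntr_lift_sub (m := m) hQ hρ (fun j i ↦ ((ha j).2.1 i).trans hR)
      (fun j i ↦ ((hb j).2.1 i).trans hR) hma hmb p).add (hlim p)
    simpa using this
  obtain ⟨j, u, huu, hle⟩ := exists_unitary_hs_le (isTracialCyclic_gns hτ.1.2) (hnuc.2 τ hτ) hsa
    hgen hA hB hω
  obtain ⟨i, hi⟩ := hu j u huu
  exact absurd (hle i) (not_le.2 hi)

/-- Up to `ω` in Hilbert–Schmidt norm, the microstates lie in a number of unitary orbits that is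
bounded independently of the size of the matrices. -/
theorem exists_finset_unitary_hs_le (hsa : ∀ i, IsSelfAdjoint (x i)) (hgen : Generates x)
    (hnuc : IsMFNuclear x) (hQ : Set.range Q = complexRationalPolynomials n) (R : ℝ) {ω : ℝ}
    (hω : 0 < ω) :
    ∃ ε > 0, ∃ r M N : ℕ, ∀ k ≥ N, ∃ T : Finset (Fin n → Matrix (Fin k) (Fin k) ℂ),
      T.card ≤ M ∧ (∀ b ∈ T, ∀ i, IsSelfAdjoint (b i) ∧ ‖b i‖ ≤ ‖x‖ + 1) ∧
      ∀ a ∈ microstates x Q R k ε r, (∀ i, ‖a i‖ ≤ ‖x‖ + 1) ∧ ∃ b ∈ T, ∃ u ∈ unitary (Matrix (Fin k) (Fin k) ℂ),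
        ∀ i, hs (u * b i * star u - a i) ≤ ω := by
  classical
  choose U hU N hN using exists_nhds_unitary_hs_le hsa hgen hnuc hQ R hω
  choose B hB using fun r ↦ exists_polyBound (max R 0) (Q r)
  -- The moments of all microstates, of every size, lie in one compact product of discs (Tychonoff),
  -- covered by finitely many of the neighbourhoods `U σ`.
  obtain ⟨t, -, ht⟩ := (isCompact_univ_pi fun r : ℕ ↦
    isCompact_closedBall (0 : ℂ) (B r)).elim_nhds_subcover U fun σ _ ↦ hU σ
  obtain ⟨r₀, hr₀⟩ := exists_index_norm_le_of_mem_microstates x hQ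
  let N' := max r₀ (t.sup N)
  refine ⟨1 / ((N' : ℝ) + 1), Nat.one_div_pos_of_nat, N', t.card, N' + 1, fun k hk ↦ ?_⟩
  let Γ := microstates x Q R k (1 / ((N' : ℝ) + 1)) N'
  have hε : 1 / ((N' : ℝ) + 1) ≤ 1 := by
    rw [div_le_one (by positivity)]
    linarith [Nat.cast_nonneg (α := ℝ) N']
  -- One microstate per occupied neighbourhood represents its orbit. The default `0` still satisfies
  -- the self-adjointness and norm requirements on `T`.
  let rep : (ℕ → ℂ) → (Fin n → Matrix (Fin k) (Fin k) ℂ) := fun σ ↦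
    if h : ∃ a ∈ Γ, moments Q a ∈ U σ then h.choose else 0
  have hnorm : ∀ a ∈ Γ, ∀ i, ‖a i‖ ≤ ‖x‖ + 1 := fun a ha i ↦
    (hr₀ _ _ _ _ (microstates_subset le_rfl (le_max_left _ _) ha) i).trans
      (add_le_add (norm_le_pi_norm x i) hε)
  refine ⟨t.image rep, Finset.card_image_le, fun b hb i ↦ ?_, fun a ha ↦ ?_⟩
  · obtain ⟨σ, hσ, rfl⟩ := Finset.mem_image.1 hb
    simp only [rep]
    split_ifs with h
    · exact ⟨h.choose_spec.1.1 i, hnorm _ h.choose_spec.1 i⟩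
    · rw [Pi.zero_apply, norm_zero]
      exact ⟨.zero _, by positivity⟩
  · have hmem : moments Q a ∈ Set.univ.pi fun r : ℕ ↦ Metric.closedBall (0 : ℂ) (B r) := by
      intro r _
      rw [mem_closedBall_zero_iff]
      exact (norm_ntr_le _).trans ((hs_le_norm _).trans ((hB r).norm_lift_le (norm_one_matrix_le _)
        (le_max_right _ _) fun i ↦ (ha.2.1 i).trans (le_max_left _ _)))
    obtain ⟨σ, hσ, haσ⟩ := Set.mem_iUnion₂.1 (ht hmem)
    have h : ∃ a ∈ Γ, moments Q a ∈ U σ := ⟨a, ha, haσ⟩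
    have hrep : rep σ = h.choose := dif_pos h
    refine ⟨hnorm a ha, rep σ, Finset.mem_image_of_mem _ hσ, ?_⟩
    have hNσ : N σ ≤ N' := (Finset.le_sup hσ).trans (le_max_right _ _)
    have hsub : Γ ⊆ microstates x Q R k (1 / ((N σ : ℝ) + 1)) (N σ) :=
      microstates_subset (Nat.one_div_le_one_div hNσ) hNσ
    rw [hrep]
    exact hN σ k (by omega) _ (hsub h.choose_spec.1) a (hsub ha) h.choose_spec.2 haσ

end Orbits

/-! ### Covering estimates -/

section Nets

open MeasureTheory in
-- Compare Haar volumes: disjoint balls of radius `η / 2` fit into one of radius `R + η / 2`.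
theorem card_le_of_separated {E : Type*} [NormedAddCommGroup E] [NormedSpace ℝ E]
    [FiniteDimensional ℝ E] {R η : ℝ} (hR : 0 ≤ R) (hη : 0 < η) (s : Finset E)
    (hs : ∀ c ∈ s, ‖c‖ ≤ R) (h : ∀ c ∈ s, ∀ d ∈ s, c ≠ d → η ≤ ‖c - d‖) :
    (s.card : ℝ) ≤ (1 + 2 * R / η) ^ Module.finrank ℝ E := by
  borelize E
  let μ : Measure E := Measure.addHaar
  have hη2 : 0 < η / 2 := by positivity
  have hρ : 0 < R + η / 2 := by positivity
  have hdisj : Set.PairwiseDisjoint (s : Set E) fun c ↦ Metric.ball c (η / 2) := by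
    rintro c hc d hd hcd
    refine Metric.ball_disjoint_ball ?_
    rw [dist_eq_norm, add_halves]
    exact h c hc d hd hcd
  have hsub : (⋃ c ∈ s, Metric.ball c (η / 2)) ⊆ Metric.ball (0 : E) (R + η / 2) := by
    refine Set.iUnion₂_subset fun c hc ↦ Metric.ball_subset_ball' ?_
    rw [dist_zero_right]
    linarith [hs c hc]
  have hI : (s.card : ℝ≥0∞) * ENNReal.ofReal ((η / 2) ^ Module.finrank ℝ E) *
      μ (Metric.ball 0 1) ≤
      ENNReal.ofReal ((R + η / 2) ^ Module.finrank ℝ E) * μ (Metric.ball 0 1) := by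
    rw [← μ.addHaar_ball_of_pos _ hρ]
    refine le_trans (le_of_eq ?_) (measure_mono hsub)
    rw [measure_biUnion_finset hdisj fun c _ ↦ measurableSet_ball]
    simp only [μ.addHaar_ball_of_pos _ hη2, Finset.sum_const, nsmul_eq_mul, mul_assoc]
  have hJ := (ENNReal.mul_le_mul_iff_left (Metric.measure_ball_pos μ 0 zero_lt_one).ne'
    measure_ball_lt_top.ne).1 hI
  have hK := ENNReal.toReal_le_of_le_ofReal (pow_nonneg hρ.le _) hJ
  rw [ENNReal.toReal_mul, ENNReal.toReal_natCast, ENNReal.toReal_ofReal (by positivity),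
    ← le_div_iff₀ (by positivity), ← div_pow] at hK
  refine hK.trans_eq ?_
  congr 1
  field_simp
  ring

/-- A ball of a `d`-dimensional real normed space has an `η`-net of at most `(1 + 2 R / η) ^ d`
elements. -/
theorem exists_net_ball (E : Type*) [NormedAddCommGroup E] [NormedSpace ℝ E]
    [FiniteDimensional ℝ E] {R η : ℝ} (hR : 0 ≤ R) (hη : 0 < η) :
    ∃ t : Finset E, (t.card : ℝ) ≤ (1 + 2 * R / η) ^ Module.finrank ℝ E ∧ (∀ c ∈ t, ‖c‖ ≤ R) ∧
      ∀ v : E, ‖v‖ ≤ R → ∃ c ∈ t, ‖v - c‖ ≤ η := by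
  classical
  let P : ℕ → Prop := fun N ↦ ∃ t : Finset E, t.card = N ∧ (∀ c ∈ t, ‖c‖ ≤ R) ∧
    ∀ c ∈ t, ∀ d ∈ t, c ≠ d → η ≤ ‖c - d‖
  obtain ⟨K, hK⟩ := exists_nat_ge ((1 + 2 * R / η) ^ Module.finrank ℝ E)
  have hbd : ∀ N, P N → N ≤ K := by
    rintro N ⟨t, rfl, h1, h2⟩
    exact_mod_cast (card_le_of_separated hR hη t h1 h2).trans hK
  have h0 : P 0 := ⟨∅, by simp⟩
  -- A separated set of greatest cardinality is a net, since any point far from it could be added.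
  obtain ⟨t, ht, h1, h2⟩ := Nat.findGreatest_spec (P := P) (Nat.zero_le K) h0
  refine ⟨t, card_le_of_separated hR hη t h1 h2, h1, fun v hv ↦ ?_⟩
  by_contra! hcon
  have hvt : v ∉ t := fun hvt ↦ by
    have := hcon v hvt
    rw [sub_self, norm_zero] at this
    exact absurd this hη.not_gt
  have h3 : P (t.card + 1) := by
    refine ⟨insert v t, Finset.card_insert_of_notMem hvt, ?_, ?_⟩
    · intro c hc
      rcases Finset.mem_insert.1 hc with rfl | hc
      exacts [hv, h1 c hc]
    · intro c hc d hd hcd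
      rcases Finset.mem_insert.1 hc with rfl | hc' <;> rcases Finset.mem_insert.1 hd with rfl | hd'
      · exact absurd rfl hcd
      · exact (hcon d hd').le
      · rw [norm_sub_rev]; exact (hcon c hc').le
      · exact h2 c hc' d hd' hcd
  have h4 := Nat.le_findGreatest (hbd _ h3) h3
  omega

end Nets

/-! ### Nets in the unitary group. -/

section Unitary

variable {k : ℕ}

theorem finrank_selfAdjoint_le :
    Module.finrank ℝ (selfAdjoint (Matrix (Fin k) (Fin k) ℂ)) ≤ k ^ 2 := by
  -- For a self-adjoint matrix, the entries at `(i, j)` and `(j, i)` are conjugate, so the sums `re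
  -- + im` at both places recover the real and imaginary parts.
  let f : selfAdjoint (Matrix (Fin k) (Fin k) ℂ) →ₗ[ℝ] Matrix (Fin k) (Fin k) ℝ :=
    { toFun := fun H ↦ Matrix.of fun i j ↦ (H.1 i j).re + (H.1 i j).im
      map_add' := fun H K ↦ by ext i j; simp; ring
      map_smul' := fun r H ↦ by ext i j; simp; ring }
  have hf : Function.Injective f := by
    rw [← LinearMap.ker_eq_bot, LinearMap.ker_eq_bot']
    intro H hH
    ext i j
    have h1 : (H.1 i j).re + (H.1 i j).im = 0 := congrFun (congrFun hH i) j
    have h2 : (H.1 j i).re + (H.1 j i).im = 0 := congrFun (congrFun hH j) i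
    have h3 : star (H.1 j i) = H.1 i j := congrFun (congrFun H.2.star_eq i) j
    rw [← h3] at h1 ⊢
    simp only [Complex.star_def, Complex.conj_re, Complex.conj_im] at h1
    refine Complex.ext ?_ ?_
    · simp; linarith
    · simp; linarith
  refine (LinearMap.finrank_le_finrank_of_injective hf).trans_eq ?_
  rw [Module.finrank_matrix]
  simp [sq]

instance : FiniteDimensional ℝ (selfAdjoint (Matrix (Fin k) (Fin k) ℂ)) :=
  inferInstanceAs (FiniteDimensional ℝ (selfAdjoint.submodule ℝ (Matrix (Fin k) (Fin k) ℂ)))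

/-- On the unit circle `i arg z = log z`, so only continuity of `arg` on the spectrum is at stake. A
matrix has finite spectrum, hence every unitary matrix is an exponential. -/
theorem expUnitary_argSelfAdjoint_of_continuousOn {A : Type*} [CStarAlgebra A] {u : unitary A}
    (h : ContinuousOn Complex.arg (spectrum ℂ (u : A))) :
    selfAdjoint.expUnitary (Unitary.argSelfAdjoint u) = u := by
  ext
  rw [selfAdjoint.expUnitary_coe, Unitary.argSelfAdjoint_coe,
    ← CFC.exp_eq_normedSpace_exp (𝕜 := ℂ), ← cfc_comp_smul .., ← cfc_comp' ..]
  conv_rhs => rw [← cfc_id' ℂ (u : A)]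
  refine cfc_congr fun y hy ↦ ?_
  have hy₁ : ‖y‖ = 1 := spectrum.norm_eq_one_of_unitary u.2 hy
  have : Complex.I * y.arg = Complex.log y :=
    Complex.ext (by simp [Complex.log_re, hy₁]) (by simp [Complex.log_im])
  have h0 : y ≠ 0 := by rintro rfl; simp at hy₁
  simpa [← Complex.exp_eq_exp_ℂ, this] using Complex.exp_log h0

theorem exists_expUnitary_eq (u : unitary (Matrix (Fin k) (Fin k) ℂ)) :
    ∃ H : selfAdjoint (Matrix (Fin k) (Fin k) ℂ), ‖H‖ ≤ Real.pi ∧ selfAdjoint.expUnitary H = u :=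
  ⟨Unitary.argSelfAdjoint u, Unitary.norm_argSelfAdjoint_le_pi u,
    expUnitary_argSelfAdjoint_of_continuousOn ((Matrix.finite_spectrum _).continuousOn _)⟩

/-- Duhamel's interpolation `exp(t X) exp((1 - t) Y)` has derivative `exp(t X) (X - Y) exp((1 - t)
Y)`, whose outer factors are unitary. -/
theorem norm_expUnitary_sub_le (H K : selfAdjoint (Matrix (Fin k) (Fin k) ℂ)) :
    ‖(selfAdjoint.expUnitary H - selfAdjoint.expUnitary K : Matrix (Fin k) (Fin k) ℂ)‖ ≤
      ‖H - K‖ := by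
  let X : Matrix (Fin k) (Fin k) ℂ := Complex.I • (H : Matrix (Fin k) (Fin k) ℂ)
  let Y : Matrix (Fin k) (Fin k) ℂ := Complex.I • (K : Matrix (Fin k) (Fin k) ℂ)
  have hexp : ∀ (L : selfAdjoint (Matrix (Fin k) (Fin k) ℂ)) (t : ℝ),
      ‖NormedSpace.exp (t • (Complex.I • (L : Matrix (Fin k) (Fin k) ℂ)))‖ ≤ 1 := fun L t ↦ by
    have : t • (Complex.I • (L : Matrix (Fin k) (Fin k) ℂ)) =
        Complex.I • ((t • L : selfAdjoint (Matrix (Fin k) (Fin k) ℂ)) :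
          Matrix (Fin k) (Fin k) ℂ) := by
      rw [selfAdjoint.val_smul, smul_comm]
    rw [this, ← selfAdjoint.expUnitary_coe]
    exact norm_le_one_of_mem_unitary (selfAdjoint.expUnitary _).2
  let f : ℝ → Matrix (Fin k) (Fin k) ℂ := fun t ↦
    NormedSpace.exp (t • X) * NormedSpace.exp ((1 - t) • Y)
  have hf : ∀ t : ℝ, HasDerivAt f (NormedSpace.exp (t • X) * (X - Y) *
      NormedSpace.exp ((1 - t) • Y)) t := fun t ↦ by
    have h1 := hasDerivAt_exp_smul_const (𝕂 := ℝ) X t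
    have h2 := (hasDerivAt_exp_smul_const' (𝕂 := ℝ) Y (1 - t)).scomp t
      ((hasDerivAt_const t (1 : ℝ)).sub (hasDerivAt_id t))
    have h3 := h1.mul h2
    refine h3.congr_deriv ?_
    simp only [Function.comp_apply, zero_sub, neg_smul, one_smul]
    noncomm_ring
  have hle := norm_image_sub_le_of_norm_deriv_le_segment_01' (f := f) (C := ‖X - Y‖)
    (fun t _ ↦ (hf t).hasDerivWithinAt) fun t _ ↦ by
      refine (norm_mul_le _ _).trans ?_
      refine (mul_le_mul (norm_mul_le _ _) (hexp K _) (norm_nonneg _) (by positivity)).trans ?_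
      rw [mul_one]
      exact mul_le_of_le_one_left (norm_nonneg _) (hexp H t)
  have h0 : f 0 = selfAdjoint.expUnitary K := by
    simp [f, Y, selfAdjoint.expUnitary_coe]
  have h1 : f 1 = selfAdjoint.expUnitary H := by
    simp [f, X, selfAdjoint.expUnitary_coe]
  rw [h0, h1] at hle
  refine hle.trans_eq ?_
  rw [← smul_sub, norm_smul, Complex.norm_I, one_mul]
  rfl

/-- The unitary group `U(k)` has an `η`-net of at most `(1 + 2 π / η) ^ k²` elements. -/
theorem exists_net_unitary (k : ℕ) {η : ℝ} (hη : 0 < η) :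
    ∃ t : Finset (Matrix (Fin k) (Fin k) ℂ), (t.card : ℝ) ≤ (1 + 2 * Real.pi / η) ^ k ^ 2 ∧
      (∀ v ∈ t, v ∈ unitary (Matrix (Fin k) (Fin k) ℂ)) ∧
      ∀ u ∈ unitary (Matrix (Fin k) (Fin k) ℂ), ∃ v ∈ t, ‖u - v‖ ≤ η := by
  classical
  obtain ⟨t, ht, -, hnet⟩ := exists_net_ball (selfAdjoint (Matrix (Fin k) (Fin k) ℂ))
    Real.pi_pos.le hη
  refine ⟨t.image fun H ↦ (selfAdjoint.expUnitary H : Matrix (Fin k) (Fin k) ℂ), ?_, ?_, ?_⟩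
  · refine le_trans (by exact_mod_cast Finset.card_image_le) (ht.trans ?_)
    refine pow_le_pow_right₀ ?_ finrank_selfAdjoint_le
    have := Real.pi_pos
    exact le_add_of_nonneg_right (by positivity)
  · intro v hv
    obtain ⟨H, -, rfl⟩ := Finset.mem_image.1 hv
    exact (selfAdjoint.expUnitary H).2
  · intro u hu
    obtain ⟨H, hH, hHu⟩ := exists_expUnitary_eq ⟨u, hu⟩
    obtain ⟨K, hK, hle⟩ := hnet H hH
    refine ⟨_, Finset.mem_image_of_mem _ hK, ?_⟩
    have : u = (selfAdjoint.expUnitary H : Matrix (Fin k) (Fin k) ℂ) := by rw [hHu]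
    rw [this]
    exact (norm_expUnitary_sub_le H K).trans hle

end Unitary

/-! ### Low-rank approximation and nets for small Hilbert–Schmidt balls. -/

section LowRank

open Matrix

/-- Up to operator norm `η`, a self-adjoint matrix is the product of two matrices with few columns
if its Hilbert–Schmidt norm is small compared with `η`. -/
theorem exists_low_rank_approx {k : ℕ} {d : Matrix (Fin k) (Fin k) ℂ} (hd : IsSelfAdjoint d)
    {η : ℝ} (hη : 0 ≤ η) :
    ∃ (S : Finset (Fin k)) (X Z : Matrix (Fin k) S ℂ), S.card * η ^ 2 ≤ k * hs d ^ 2 ∧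
      ‖X‖ ≤ ‖d‖ ∧ ‖Z‖ ≤ 1 ∧ ‖d - X * Zᴴ‖ ≤ η := by
  have hH : d.IsHermitian := hd
  let U : Matrix (Fin k) (Fin k) ℂ := hH.eigenvectorUnitary
  let v : Fin k → ℂ := fun i ↦ (hH.eigenvalues i : ℂ)
  let D : Matrix (Fin k) (Fin k) ℂ := diagonal v
  have hU : U ∈ unitary (Matrix (Fin k) (Fin k) ℂ) := hH.eigenvectorUnitary.2
  have hUU : star U * U = 1 := Unitary.star_mul_self_of_mem hU
  have hdU : d = U * D * star U := hH.spectral_theorem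
  -- The large eigenvalues, counted by Chebyshev's inequality. `U * E` has the corresponding
  -- eigenvectors as columns, so `d * (U * E) * (U * E)ᴴ` is `d` cut down to their span.
  let S : Finset (Fin k) := Finset.univ.filter fun i ↦ η < ‖v i‖
  let E : Matrix (Fin k) S ℂ := (1 : Matrix (Fin k) (Fin k) ℂ).submatrix id Subtype.val
  have hEE : Eᴴ * E = 1 := by
    rw [conjTranspose_submatrix, conjTranspose_one, ← submatrix_mul _ _ _ _ _ Function.bijective_id,
      Matrix.one_mul, submatrix_one _ Subtype.val_injective]
  have hEE' : E * Eᴴ = diagonal fun i ↦ if i ∈ S then 1 else 0 := by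
    ext i j
    rw [mul_apply, diagonal_apply]
    have h1 : ∀ l : S, E i l * Eᴴ l j = if (l : Fin k) = i then (if i = j then 1 else 0) else 0 := by
      intro l
      simp only [E, submatrix_apply, conjTranspose_apply, one_apply, id]
      by_cases h : (l : Fin k) = i
      · subst h
        by_cases h' : (l : Fin k) = j
        · simp [h']
        · simp [h', Ne.symm h']
      · simp [h, Ne.symm h]
    rw [Finset.sum_congr rfl fun l _ ↦ h1 l]
    rw [Finset.sum_coe_sort S fun l ↦ if l = i then (if i = j then (1 : ℂ) else 0) else 0,
      Finset.sum_ite_eq']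
    by_cases h : i ∈ S <;> by_cases h' : i = j <;> simp [h, h']
  have hE1 : ‖E‖ ≤ 1 := by
    have h1 := l2_opNorm_conjTranspose_mul_self E
    have h2 : ‖(1 : Matrix S S ℂ)‖ ≤ 1 := by
      rw [← diagonal_one, l2_opNorm_diagonal]
      refine (pi_norm_le_iff_of_nonneg zero_le_one).2 fun i ↦ ?_
      simp
    rw [hEE] at h1
    nlinarith [norm_nonneg E]
  have hZ : ‖U * E‖ ≤ 1 := (l2_opNorm_mul U E).trans
    (mul_le_one₀ (norm_le_one_of_mem_unitary hU) (norm_nonneg _) hE1)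
  refine ⟨S, d * (U * E), U * E, ?_, ?_, hZ, ?_⟩
  · have h1 : hs d = hs D := by
      rw [hdU, hs_mul_unitary (Unitary.star_mem hU), hs_unitary_mul hU]
    have h2 : (k : ℝ) * hs D ^ 2 = ∑ i, ‖v i‖ ^ 2 := by
      have hk : ‖vecE D‖ ^ 2 = ∑ i, ‖v i‖ ^ 2 := by
        rw [norm_sq_vecE]
        refine Finset.sum_congr rfl fun j _ ↦ ?_
        rw [Finset.sum_eq_single j]
        · simp [D]
        · intro i _ hij
          simp [D, diagonal_apply_ne _ hij]
        · simp
      rcases Nat.eq_zero_or_pos k with h0 | h0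
      · subst h0; simp
      · rw [hs, div_pow, Real.sq_sqrt (Nat.cast_nonneg _), hk]
        field_simp
    rw [h1, h2]
    calc (S.card : ℝ) * η ^ 2 = ∑ _i ∈ S, η ^ 2 := by simp
      _ ≤ ∑ i ∈ S, ‖v i‖ ^ 2 := Finset.sum_le_sum fun i hi ↦
        pow_le_pow_left₀ hη (Finset.mem_filter.1 hi).2.le 2
      _ ≤ ∑ i, ‖v i‖ ^ 2 :=
        Finset.sum_le_univ_sum_of_nonneg fun i ↦ by positivity
  · exact (l2_opNorm_mul _ _).trans (mul_le_of_le_one_right (norm_nonneg _) hZ)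
  · have h1 : d - d * (U * E) * (U * E)ᴴ =
        U * diagonal (fun i ↦ if i ∈ S then 0 else v i) * star U := by
      have h2 : d * (U * E) * (U * E)ᴴ = U * (D * (E * Eᴴ)) * star U := by
        rw [conjTranspose_mul, hdU, ← star_eq_conjTranspose U]
        calc U * D * star U * (U * E) * (Eᴴ * star U)
            = U * D * (star U * U) * E * (Eᴴ * star U) := by simp only [Matrix.mul_assoc]
          _ = _ := by rw [hUU, Matrix.mul_one]; simp only [Matrix.mul_assoc]
      rw [h2, hEE']
      conv_lhs => rw [hdU]
      rw [← Matrix.sub_mul, ← Matrix.mul_sub, diagonal_mul_diagonal, diagonal_sub]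
      congr 3
      ext i
      by_cases h : i ∈ S <;> simp [h]
    rw [h1]
    refine (norm_mul_le _ _).trans ?_
    refine (mul_le_of_le_one_right (norm_nonneg _)
      (norm_le_one_of_mem_unitary (Unitary.star_mem hU))).trans ?_
    refine (norm_mul_le _ _).trans ?_
    refine (mul_le_of_le_one_left (norm_nonneg _) (norm_le_one_of_mem_unitary hU)).trans ?_
    rw [l2_opNorm_diagonal]
    refine (pi_norm_le_iff_of_nonneg hη).2 fun i ↦ ?_
    by_cases h : i ∈ S
    · simpa [h] using hη
    · rw [if_neg h]
      exact not_lt.1 fun h' ↦ h (Finset.mem_filter.2 ⟨Finset.mem_univ _, h'⟩)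

/-- Products of net points for the two factors form the net. Each factor has `2 k |S|` real
coordinates, whence the exponent `4 k |S|`. -/
theorem exists_net_low_rank {k : ℕ} (S : Finset (Fin k)) {B η : ℝ} (hB : 1 ≤ B) (hη : 0 < η) :
    ∃ t : Finset (Matrix (Fin k) (Fin k) ℂ),
      (t.card : ℝ) ≤ ((1 + 4 * B ^ 2 / η) ^ 4) ^ (k * S.card) ∧
      ∀ X Z : Matrix (Fin k) S ℂ, ‖X‖ ≤ B → ‖Z‖ ≤ 1 → ∃ c ∈ t, ‖X * Zᴴ - c‖ ≤ η := by
  classical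
  have hB0 : 0 < B := by linarith
  obtain ⟨t, ht, htB, hnet⟩ := exists_net_ball (Matrix (Fin k) S ℂ) hB0.le
    (η := η / (2 * B)) (by positivity)
  have hfr : Module.finrank ℝ (Matrix (Fin k) S ℂ) = k * S.card * 2 := by
    rw [Module.finrank_matrix, Complex.finrank_real_complex, Fintype.card_fin, Fintype.card_coe]
  refine ⟨(t ×ˢ t).image fun p ↦ p.1 * p.2ᴴ, ?_, fun X Z hX hZ ↦ ?_⟩
  · have h1 : (((t ×ˢ t).image fun p ↦ p.1 * p.2ᴴ).card : ℝ) ≤ (t.card : ℝ) * t.card := by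
      rw [← Nat.cast_mul, ← Finset.card_product]
      exact_mod_cast Finset.card_image_le
    refine h1.trans ((mul_le_mul ht ht (Nat.cast_nonneg _) (by positivity)).trans_eq ?_)
    rw [hfr, show 2 * B / (η / (2 * B)) = 4 * B ^ 2 / η by field_simp; ring, ← pow_add, ← pow_mul]
    congr 1
    ring
  · obtain ⟨X', hX', hXX'⟩ := hnet X hX
    obtain ⟨Z', hZ', hZZ'⟩ := hnet Z (hZ.trans hB)
    refine ⟨_, Finset.mem_image_of_mem _ (Finset.mk_mem_product hX' hZ'), ?_⟩
    have h1 : X * Zᴴ - X' * Z'ᴴ = (X - X') * Zᴴ + X' * (Z - Z')ᴴ := by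
      rw [conjTranspose_sub, Matrix.sub_mul, Matrix.mul_sub]; abel
    have h2 : ‖(X - X') * Zᴴ‖ ≤ η / (2 * B) * 1 := (l2_opNorm_mul _ _).trans
      (mul_le_mul hXX' (by rwa [l2_opNorm_conjTranspose]) (norm_nonneg _) (by positivity))
    have h3 : ‖X' * (Z - Z')ᴴ‖ ≤ B * (η / (2 * B)) := (l2_opNorm_mul _ _).trans
      (mul_le_mul (htB X' hX') (by rwa [l2_opNorm_conjTranspose]) (norm_nonneg _) hB0.le)
    have h4 : B * (η / (2 * B)) = η / 2 := by field_simp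
    have h5 : η / (2 * B) ≤ η / 2 := by gcongr; linarith
    change ‖X * Zᴴ - X' * Z'ᴴ‖ ≤ η
    rw [h1]
    refine (norm_add_le _ _).trans ?_
    linarith

/-- The self-adjoint matrices of norm at most `B` and of very small Hilbert–Schmidt norm have an
operator-norm net of at most `4 ^ k²` elements. -/
theorem exists_net_hs_ball {B η : ℝ} (hB : 1 ≤ B) (hη : 0 < η) :
    ∃ ω > 0, ∀ k : ℕ, ∃ t : Finset (Matrix (Fin k) (Fin k) ℂ), (t.card : ℝ) ≤ 4 ^ k ^ 2 ∧
      ∀ d : Matrix (Fin k) (Fin k) ℂ, IsSelfAdjoint d → ‖d‖ ≤ B → hs d ≤ ω →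
        ∃ c ∈ t, ‖d - c‖ ≤ 2 * η := by
  classical
  let b : ℝ := (1 + 4 * B ^ 2 / η) ^ 4
  have hb : 1 ≤ b := one_le_pow₀ (le_add_of_nonneg_right (by positivity))
  -- If `q |S| ≤ k`, the net for `S` has at most `b ^ (k |S|) ≤ 2 ^ k²` points; `hs d ≤ η / √q`
  -- guarantees such an `S`. Summing over at most `2 ^ k` sets `S` gives `4 ^ k²`.
  obtain ⟨q, hq⟩ := pow_unbounded_of_one_lt b (one_lt_two)
  have hq0 : 0 < q := by
    rcases Nat.eq_zero_or_pos q with rfl | h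
    · rw [pow_zero] at hq; linarith
    · exact h
  have hqr : (0 : ℝ) < q := by exact_mod_cast hq0
  refine ⟨η / √q, by positivity, fun k ↦ ?_⟩
  choose t ht hnet using fun S : Finset (Fin k) ↦ exists_net_low_rank S hB hη
  refine ⟨(Finset.univ.filter fun S : Finset (Fin k) ↦ q * S.card ≤ k).biUnion t, ?_, ?_⟩
  · have h1 : ∀ S ∈ Finset.univ.filter (fun S : Finset (Fin k) ↦ q * S.card ≤ k),
        ((t S).card : ℝ) ≤ 2 ^ k ^ 2 := fun S hS ↦ by
      refine (ht S).trans ((pow_le_pow_left₀ (by positivity) hq.le _).trans ?_)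
      rw [← pow_mul]
      refine pow_le_pow_right₀ one_le_two ?_
      have := (Finset.mem_filter.1 hS).2
      nlinarith
    have h2 : (((Finset.univ.filter fun S : Finset (Fin k) ↦ q * S.card ≤ k).biUnion t).card : ℝ) ≤
        ∑ S ∈ Finset.univ.filter (fun S : Finset (Fin k) ↦ q * S.card ≤ k), ((t S).card : ℝ) := by
      exact_mod_cast Finset.card_biUnion_le
    refine h2.trans ((Finset.sum_le_sum h1).trans ?_)
    rw [Finset.sum_const, nsmul_eq_mul]
    have h3 : ((Finset.univ.filter fun S : Finset (Fin k) ↦ q * S.card ≤ k).card : ℝ) ≤ 2 ^ k := by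
      have := Finset.card_filter_le (Finset.univ : Finset (Finset (Fin k))) fun S ↦ q * S.card ≤ k
      rw [Finset.card_univ, Fintype.card_finset, Fintype.card_fin] at this
      exact_mod_cast this
    have h4 : (2 : ℝ) ^ k ≤ 2 ^ k ^ 2 := pow_le_pow_right₀ one_le_two (Nat.le_self_pow two_ne_zero k)
    calc _ ≤ (2 : ℝ) ^ k ^ 2 * 2 ^ k ^ 2 := by gcongr; exact h3.trans h4
      _ = 4 ^ k ^ 2 := by rw [← mul_pow]; norm_num
  · intro d hd hdB hdω
    obtain ⟨S, X, Z, hS, hX, hZ, hle⟩ := exists_low_rank_approx hd hη.le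
    have hSk : q * S.card ≤ k := by
      have h1 : hs d ^ 2 ≤ η ^ 2 / q := by
        refine (pow_le_pow_left₀ (hs_nonneg d) hdω 2).trans_eq ?_
        rw [div_pow, Real.sq_sqrt hqr.le]
      have h2 : (S.card : ℝ) * η ^ 2 ≤ k * (η ^ 2 / q) :=
        hS.trans (mul_le_mul_of_nonneg_left h1 (Nat.cast_nonneg _))
      have h3 : (q : ℝ) * S.card ≤ k := by
        rw [← mul_div_assoc, le_div_iff₀ hqr] at h2
        have : 0 < η ^ 2 := by positivity
        nlinarith
      exact_mod_cast h3
    obtain ⟨c, hc, hcle⟩ := hnet S X Z (hX.trans hdB) hZ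
    refine ⟨c, Finset.mem_biUnion.2 ⟨S, Finset.mem_filter.2 ⟨Finset.mem_univ _, hSk⟩, hc⟩, ?_⟩
    have h1 : d - c = (d - X * Zᴴ) + (X * Zᴴ - c) := by abel
    rw [h1]
    exact (norm_add_le _ _).trans (by linarith)

end LowRank

/-! ### The bound on the topological free entropy dimension -/

section Dimension

/-- Centres must lie in `K`: each useful net point is replaced by a nearby point of `K`, which
doubles the radius. -/
theorem coveringNumber_le_card {n k : ℕ} {K : Set (Fin n → Matrix (Fin k) (Fin k) ℂ)} {ω η : ℝ}
    (t : Finset (Fin n → Matrix (Fin k) (Fin k) ℂ)) (hη : 2 * η < ω)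
    (h : ∀ a ∈ K, ∃ c ∈ t, ‖a - c‖ ≤ η) : coveringNumber K ω ≤ t.card := by
  classical
  let rep : (Fin n → Matrix (Fin k) (Fin k) ℂ) → (Fin n → Matrix (Fin k) (Fin k) ℂ) := fun c ↦
    if h : ∃ a ∈ K, ‖a - c‖ ≤ η then h.choose else 0
  let t' := (t.filter fun c ↦ ∃ a ∈ K, ‖a - c‖ ≤ η).image rep
  have hrep : ∀ c, (∃ a ∈ K, ‖a - c‖ ≤ η) → rep c ∈ K ∧ ‖rep c - c‖ ≤ η := fun c hc ↦ by
    have : rep c = hc.choose := dif_pos hc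
    rw [this]; exact hc.choose_spec
  have hsub : (t' : Set (Fin n → Matrix (Fin k) (Fin k) ℂ)) ⊆ K := by
    intro b hb
    obtain ⟨c, hc, rfl⟩ := Finset.mem_image.1 (Finset.mem_coe.1 hb)
    exact (hrep c (Finset.mem_filter.1 hc).2).1
  have hcov : K ⊆ ⋃ b ∈ (t' : Set (Fin n → Matrix (Fin k) (Fin k) ℂ)), Metric.ball b ω := by
    intro a ha
    obtain ⟨c, hc, hac⟩ := h a ha
    have hex : ∃ a ∈ K, ‖a - c‖ ≤ η := ⟨a, ha, hac⟩
    refine Set.mem_iUnion₂.2 ⟨rep c,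
      Finset.mem_image_of_mem _ (Finset.mem_filter.2 ⟨hc, hex⟩), ?_⟩
    rw [mem_ball_iff_norm]
    have h1 : a - rep c = (a - c) - (rep c - c) := by abel
    rw [h1]
    have := norm_sub_le (a - c) (rep c - c)
    have := (hrep c hex).2
    linarith
  rw [coveringNumber]
  refine (iInf_le_of_le (t' : Set _) (iInf₂_le_of_le hsub hcov le_rfl)).trans ?_
  rw [Set.encard_coe_eq_coe_finsetCard]
  exact_mod_cast Finset.card_image_le.trans (Finset.card_filter_le _ _)

theorem norm_conj_sub_conj_le {k : ℕ} {u v b : Matrix (Fin k) (Fin k) ℂ} (hu : u ∈ unitary _)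
    (hv : v ∈ unitary _) : ‖u * b * star u - v * b * star v‖ ≤ 2 * ‖u - v‖ * ‖b‖ := by
  have h1 : u * b * star u - v * b * star v = (u - v) * b * star u + v * b * star (u - v) := by
    rw [star_sub]; noncomm_ring
  have h2 : ‖(u - v) * b * star u‖ ≤ ‖u - v‖ * ‖b‖ := (norm_mul_le _ _).trans
    ((mul_le_of_le_one_right (norm_nonneg _)
      (norm_le_one_of_mem_unitary (Unitary.star_mem hu))).trans (norm_mul_le _ _))
  have h3 : ‖v * b * star (u - v)‖ ≤ ‖b‖ * ‖u - v‖ := by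
    refine (norm_mul_le _ _).trans ?_
    rw [norm_star]
    exact mul_le_mul_of_nonneg_right ((norm_mul_le _ _).trans
      (mul_le_of_le_one_left (norm_nonneg _) (norm_le_one_of_mem_unitary hv))) (norm_nonneg _)
  rw [h1]
  refine (norm_add_le _ _).trans ?_
  linarith

variable {A : Type*} [CStarAlgebra A] [PartialOrder A] [StarOrderedRing A] {n : ℕ} {x : Fin n → A}
  {Q : ℕ → FreeAlgebra ℂ (Fin n)}

/-- A microstate is encoded by an orbit representative (at most `M`), a unitary from a net (the only
factor involving `ω ^ (-k²)`), and `n` small Hilbert–Schmidt errors (together `(4 ^ n) ^ k²`). -/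
theorem exists_coveringNumber_le (hsa : ∀ i, IsSelfAdjoint (x i)) (hgen : Generates x)
    (hnuc : IsMFNuclear x) (hQ : Set.range Q = complexRationalPolynomials n) (R : ℝ) {ω : ℝ}
    (hω : 0 < ω) (hω1 : ω ≤ 1) :
    ∃ ε > 0, ∃ r M N : ℕ, ∀ k ≥ N, ∃ C : ℕ, coveringNumber (microstates x Q R k ε r) ω ≤ C ∧
      (C : ℝ) ≤ M * (4 ^ n * (1 + 32 * Real.pi * (‖x‖ + 1)) / ω) ^ k ^ 2 := by
  classical
  have hρ : 1 ≤ ‖x‖ + 1 := le_add_of_nonneg_left (norm_nonneg _)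
  obtain ⟨ρ, hρx⟩ : ∃ ρ, ρ = ‖x‖ + 1 := ⟨_, rfl⟩
  rw [← hρx] at hρ ⊢
  have hρ0 : 0 < ρ := by linarith
  -- `2 ρ` bounds the difference of a microstate and a conjugated representative. The error net and
  -- the unitary net each contribute `ω / 8`; the total `ω / 4` stays below `ω / 2` as the
  -- recentering requires.
  obtain ⟨ω₁, hω₁, hball⟩ := exists_net_hs_ball (B := 2 * ρ) (η := ω / 16) (by linarith)
    (by positivity)
  obtain ⟨ε, hε, r, M, N, hT⟩ := exists_finset_unitary_hs_le hsa hgen hnuc hQ R hω₁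
  rw [← hρx] at hT
  refine ⟨ε, hε, r, M, N, fun k hk ↦ ?_⟩
  obtain ⟨T, hTM, hTb, hTa⟩ := hT k hk
  obtain ⟨V, hV, hVu, hVnet⟩ := exists_net_unitary k (η := ω / (16 * ρ)) (by positivity)
  obtain ⟨W, hW, hWnet⟩ := hball k
  let F : Finset (Fin n → Matrix (Fin k) (Fin k) ℂ) := Fintype.piFinset fun _ ↦ W
  let t : Finset (Fin n → Matrix (Fin k) (Fin k) ℂ) :=
    (T ×ˢ V ×ˢ F).image fun p i ↦ p.2.1 * p.1 i * star p.2.1 + p.2.2 i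
  refine ⟨t.card, coveringNumber_le_card (η := ω / 4) t (by linarith) fun a ha ↦ ?_, ?_⟩
  · obtain ⟨han, b, hb, u, hu, hub⟩ := hTa a ha
    obtain ⟨v, hv, huv⟩ := hVnet u hu
    have hex : ∀ i, ∃ c ∈ W, ‖(a i - u * b i * star u) - c‖ ≤ 2 * (ω / 16) := fun i ↦ by
      refine hWnet _ ((ha.1 i).sub ((hTb b hb i).1.conjugate u)) ?_ ?_
      · refine (norm_sub_le _ _).trans ?_
        have h1 : ‖u * b i * star u‖ ≤ ρ := by
          refine (norm_mul_le _ _).trans ((mul_le_of_le_one_right (norm_nonneg _)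
            (norm_le_one_of_mem_unitary (Unitary.star_mem hu))).trans ?_)
          exact (norm_mul_le _ _).trans ((mul_le_of_le_one_left (norm_nonneg _)
            (norm_le_one_of_mem_unitary hu)).trans (hTb b hb i).2)
        linarith [han i]
      · rw [hs_sub_comm]; exact hub i
    choose c hc hac using hex
    refine ⟨_, Finset.mem_image_of_mem _ (a := (b, v, c)) ?_, ?_⟩
    · exact Finset.mk_mem_product hb (Finset.mk_mem_product hv (Fintype.mem_piFinset.2 hc))
    · refine (pi_norm_le_iff_of_nonneg (by positivity)).2 fun i ↦ ?_
      have h1 : a i - (v * b i * star v + c i) =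
          (u * b i * star u - v * b i * star v) + ((a i - u * b i * star u) - c i) := by abel
      have h2 : 2 * ‖u - v‖ * ‖b i‖ ≤ 2 * (ω / (16 * ρ)) * ρ :=
        mul_le_mul (by linarith) (hTb b hb i).2 (norm_nonneg _) (by positivity)
      have h3 : 2 * (ω / (16 * ρ)) * ρ = ω / 8 := by field_simp; norm_num
      change ‖a i - (v * b i * star v + c i)‖ ≤ ω / 4
      rw [h1]
      refine (norm_add_le _ _).trans ?_
      linarith [norm_conj_sub_conj_le (b := b i) hu (hVu v hv), hac i]
  · have h1 : (t.card : ℝ) ≤ T.card * (V.card * F.card) := by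
      rw [← Nat.cast_mul, ← Nat.cast_mul, ← Finset.card_product, ← Finset.card_product]
      exact_mod_cast Finset.card_image_le
    have h2 : (F.card : ℝ) ≤ (4 ^ n) ^ k ^ 2 := by
      rw [Fintype.card_piFinset, Finset.prod_const, Finset.card_univ, Fintype.card_fin, ← pow_mul,
        mul_comm n, pow_mul, Nat.cast_pow]
      exact pow_le_pow_left₀ (Nat.cast_nonneg _) hW n
    have h3 : (V.card : ℝ) ≤ ((1 + 32 * Real.pi * ρ) / ω) ^ k ^ 2 := by
      have hpi := Real.pi_pos
      refine hV.trans (pow_le_pow_left₀ (by positivity) ?_ _)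
      rw [add_div, show 2 * Real.pi / (ω / (16 * ρ)) = 32 * Real.pi * ρ / ω by field_simp; norm_num]
      have := (one_le_div hω).2 hω1
      linarith
    have h4 : (T.card : ℝ) ≤ M := by exact_mod_cast hTM
    refine h1.trans (mul_le_mul h4 ?_ (by positivity) (Nat.cast_nonneg _))
    rw [mul_div_assoc, mul_pow, mul_comm]
    exact mul_le_mul h2 h3 (Nat.cast_nonneg _) (by positivity)

theorem deltaTopAt_le (hsa : ∀ i, IsSelfAdjoint (x i)) (hgen : Generates x)
    (hnuc : IsMFNuclear x) (hQ : Set.range Q = complexRationalPolynomials n) {K : ℝ}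
    (hK : K = 4 ^ n * (1 + 32 * Real.pi * (‖x‖ + 1))) {ω : ℝ} (hω : 0 < ω) (hω1 : ω < 1) :
    deltaTopAt x Q ω ≤
      (((Real.log (2 * K) - Real.log ω) / (-Real.log ω) : ℝ) : EReal) := by
  have hpi := Real.pi_pos
  have hK0 : 0 < K := by rw [hK]; positivity
  have hlog : Real.log ω < 0 := Real.log_neg hω hω1
  refine iSup₂_le fun R _ ↦ ?_
  obtain ⟨ε, hε, r, M, N, hC⟩ := exists_coveringNumber_le hsa hgen hnuc hQ R hω hω1.le
  rw [← hK] at hC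
  refine iInf₂_le_of_le ε hε (iInf_le_of_le r ?_)
  refine limsup_le_of_le (by isBoundedDefault) ?_
  -- For `k ≥ M` the number of orbits is absorbed, `M ≤ 2 ^ k²`, which turns `K` into `2 K`; `k ≥ 1`
  -- makes the denominator nonzero.
  filter_upwards [eventually_ge_atTop N, eventually_ge_atTop M, eventually_ge_atTop 1]
    with k hkN hkM hk1
  obtain ⟨C, hcov, hCle⟩ := hC k hkN
  have hkr : (0 : ℝ) < k := by exact_mod_cast hk1
  have hle : (C : ℝ) ≤ (2 * K / ω) ^ k ^ 2 := by
    refine hCle.trans ?_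
    rw [mul_div_assoc, mul_pow]
    refine mul_le_mul_of_nonneg_right ?_ (by positivity)
    have h1 : M ≤ 2 ^ k ^ 2 :=
      hkM.trans ((Nat.le_self_pow two_ne_zero k).trans Nat.lt_two_pow_self.le)
    exact_mod_cast h1
  have h1 : ((coveringNumber (microstates x Q R k ε r) ω : ℕ∞) : ℝ≥0∞) ≤
      ENNReal.ofReal ((2 * K / ω) ^ k ^ 2) := by
    refine (ENat.toENNReal_le.2 hcov).trans ?_
    rw [ENat.toENNReal_coe, ← ENNReal.ofReal_natCast]
    exact ENNReal.ofReal_le_ofReal hle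
  have h2 : ENNReal.log (ENNReal.ofReal ((2 * K / ω) ^ k ^ 2)) =
      ((k ^ 2 * (Real.log (2 * K) - Real.log ω) : ℝ) : EReal) := by
    rw [ENNReal.log_ofReal_of_pos (by positivity), Real.log_pow,
      Real.log_div (by positivity) hω.ne', Nat.cast_pow]
  have h3 : 0 ≤ -((k : ℝ) ^ 2 * Real.log ω) := by
    have : 0 < (k : ℝ) ^ 2 := by positivity
    nlinarith
  refine (EReal.div_le_div_right_of_nonneg (EReal.coe_nonneg.2 h3)
    (ENNReal.log_monotone h1)).trans_eq ?_
  rw [h2, ← EReal.coe_div]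
  congr 1
  have hlog' := hlog.ne
  field_simp

theorem deltaTop_le_one (hsa : ∀ i, IsSelfAdjoint (x i)) (hgen : Generates x)
    (hnuc : IsMFNuclear x) (hQ : Set.range Q = complexRationalPolynomials n) :
    deltaTop x Q ≤ 1 := by
  obtain ⟨K, hK⟩ : ∃ K : ℝ, K = 4 ^ n * (1 + 32 * Real.pi * (‖x‖ + 1)) := ⟨_, rfl⟩
  have hlim : Tendsto (fun ω : ℝ ↦ (Real.log (2 * K) - Real.log ω) / (-Real.log ω)) (𝓝[>] 0)
      (𝓝 1) := by
    -- `K` does not depend on `ω`, so only the contribution `1` of the unitary group survives.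
    have h1 : Tendsto (fun ω : ℝ ↦ Real.log (2 * K) / (-Real.log ω) + 1) (𝓝[>] 0) (𝓝 (0 + 1)) :=
      ((tendsto_neg_atBot_atTop.comp Real.tendsto_log_nhdsGT_zero).const_div_atTop _).add_const 1
    rw [zero_add] at h1
    refine h1.congr' ?_
    filter_upwards [Ioo_mem_nhdsGT (zero_lt_one (α := ℝ))] with ω hω
    have hlog : Real.log ω ≠ 0 := (Real.log_neg hω.1 hω.2).ne
    field_simp
    ring
  have hlim' := (continuous_coe_real_ereal.tendsto 1).comp hlim
  rw [EReal.coe_one] at hlim'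
  rw [← hlim'.limsup_eq]
  refine limsup_le_limsup ?_
  filter_upwards [Ioo_mem_nhdsGT (zero_lt_one (α := ℝ))] with ω hω
  exact deltaTopAt_le hsa hgen hnuc hQ hK hω.1 hω.2

end Dimension

end TopFreeEntropy

theorem theorem3p3 {A : Type*} [CStarAlgebra A] [PartialOrder A] [StarOrderedRing A]
    {n : ℕ} (x : Fin n → A) (hsa : ∀ i, IsSelfAdjoint (x i))
    (hgen : TopFreeEntropy.Generates x) (hnuc : TopFreeEntropy.IsMFNuclear x)
    (Q : ℕ → FreeAlgebra ℂ (Fin n))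
    (hQ : Set.range Q = TopFreeEntropy.complexRationalPolynomials n) :
    TopFreeEntropy.deltaTop x Q ≤ 1 := by
  exact TopFreeEntropy.deltaTop_le_one hsa hgen hnuc hQ
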